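/- Consider the two-dimensional cubic-quintic nonlinear Schrödinger equation $$(i\partial_t+\Delta)u=-|u|^2u+|u|^4u,\qquad (t,x)\in[0,\infty)\times\mathbb{R}^2. \tag{NLS}$$ A solution means a function $u\in C([0,\infty);H^1(\mathbb{R}^2))$ that satisfies (NLS) in the sense of distributions; it is radial if each $u(t)$ is a function of $|x|$, and $H^1$-bounded if $\sup_{t\ge 0}\|u(t)\|_{H^1}<\infty$. Fix a smooth function $\phi:\mathbb{R}^2\to[0,1]$ with $\phi(x)=1$ for $|x|\le 1$ and $\phi(x)=0$ for $|x|>2$, and put $\chi_R(x)=\phi(x/R)$ for $R>0$. **Proposition.** (i) For every $M$ there is a constant $K>0$, depending only on $M$ and $\phi$, such that for every radial solution $u$ of (NLS) with $\sup_{t\ge0}\|u(t)\|_{H^1}\le M$ and all $T,R>0$, $$\int_0^T\!\!\int_{\mathbb{R}^2}\Bigl\{\chi_R|\nabla u|^2-\tfrac12|u|^4+\tfrac23|u|^6\Bigr\}\,dx\,dt\le K\,(R+R^{-1}T).$$ (ii) Let $u$ be a radial, $H^1$-bounded solution of (NLS) with $\|u\|_{L^4_{t,x}([0,\infty)\times\mathbb{R}^2)}=\infty$,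 and let $\lambda:[0,\infty)\to[1,\infty)$ be a scale function for $u$, that is, $\{\lambda(t)u(t,\lambda(t)x):t\in[0,\infty)\}$ is pre-compact in $L^2(\mathbb{R}^2)$. Then for every $C>0$ there is a sequence of times $t_n\ge 0$, $t_n\to\infty$, such that $$\limsup_{n\to\infty}\int_{\mathbb{R}^2}\tfrac12\chi_{C\lambda(t_n)}|\nabla u(t_n,x)|^2-\tfrac14|u(t_n,x)|^4+\tfrac16|u(t_n,x)|^6\,dx\le 0.$$ In both parts the spatial integrands are integrable, and in (i) the spatial integral is an integrable function of $t\in[0,T]$. -/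

import Mathlib

open MeasureTheory Filter Topology Set
open scoped ContDiff

namespace CubicQuintic

/-- The plane `ℝ²` with the Euclidean norm and Lebesgue measure. -/
abbrev Plane : Type := EuclideanSpace ℝ (Fin 2)

/-- The `j`-th classical partial derivative of a real-valued function on the plane. -/
noncomputable def pderiv (j : Fin 2) (η : Plane → ℝ) (x : Plane) : ℝ :=
  fderiv ℝ η x (EuclideanSpace.single j 1)

/-- Test functions `C_c^∞(ℝ²)`; real-valued ones suffice, by linearity. -/
def IsTest (η : Plane → ℝ) : Prop :=
  ContDiff ℝ ∞ η ∧ HasCompactSupport η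

/-- `g` is the weak (distributional) gradient of `f`. -/
def IsWeakGradient (f : Plane → ℂ) (g : Plane → EuclideanSpace ℂ (Fin 2)) : Prop :=
  ∀ η : Plane → ℝ, IsTest η → ∀ j : Fin 2,
    ∫ x, pderiv j η x • f x = - ∫ x, η x • g x j

theorem IsTest.memLp {η : Plane → ℝ} (hη : IsTest η) : MemLp η 2 volume :=
  hη.1.continuous.memLp_of_hasCompactSupport hη.2

theorem IsTest.memLp_pderiv {η : Plane → ℝ} (hη : IsTest η) (j : Fin 2) :
    MemLp (pderiv j η) 2 volume := by
  have hc : Continuous (pderiv j η) :=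
    (hη.1.continuous_fderiv (by simp)).clm_apply continuous_const
  refine hc.memLp_of_hasCompactSupport ?_
  exact (hη.2.fderiv (𝕜 := ℝ)).comp_left
    (g := fun L : Plane →L[ℝ] ℝ => L (EuclideanSpace.single j 1)) (by simp)

theorem integrable_smul_of_memLp {η : Plane → ℝ} {f : Plane → ℂ} (hη : MemLp η 2 volume)
    (hf : MemLp f 2 volume) : Integrable (fun x => η x • f x) volume :=
  memLp_one_iff_integrable.1 (hf.smul hη)

theorem memLp_coord (g : Lp (EuclideanSpace ℂ (Fin 2)) 2 (volume : Measure Plane)) (j : Fin 2) :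
    MemLp (fun x => g x j) 2 volume :=
  (Lp.memLp g).continuousLinearMap_comp (EuclideanSpace.proj (𝕜 := ℂ) j)

/-- The Sobolev space `H¹(ℝ²; ℂ)`, as the space of pairs `(f, ∇f)` of `L²` functions with `∇f` the
weak gradient of `f`. The norm inherited from the ambient space is
`‖f‖_{H¹} = (‖f‖_{L²}² + ‖∇f‖_{L²}²)^{1/2}`. -/
noncomputable def H1 : Submodule ℂ (WithLp 2 (Lp ℂ 2 (volume : Measure Plane) ×
    Lp (EuclideanSpace ℂ (Fin 2)) 2 (volume : Measure Plane))) where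
  carrier := {p | IsWeakGradient p.fst p.snd}
  zero_mem' := by
    intro η _ j
    have h1 : (fun x => pderiv j η x • (0 : Lp ℂ 2 (volume : Measure Plane)) x) =ᵐ[volume] 0 := by
      filter_upwards [Lp.coeFn_zero ℂ 2 (volume : Measure Plane)] with x hx
      rw [hx]
      simp
    have h2 : (fun x => η x • (0 : Lp (EuclideanSpace ℂ (Fin 2)) 2 (volume : Measure Plane)) x j)
        =ᵐ[volume] 0 := by
      filter_upwards [Lp.coeFn_zero (EuclideanSpace ℂ (Fin 2)) 2 (volume : Measure Plane)]
        with x hx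
      rw [hx]
      simp
    rw [WithLp.zero_fst, WithLp.zero_snd, integral_congr_ae h1, integral_congr_ae h2]
    simp
  add_mem' := by
    intro p q hp hq η hη j
    have h1 : (fun x => pderiv j η x • (p.fst + q.fst) x) =ᵐ[volume]
        fun x => pderiv j η x • p.fst x + pderiv j η x • q.fst x := by
      filter_upwards [Lp.coeFn_add p.fst q.fst] with x hx
      rw [hx, Pi.add_apply, smul_add]
    have h2 : (fun x => η x • (p.snd + q.snd) x j) =ᵐ[volume]
        fun x => η x • p.snd x j + η x • q.snd x j := by
      filter_upwards [Lp.coeFn_add p.snd q.snd] with x hx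
      rw [hx, Pi.add_apply, PiLp.add_apply, smul_add]
    rw [WithLp.add_fst, WithLp.add_snd, integral_congr_ae h1, integral_congr_ae h2,
      integral_add (integrable_smul_of_memLp (hη.memLp_pderiv j) (Lp.memLp _))
        (integrable_smul_of_memLp (hη.memLp_pderiv j) (Lp.memLp _)),
      integral_add (integrable_smul_of_memLp hη.memLp (memLp_coord _ j))
        (integrable_smul_of_memLp hη.memLp (memLp_coord _ j)), hp η hη j, hq η hη j]
    ring
  smul_mem' := by
    intro c p hp η hη j
    have h1 : (fun x => pderiv j η x • (c • p.fst) x) =ᵐ[volume]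
        fun x => c * (pderiv j η x • p.fst x) := by
      filter_upwards [Lp.coeFn_smul c p.fst] with x hx
      simp [hx, mul_left_comm]
    have h2 : (fun x => η x • (c • p.snd) x j) =ᵐ[volume]
        fun x => c * (η x • p.snd x j) := by
      filter_upwards [Lp.coeFn_smul c p.snd] with x hx
      simp [hx, mul_left_comm]
    rw [WithLp.smul_fst, WithLp.smul_snd, integral_congr_ae h1, integral_congr_ae h2,
      integral_const_mul, integral_const_mul, hp η hη j]
    ring

/-- The function underlying an element of `H¹`. -/
noncomputable def fn (v : H1) : Plane → ℂ := v.1.fst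

/-- The weak gradient of an element of `H¹`. -/
noncomputable def grad (v : H1) : Plane → EuclideanSpace ℂ (Fin 2) := v.1.snd

/-- `v` is radial: it is (almost everywhere) a function of `|x|`. -/
def IsRadial (v : H1) : Prop :=
  ∃ f : ℝ → ℂ, ∀ᵐ x : Plane, fn v x = f ‖x‖

/-- The nonlinearity `-|z|²z + |z|⁴z`. -/
noncomputable def nonlin (z : ℂ) : ℂ := -((‖z‖ : ℂ) ^ 2 * z) + (‖z‖ : ℂ) ^ 4 * z

/-- `u` is a forward-global (`t ≥ 0`) `H¹` solution of `(i∂ₜ + Δ)u = -|u|²u + |u|⁴u`: it belongs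
to `C([0,∞); H¹)` and the equation, integrated in time, holds in the sense of distributions.
Values `u t` with `t < 0` are irrelevant. -/
structure IsSolution (u : ℝ → H1) : Prop where
  continuousOn : ContinuousOn u (Ici 0)
  equation : ∀ η : Plane → ℝ, IsTest η → ∀ t : ℝ, 0 ≤ t →
    Complex.I * ((∫ x, η x • fn (u t) x) - ∫ x, η x • fn (u 0) x) =
      ∫ s in (0 : ℝ)..t,
        ((∫ x, ∑ j : Fin 2, pderiv j η x • grad (u s) x j) +
          ∫ x, η x • nonlin (fn (u s) x))

/-- The bound `‖u‖_{L_t^∞ H_x^1([0,∞)×ℝ²)} ≤ M`. -/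
def BoundedBy (u : ℝ → H1) (M : ℝ) : Prop := ∀ t : ℝ, 0 ≤ t → ‖u t‖ ≤ M

/-- `‖u‖_{L^4_{t,x}([0,∞)×ℝ²)} = ∞`. -/
def InfiniteL4 (u : ℝ → H1) : Prop :=
  ∫⁻ t in Ici (0 : ℝ), ∫⁻ x, ‖fn (u t) x‖ₑ ^ 4 = ⊤

/-- `lam : [0,∞) → [1,∞)` is a scale function for `u`: the orbit
`{lam(t) u(t, lam(t) x) : t ≥ 0}` is pre-compact in `L²(ℝ²)`. -/
def IsScaleFunction (u : ℝ → H1) (lam : ℝ → ℝ) : Prop :=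
  (∀ t : ℝ, 0 ≤ t → 1 ≤ lam t) ∧
    IsCompact (closure {g : Lp ℂ 2 (volume : Measure Plane) |
      ∃ t : ℝ, 0 ≤ t ∧ g =ᵐ[volume] fun x => (lam t : ℂ) * fn (u t) (lam t • x)})

/-- `φ` is a smooth cutoff to the unit disc. -/
structure IsCutoff (φ : Plane → ℝ) : Prop where
  smooth : ContDiff ℝ ∞ φ
  nonneg : ∀ x, 0 ≤ φ x
  le_one : ∀ x, φ x ≤ 1
  eq_one : ∀ x, ‖x‖ ≤ 1 → φ x = 1
  eq_zero : ∀ x, 2 < ‖x‖ → φ x = 0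

/-- The rescaled cutoff `χ_R(x) = φ(x/R)` to `{|x| ≤ R}`. -/
noncomputable def cutoff (φ : Plane → ℝ) (R : ℝ) (x : Plane) : ℝ := φ (R⁻¹ • x)

/-- The density `χ_R|∇v|² - ½|v|⁴ + ⅔|v|⁶`. -/
noncomputable def virialDensity (φ : Plane → ℝ) (R : ℝ) (v : H1) (x : Plane) : ℝ :=
  cutoff φ R x * ‖grad v x‖ ^ 2 - 1 / 2 * ‖fn v x‖ ^ 4 + 2 / 3 * ‖fn v x‖ ^ 6

/-- The localized energy density `½χ_R|∇v|² - ¼|v|⁴ + ⅙|v|⁶`. -/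
noncomputable def energyDensity (φ : Plane → ℝ) (R : ℝ) (v : H1) (x : Plane) : ℝ :=
  1 / 2 * cutoff φ R x * ‖grad v x‖ ^ 2 - 1 / 4 * ‖fn v x‖ ^ 4 + 1 / 6 * ‖fn v x‖ ^ 6

end CubicQuintic

namespace CubicQuintic

/-! ### Classical partial derivatives and test functions -/

/-! Part (i) is a localized virial estimate. For a compactly supported field `X`, the momentum `Im ∫
ū X·∇u` has time derivative `2 Re ∫ ∂ⱼXₖ ∂ⱼu ∂ₖū + Re ∫ u ∇(div X)·∇ū + ∫ div X (-½|u|⁴ + ⅔|u|⁶)`,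
which for `X = x` would be twice the virial functional. The field used is `x` on `|x| ≤ 2R` and `3R
x/|x|` from `|x| = 3R` on, until it is truncated very far out. Its Jacobian has eigenvalues `f(r)/r`
and `f'(r)`, where `f` is the radial component; both are nonnegative except in the truncation
region, where `f' ≥ -δ`. The truncation radius enters no other bound, so `δ = 1/R` is allowed. The
remaining errors are `O(1/R)` per unit time: `∇ div X = O(1/R)`, and outside `|x| ≤ 2R` the radial
Sobolev inequality gives `|u|² = O(1/R)`. Since `|X| = O(R)`, the momentum is `O(R)`, and
integration in time gives the bound (`exists_virial_bound`).

An `H¹` solution is too rough for the formal computation. The equation is therefore mollified in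
space: the mollified solution is smooth in space, differentiable in time, and solves the linear
equation forced by the mollified nonlinearity. The identities are integrated in time and the
mollification removed (`RealSol.virial_frc`, `RealSol.mass_flux`); the nonlinear term is then
simplified by density of smooth functions (`frc_nonlinear`).

Part (ii) is a contradiction with mass conservation (`Trapped.false`). Suppose that the localized
energy exceeds `δ > 0` at all times after `t₀`. Twice that energy is at most the virial functional
at any radius `R ≥ 2Cλ(t)`, so the latter exceeds `2δ` whenever the scale is small against `R`. When
the scale is large, compactness makes `u(t)` close in `L²` to a spread profile of height `O(1/λ)`,
so `∫|u|⁴` is small. With `R = εT`, the virial estimate then forces `∫₀ᵀ∫|u|⁴ = o(T)`. With `R`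
proportional to `T`, it also forces some `t ≤ T` with `λ(t) ≥ cT`.

At such a time, test the equation against an `L²`-normalized dilation of a test function at scale `r
≥ cT`. The Laplacian contributes `O(T/r²)` and the nonlinearity at most `r⁻¹ o(T)`, while the
initial datum is asymptotically orthogonal to spreading profiles; so the pairing with `u(t)` is
`o(1)`. By compactness `u(t)` is itself approximated by such profiles at scale `λ(t)`, hence its
mass is `o(1)`. Mass conservation then makes the solution vanish, and so does its energy. -/

theorem contDiff_pderiv {f : Plane → ℝ} (hf : ContDiff ℝ ∞ f) (j : Fin 2) :
    ContDiff ℝ ∞ (pderiv j f) :=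
  (hf.fderiv_right (m := ∞) (by simp)).clm_apply contDiff_const

theorem pderiv_add {f g : Plane → ℝ} {x : Plane} (hf : DifferentiableAt ℝ f x)
    (hg : DifferentiableAt ℝ g x) (j : Fin 2) :
    pderiv j (fun y => f y + g y) x = pderiv j f x + pderiv j g x := by
  simp [pderiv, fderiv_fun_add hf hg]

theorem pderiv_sub {f g : Plane → ℝ} {x : Plane} (hf : DifferentiableAt ℝ f x)
    (hg : DifferentiableAt ℝ g x) (j : Fin 2) :
    pderiv j (fun y => f y - g y) x = pderiv j f x - pderiv j g x := by
  simp [pderiv, fderiv_fun_sub hf hg]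

theorem pderiv_mul {f g : Plane → ℝ} {x : Plane} (hf : DifferentiableAt ℝ f x)
    (hg : DifferentiableAt ℝ g x) (j : Fin 2) :
    pderiv j (fun y => f y * g y) x = pderiv j f x * g x + f x * pderiv j g x := by
  simp [pderiv, fderiv_fun_mul hf hg]
  ring

theorem pderiv_const_mul {f : Plane → ℝ} {x : Plane} (hf : DifferentiableAt ℝ f x) (c : ℝ)
    (j : Fin 2) : pderiv j (fun y => c * f y) x = c * pderiv j f x := by
  simp [pderiv, fderiv_const_mul hf]

theorem pderiv_pow {f : Plane → ℝ} {x : Plane} (hf : DifferentiableAt ℝ f x) (n : ℕ)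
    (j : Fin 2) : pderiv j (fun y => f y ^ n) x = n * f x ^ (n - 1) * pderiv j f x := by
  simp [pderiv, fderiv_fun_pow n hf]

theorem pderiv_comp_smul {f : Plane → ℝ} (c : ℝ) (x : Plane) (j : Fin 2)
    (hf : DifferentiableAt ℝ f (c • x)) :
    pderiv j (fun y => f (c • y)) x = c * pderiv j f (c • x) := by
  have h1 : HasFDerivAt (fun y : Plane => c • y) (c • ContinuousLinearMap.id ℝ Plane) x :=
    (hasFDerivAt_id x).const_smul c
  have := (hf.hasFDerivAt.comp x h1).fderiv
  simp only [Function.comp_def] at this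
  simp [pderiv, this]

theorem pderiv_const_sub (f : Plane → ℝ) (y x : Plane) (j : Fin 2)
    (hf : DifferentiableAt ℝ f (y - x)) :
    pderiv j (fun z => f (y - z)) x = - pderiv j f (y - x) := by
  have h1 : HasFDerivAt (fun z : Plane => y - z) (-ContinuousLinearMap.id ℝ Plane) x :=
    (hasFDerivAt_id x).const_sub y
  have := (hf.hasFDerivAt.comp x h1).fderiv
  simp only [Function.comp_def] at this
  simp [pderiv, this]

theorem pderiv_comm {f : Plane → ℝ} (hf : ContDiff ℝ ∞ f) (j k : Fin 2) (x : Plane) :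
    pderiv j (pderiv k f) x = pderiv k (pderiv j f) x := by
  have hs : IsSymmSndFDerivAt ℝ f x :=
    hf.contDiffAt.isSymmSndFDerivAt (by
      simpa using WithTop.coe_le_coe.2 (le_top : (2 : ℕ∞) ≤ ⊤))
  have hd : DifferentiableAt ℝ (fderiv ℝ f) x :=
    ((hf.fderiv_right (m := ∞) (by simp)).differentiable (by simp)) x
  have key : ∀ a b : Fin 2, pderiv a (pderiv b f) x =
      fderiv ℝ (fderiv ℝ f) x (EuclideanSpace.single a 1) (EuclideanSpace.single b 1) := by
    intro a b
    have : pderiv b f = fun y => fderiv ℝ f y (EuclideanSpace.single b 1) := rfl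
    rw [this, pderiv, fderiv_clm_apply hd (differentiableAt_const _)]
    simp
  rw [key, key]
  exact hs _ _

theorem HasCompactSupport.pderiv {f : Plane → ℝ} (hf : HasCompactSupport f) (j : Fin 2) :
    HasCompactSupport (pderiv j f) :=
  (hf.fderiv (𝕜 := ℝ)).comp_left
    (g := fun L : Plane →L[ℝ] ℝ => L (EuclideanSpace.single j 1)) (by simp)

theorem IsTest.pderiv {η : Plane → ℝ} (hη : IsTest η) (j : Fin 2) : IsTest (pderiv j η) :=
  ⟨contDiff_pderiv hη.1 j, HasCompactSupport.pderiv hη.2 j⟩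

theorem IsTest.mul_smooth {η f : Plane → ℝ} (hη : IsTest η) (hf : ContDiff ℝ ∞ f) :
    IsTest (fun x => η x * f x) :=
  ⟨hη.1.mul hf, hη.2.mul_right⟩

theorem IsTest.add {η f : Plane → ℝ} (hη : IsTest η) (hf : IsTest f) :
    IsTest (fun x => η x + f x) :=
  ⟨hη.1.add hf.1, hη.2.add hf.2⟩

theorem IsTest.comp_const_sub {η : Plane → ℝ} (hη : IsTest η) (y : Plane) :
    IsTest (fun x => η (y - x)) :=
  ⟨hη.1.comp (contDiff_const.sub contDiff_id),
    hη.2.comp_homeomorph (Homeomorph.subLeft y)⟩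

theorem IsTest.comp_smul {η : Plane → ℝ} (hη : IsTest η) {c : ℝ} (hc : c ≠ 0) :
    IsTest (fun x => η (c • x)) :=
  ⟨hη.1.comp (contDiff_const_smul c),
    hη.2.comp_homeomorph (Homeomorph.smulOfNeZero c hc)⟩

theorem IsTest.continuous {η : Plane → ℝ} (hη : IsTest η) : Continuous η := hη.1.continuous

theorem IsTest.integrable {η : Plane → ℝ} (hη : IsTest η) : Integrable η :=
  hη.1.continuous.integrable_of_hasCompactSupport hη.2

theorem IsTest.exists_bound {η : Plane → ℝ} (hη : IsTest η) : ∃ C, 0 ≤ C ∧ ∀ x, |η x| ≤ C := by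
  obtain ⟨C, hC⟩ := hη.2.exists_bound_of_continuous hη.continuous
  exact ⟨C, (norm_nonneg _).trans (hC 0), hC⟩

theorem differentiableAt_of_smooth {f : Plane → ℝ} (hf : ContDiff ℝ ∞ f) (x : Plane) :
    DifferentiableAt ℝ f x := (hf.differentiable (by simp)) x

theorem continuous_pderiv {f : Plane → ℝ} (hf : ContDiff ℝ 1 f) (j : Fin 2) :
    Continuous (pderiv j f) :=
  (hf.continuous_fderiv (by simp)).clm_apply continuous_const

/-- Integration by parts against the constant `1`: only the products need to be integrable, so the
constant causes no trouble. -/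
theorem integral_pderiv_eq_zero {w : Plane → ℝ} (hw : ContDiff ℝ 1 w)
    (hc : HasCompactSupport w) (j : Fin 2) : ∫ x, pderiv j w x = 0 := by
  have h := integral_mul_fderiv_eq_neg_fderiv_mul_of_integrable (μ := (volume : Measure Plane))
    (f := fun _ : Plane => (1 : ℝ)) (g := w) (v := EuclideanSpace.single j 1)
    (by simp)
    (by
      simp only [one_mul]
      exact (continuous_pderiv hw j).integrable_of_hasCompactSupport
        (HasCompactSupport.pderiv hc j))
    (by
      simp only [one_mul]
      exact hw.continuous.integrable_of_hasCompactSupport hc)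
    (by intro x _; fun_prop) (fun x _ => (hw.differentiable (by simp)) x)
  simpa [pderiv] using h

theorem integral_pderiv_mul {η f : Plane → ℝ} (hη : IsTest η) (hf : ContDiff ℝ ∞ f)
    (j : Fin 2) : ∫ x, pderiv j η x * f x = - ∫ x, η x * pderiv j f x := by
  have hw := hη.mul_smooth hf
  have h := integral_pderiv_eq_zero (hw.1.of_le (by simp)) hw.2 j
  have e : ∀ x, pderiv j (fun y => η y * f y) x = pderiv j η x * f x + η x * pderiv j f x :=
    fun x => pderiv_mul (differentiableAt_of_smooth hη.1 x) (differentiableAt_of_smooth hf x) j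
  simp_rw [e] at h
  rw [integral_add ((hη.pderiv j).mul_smooth hf).integrable
    (hη.mul_smooth (contDiff_pderiv hf j)).integrable] at h
  linarith

/-! ### The real Sobolev space -/

/-- Real-valued square-integrable functions on the plane. -/
abbrev L2 : Type := Lp ℝ 2 (volume : Measure Plane)

theorem inner_toLp {η : Plane → ℝ} (hη : MemLp η 2 volume) (f : L2) :
    inner ℝ (hη.toLp η) f = ∫ x, η x * f x := by
  rw [L2.inner_def]
  refine integral_congr_ae ?_
  filter_upwards [hη.coeFn_toLp] with x hx
  rw [hx]
  simp [mul_comm]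

theorem integrable_mul_L2 (f g : L2) : Integrable (fun x => f x * g x) :=
  (Lp.memLp f).integrable_mul (Lp.memLp g)

theorem inner_L2 (f g : L2) : inner ℝ f g = ∫ x, f x * g x := by
  rw [L2.inner_def]
  refine integral_congr_ae (ae_of_all _ fun x => ?_)
  simp [mul_comm]

/-- The real Sobolev space: triples `(f, ∂₀f, ∂₁f)` of square-integrable functions. -/
def W : Submodule ℝ (L2 × (Fin 2 → L2)) where
  carrier := {p | ∀ (η : Plane → ℝ) (hη : IsTest η) (j : Fin 2),
    inner ℝ ((hη.memLp_pderiv j).toLp _) p.1 = - inner ℝ (hη.memLp.toLp _) (p.2 j)}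
  zero_mem' := by intro η hη j; simp
  add_mem' := by
    intro p q hp hq η hη j
    simp only [Prod.fst_add, Prod.snd_add, Pi.add_apply, inner_add_right, hp η hη j, hq η hη j]
    ring
  smul_mem' := by
    intro c p hp η hη j
    simp only [Prod.smul_fst, Prod.smul_snd, Pi.smul_apply, inner_smul_right, hp η hη j]
    ring

namespace W

/-- The function underlying an element of the Sobolev space. -/
noncomputable def val : W →L[ℝ] L2 := (ContinuousLinearMap.fst ℝ _ _).comp W.subtypeL

/-- The weak partial derivative of an element of the Sobolev space. -/
noncomputable def der (j : Fin 2) : W →L[ℝ] L2 :=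
  ((ContinuousLinearMap.proj j).comp (ContinuousLinearMap.snd ℝ _ _)).comp W.subtypeL

theorem norm_val_le (p : W) : ‖val p‖ ≤ ‖p‖ := norm_fst_le p.1

theorem norm_der_le (p : W) (j : Fin 2) : ‖der j p‖ ≤ ‖p‖ :=
  (norm_le_pi_norm _ j).trans (norm_snd_le p.1)

/-- `W` carries the maximum norm inherited from the product, so componentwise bounds pass to the
norm without loss. -/
theorem norm_le {p : W} {C : ℝ} (hC : 0 ≤ C) (h : ‖val p‖ ≤ C) (h' : ∀ j, ‖der j p‖ ≤ C) :
    ‖p‖ ≤ C := by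
  change ‖p.1‖ ≤ C
  exact norm_prod_le_iff.2 ⟨h, (pi_norm_le_iff_of_nonneg hC).2 h'⟩

theorem integral_pderiv (p : W) {η : Plane → ℝ} (hη : IsTest η) (j : Fin 2) :
    ∫ x, pderiv j η x * val p x = - ∫ x, η x * der j p x := by
  have := p.2 η hη j
  rwa [inner_toLp, inner_toLp] at this

theorem exists_of_weak {f : L2} {g : Fin 2 → L2} (h : ∀ η : Plane → ℝ, IsTest η → ∀ j : Fin 2,
    ∫ x, pderiv j η x * f x = - ∫ x, η x * g j x) :
    ∃ p : W, val p = f ∧ ∀ j, der j p = g j := by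
  refine ⟨⟨(f, g), fun η hη j => ?_⟩, rfl, fun j => rfl⟩
  rw [inner_toLp, inner_toLp]
  exact h η hη j

end W

theorem norm_sq_L2 (f : L2) : ‖f‖ ^ 2 = ∫ x, f x ^ 2 := by
  rw [← real_inner_self_eq_norm_sq, inner_L2]
  simp_rw [sq]

theorem norm_toLp_sq {f : Plane → ℝ} (hf : MemLp f 2 volume) :
    ‖hf.toLp f‖ ^ 2 = ∫ x, f x ^ 2 := by
  rw [norm_sq_L2]
  exact integral_congr_ae (hf.coeFn_toLp.mono fun x hx => by simp only [hx])

theorem abs_integral_mul_le {c : Plane → ℝ} (hc : AEStronglyMeasurable c) {C : ℝ}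
    (hC : ∀ x, |c x| ≤ C) (f g : L2) :
    Integrable (fun x => c x * (f x * g x)) ∧ |∫ x, c x * (f x * g x)| ≤ C * (‖f‖ * ‖g‖) := by
  have hi : Integrable (fun x => c x * (f x * g x)) :=
    (integrable_mul_L2 f g).bdd_mul hc (ae_of_all _ hC)
  refine ⟨hi, ?_⟩
  have hC0 : 0 ≤ C := (abs_nonneg _).trans (hC 0)
  have h1 : |∫ x, c x * (f x * g x)| ≤ ∫ x, C * (|f| x * |g| x) := by
    refine (abs_integral_le_integral_abs).trans (integral_mono_ae hi.abs
      ((integrable_mul_L2 _ _).const_mul C) ?_)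
    filter_upwards [Lp.coeFn_abs f, Lp.coeFn_abs g] with x h1 h2
    simp only [h1, h2, abs_mul]
    exact mul_le_mul_of_nonneg_right (hC x) (by positivity)
  refine h1.trans ?_
  rw [integral_const_mul, ← inner_L2]
  refine mul_le_mul_of_nonneg_left ?_ hC0
  refine (real_inner_le_norm _ _).trans ?_
  rw [norm_abs_eq_norm, norm_abs_eq_norm]

end CubicQuintic

namespace CubicQuintic

/-! ### Mollification -/

/-- Convolution of a function with a kernel. -/
noncomputable def cv (k f : Plane → ℝ) (y : Plane) : ℝ := ∫ x, k (y - x) * f x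

theorem cv_eq_convolution (k f : Plane → ℝ) :
    cv k f = convolution f k (ContinuousLinearMap.mul ℝ ℝ) volume := by
  ext y
  simp [cv, convolution, mul_comm]

theorem cv_congr {k f g : Plane → ℝ} (h : f =ᵐ[volume] g) : cv k f = cv k g := by
  ext y
  exact integral_congr_ae (h.mono fun x hx => by simp [hx])

theorem contDiff_cv {k f : Plane → ℝ} (hk : IsTest k) (hf : LocallyIntegrable f) :
    ContDiff ℝ ∞ (cv k f) := by
  rw [cv_eq_convolution]
  exact hk.2.contDiff_convolution_right _ hf hk.1

theorem pderiv_cv {k f : Plane → ℝ} (hk : IsTest k) (hf : LocallyIntegrable f) (j : Fin 2) :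
    pderiv j (cv k f) = cv (pderiv j k) f := by
  ext y
  rw [pderiv, cv_eq_convolution, cv_eq_convolution,
    (hk.2.hasFDerivAt_convolution_right (ContinuousLinearMap.mul ℝ ℝ) hf
      (hk.1.of_le (by simp)) y).fderiv,
    convolution_precompR_apply _ hf (hk.2.fderiv (𝕜 := ℝ)) (hk.1.continuous_fderiv (by simp))]
  rfl

theorem L2.locallyIntegrable (f : L2) : LocallyIntegrable f :=
  (Lp.memLp f).locallyIntegrable (by norm_num)

/-- The translated kernel `x ↦ k (y - x)` is itself a test function, so the definition of weak
derivative applies; its own minus sign cancels the one from the reflection. -/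
theorem cv_pderiv_val {k : Plane → ℝ} (hk : IsTest k) (p : W) (j : Fin 2) :
    cv (pderiv j k) (W.val p) = cv k (W.der j p) := by
  ext y
  have h := W.integral_pderiv p (hk.comp_const_sub y) j
  simp_rw [pderiv_const_sub k y _ j (differentiableAt_of_smooth hk.1 _)] at h
  simp only [neg_mul, integral_neg, neg_inj] at h
  exact h

theorem pderiv_cv_val {k : Plane → ℝ} (hk : IsTest k) (p : W) (j : Fin 2) :
    pderiv j (cv k (W.val p)) = cv k (W.der j p) := by
  rw [pderiv_cv hk (L2.locallyIntegrable _), cv_pderiv_val hk]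

theorem integrable_cv_integrand {k : Plane → ℝ} (hk : IsTest k) (f : L2) (y : Plane) :
    Integrable (fun x => k (y - x) * f x) :=
  (hk.comp_const_sub y).memLp.integrable_mul (Lp.memLp f)

/-- A nonnegative mollification kernel of unit mass. -/
structure IsKernel (k : Plane → ℝ) : Prop where
  test : IsTest k
  nonneg : ∀ x, 0 ≤ k x
  integral_eq : ∫ x, k x = 1

/-- Jensen's inequality, proved as nonnegativity of the variance of `f` under the probability
density `k (y - ·)`. Integrated in `y`, it makes mollification a contraction of `L²`. -/
theorem IsKernel.cv_sq_le {k : Plane → ℝ} (hk : IsKernel k) (f : L2) (y : Plane) :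
    cv k f y ^ 2 ≤ cv k (fun x => f x ^ 2) y := by
  set m := cv k f y with hm
  obtain ⟨C, -, hC⟩ := hk.test.exists_bound
  have i1 : Integrable (fun x => k (y - x)) := (hk.test.comp_const_sub y).integrable
  have i2 := integrable_cv_integrand hk.test f y
  have i3 : Integrable (fun x => k (y - x) * f x ^ 2) :=
    ((Lp.memLp f).integrable_sq).bdd_mul (hk.test.comp_const_sub y).continuous.aestronglyMeasurable
      (ae_of_all _ fun x => hC (y - x))
  have h0 : 0 ≤ ∫ x, k (y - x) * (f x - m) ^ 2 :=
    integral_nonneg fun x => mul_nonneg (hk.nonneg _) (sq_nonneg _)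
  have e : ∀ x, k (y - x) * (f x - m) ^ 2 =
      k (y - x) * f x ^ 2 - (2 * m) * (k (y - x) * f x) + m ^ 2 * k (y - x) := fun x => by ring
  simp_rw [e] at h0
  rw [integral_add (i3.sub' (i2.const_mul _)) (i1.const_mul _),
    integral_sub i3 (i2.const_mul _), integral_const_mul, integral_const_mul,
    integral_sub_left_eq_self k volume y, hk.integral_eq] at h0
  change 0 ≤ cv k (fun x => f x ^ 2) y - 2 * m * m + m ^ 2 * 1 at h0
  nlinarith

theorem IsKernel.integrable_cv {k : Plane → ℝ} (hk : IsKernel k) {f : Plane → ℝ}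
    (hf : Integrable f) : Integrable (cv k f) := by
  rw [cv_eq_convolution]
  exact hf.integrable_convolution _ hk.test.integrable

theorem IsKernel.integral_cv {k : Plane → ℝ} (hk : IsKernel k) {f : Plane → ℝ}
    (hf : Integrable f) : ∫ y, cv k f y = ∫ x, f x := by
  rw [cv_eq_convolution, integral_convolution _ hf hk.test.integrable, hk.integral_eq]
  simp

theorem IsKernel.memLp_cv {k : Plane → ℝ} (hk : IsKernel k) (f : L2) :
    MemLp (cv k f) 2 volume := by
  have hc : Continuous (cv k f) := (contDiff_cv hk.test (L2.locallyIntegrable f)).continuous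
  rw [memLp_two_iff_integrable_sq hc.aestronglyMeasurable]
  refine (hk.integrable_cv (Lp.memLp f).integrable_sq).mono'
    (hc.pow 2).aestronglyMeasurable (ae_of_all _ fun y => ?_)
  rw [Real.norm_eq_abs, abs_of_nonneg (sq_nonneg _)]
  exact hk.cv_sq_le f y

theorem IsKernel.norm_toLp_cv_le {k : Plane → ℝ} (hk : IsKernel k) (f : L2) :
    ‖(hk.memLp_cv f).toLp _‖ ≤ ‖f‖ := by
  refine le_of_sq_le_sq ?_ (norm_nonneg _)
  rw [norm_sq_L2, norm_sq_L2, ← hk.integral_cv (Lp.memLp f).integrable_sq]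
  rw [integral_congr_ae ((hk.memLp_cv f).coeFn_toLp.mono fun x hx => by
    show _ = cv k f x ^ 2
    simp only [hx])]
  exact integral_mono (hk.memLp_cv f).integrable_sq
    (hk.integrable_cv (Lp.memLp f).integrable_sq) fun y => hk.cv_sq_le f y

/-- Mollification as an operator on square-integrable functions. -/
noncomputable def convL {k : Plane → ℝ} (hk : IsKernel k) : L2 →L[ℝ] L2 :=
  LinearMap.mkContinuous
    { toFun := fun f => (hk.memLp_cv f).toLp _
      map_add' := by
        intro f g
        rw [← MemLp.toLp_add]
        refine MemLp.toLp_congr _ _ (ae_of_all _ fun y => ?_)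
        simp only [Pi.add_apply]
        rw [cv_congr (Lp.coeFn_add f g)]
        simp only [cv, Pi.add_apply, mul_add]
        exact integral_add (integrable_cv_integrand hk.test f y)
          (integrable_cv_integrand hk.test g y)
      map_smul' := by
        intro c f
        simp only [RingHom.id_apply]
        rw [← MemLp.toLp_const_smul]
        refine MemLp.toLp_congr _ _ (ae_of_all _ fun y => ?_)
        simp only [Pi.smul_apply]
        rw [cv_congr (Lp.coeFn_smul c f)]
        simp only [cv, Pi.smul_apply, smul_eq_mul, mul_left_comm _ c]
        exact integral_const_mul _ _ } 1
    (fun f => by simpa using hk.norm_toLp_cv_le f)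

theorem coeFn_convL {k : Plane → ℝ} (hk : IsKernel k) (f : L2) :
    convL hk f =ᵐ[volume] cv k f := (hk.memLp_cv f).coeFn_toLp

theorem norm_convL_le {k : Plane → ℝ} (hk : IsKernel k) (f : L2) : ‖convL hk f‖ ≤ ‖f‖ :=
  hk.norm_toLp_cv_le f

/-- Mollification on the Sobolev space. -/
noncomputable def moll {k : Plane → ℝ} (hk : IsKernel k) (p : W) : W :=
  ⟨(convL hk (W.val p), fun j => convL hk (W.der j p)), by
    intro η hη j
    rw [inner_toLp, inner_toLp]
    have h1 : ∫ x, pderiv j η x * convL hk (W.val p) x =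
        ∫ x, pderiv j η x * cv k (W.val p) x :=
      integral_congr_ae ((coeFn_convL hk (W.val p)).mono fun x hx => by simp [hx])
    have h2 : ∫ x, η x * convL hk (W.der j p) x = ∫ x, η x * cv k (W.der j p) x :=
      integral_congr_ae ((coeFn_convL hk (W.der j p)).mono fun x hx => by simp [hx])
    change ∫ x, pderiv j η x * convL hk (W.val p) x = - ∫ x, η x * convL hk (W.der j p) x
    rw [h1, h2, ← pderiv_cv_val hk.test]
    exact integral_pderiv_mul hη (contDiff_cv hk.test (L2.locallyIntegrable _)) j⟩

/-! ### A radial bump function and the approximate identity -/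

/-- A radial bump function, equal to one on the unit disc. -/
noncomputable def bump (x : Plane) : ℝ := Real.smoothTransition (2 - ‖x‖ ^ 2)

theorem contDiff_bump : ContDiff ℝ ∞ bump :=
  Real.smoothTransition.contDiff.comp (contDiff_const.sub (contDiff_norm_sq ℝ))

theorem bump_nonneg (x : Plane) : 0 ≤ bump x := Real.smoothTransition.nonneg _

theorem bump_le_one (x : Plane) : bump x ≤ 1 := Real.smoothTransition.le_one _

theorem bump_eq_one {x : Plane} (hx : ‖x‖ ≤ 1) : bump x = 1 :=
  Real.smoothTransition.one_of_one_le (by nlinarith [norm_nonneg x])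

theorem bump_eq_zero {x : Plane} (hx : 2 ≤ ‖x‖) : bump x = 0 :=
  Real.smoothTransition.zero_of_nonpos (by nlinarith)

theorem bump_congr {x y : Plane} (h : ‖x‖ = ‖y‖) : bump x = bump y := by simp [bump, h]

theorem isTest_bump : IsTest bump := by
  refine ⟨contDiff_bump, HasCompactSupport.intro (isCompact_closedBall (0 : Plane) 2) ?_⟩
  intro x hx
  exact bump_eq_zero (by simpa using (not_le.1 (by simpa using hx)).le)

theorem integral_bump_smul_pos (n : ℕ) : 0 < ∫ x, bump (((n : ℝ) + 1) • x) := by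
  have hn : ((n : ℝ) + 1) ≠ 0 := by positivity
  have ht := isTest_bump.comp_smul hn
  refine ht.continuous.integral_pos_of_hasCompactSupport_nonneg_nonzero ht.2
    (fun x => bump_nonneg _) (x := 0) ?_
  rw [smul_zero, bump_eq_one (by simp)]
  exact one_ne_zero

/-- The radial approximate identity. -/
noncomputable def kap (n : ℕ) (x : Plane) : ℝ :=
  (∫ x, bump (((n : ℝ) + 1) • x))⁻¹ * bump (((n : ℝ) + 1) • x)

theorem isKernel_kap (n : ℕ) : IsKernel (kap n) := by
  have hn : ((n : ℝ) + 1) ≠ 0 := by positivity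
  have ht := isTest_bump.comp_smul hn
  refine ⟨⟨contDiff_const.mul ht.1, ht.2.mul_left⟩, fun x => ?_, ?_⟩
  · exact mul_nonneg (inv_nonneg.2 (integral_bump_smul_pos n).le) (bump_nonneg _)
  · simp only [kap]
    rw [integral_const_mul, inv_mul_cancel₀ (integral_bump_smul_pos n).ne']

theorem kap_congr (n : ℕ) {x y : Plane} (h : ‖x‖ = ‖y‖) : kap n x = kap n y := by
  rw [kap, kap, bump_congr (x := ((n : ℝ) + 1) • x) (y := ((n : ℝ) + 1) • y)
    (by rw [norm_smul, norm_smul, h])]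

theorem kap_eq_zero (n : ℕ) {x : Plane} (h : 2 / ((n : ℝ) + 1) ≤ ‖x‖) : kap n x = 0 := by
  rw [kap, bump_eq_zero, mul_zero]
  have hn : (0 : ℝ) < (n : ℝ) + 1 := by positivity
  rw [norm_smul, Real.norm_of_nonneg hn.le]
  rw [div_le_iff₀ hn] at h
  linarith

theorem abs_cv_sub_le {k g : Plane → ℝ} (hk : IsKernel k) {ε δ : ℝ}
    (hs : ∀ x, δ ≤ ‖x‖ → k x = 0) (hg : Continuous g)
    (y : Plane) (h : ∀ x, dist x y < δ → |g x - g y| ≤ ε) : |cv k g y - g y| ≤ ε := by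
  have i0 : Integrable (fun x => k (y - x)) := (hk.test.comp_const_sub y).integrable
  have i1 : Integrable (fun x => k (y - x) * g x) :=
    ((hk.test.comp_const_sub y).continuous.mul hg).integrable_of_hasCompactSupport
      (hk.test.comp_const_sub y).2.mul_right
  have e1 : ∫ x, k (y - x) = 1 := by rw [integral_sub_left_eq_self k volume y, hk.integral_eq]
  have e : cv k g y - g y = ∫ x, k (y - x) * (g x - g y) := by
    simp_rw [mul_sub]
    rw [integral_sub i1 (i0.mul_const _), integral_mul_const, e1, one_mul]
    rfl
  rw [e]
  have hb : ∀ x, |k (y - x) * (g x - g y)| ≤ ε * k (y - x) := by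
    intro x
    rw [abs_mul, abs_of_nonneg (hk.nonneg _), mul_comm]
    rcases lt_or_ge (dist x y) δ with hx | hx
    · exact mul_le_mul_of_nonneg_right (h x hx) (hk.nonneg _)
    · rw [hs (y - x) (by rwa [← dist_eq_norm, dist_comm])]; simp
  refine (abs_integral_le_integral_abs).trans ?_
  refine (integral_mono_of_nonneg (ae_of_all _ fun x => abs_nonneg _) (i0.const_mul ε)
    (ae_of_all _ hb)).trans ?_
  rw [integral_const_mul, e1, mul_one]

/-- Uniform continuity gives uniform convergence, and all the functions involved vanish outside one
fixed ball. -/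
theorem tendsto_convL_of_continuous {g : Plane → ℝ} (hg : Continuous g)
    (hc : HasCompactSupport g) (hm : MemLp g 2 volume) :
    Tendsto (fun n => convL (isKernel_kap n) (hm.toLp g)) atTop (𝓝 (hm.toLp g)) := by
  obtain ⟨r, hr⟩ := hc.isCompact.isBounded.subset_closedBall (0 : Plane)
  -- The kernels live in `|x| ≤ 2/(n+1) ≤ 2`, so enlarging the support radius by `2` serves every
  -- `n`.
  set K : Set Plane := Metric.closedBall 0 (r + 2)
  have hK : volume K ≠ ⊤ := (isCompact_closedBall _ _).measure_lt_top.ne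
  have hu := Metric.uniformContinuous_iff.1 (hc.uniformContinuous_of_continuous hg)
  rw [Metric.tendsto_atTop]
  intro ε hε
  set V : ℝ := volume.real K
  have hV : 0 ≤ V := measureReal_nonneg
  -- Adding `1` to the volume keeps the quotient meaningful and makes the final inequality strict.
  set ε' : ℝ := ε / (V + 1)
  have hε' : 0 < ε' := by positivity
  obtain ⟨δ, hδ, hδ'⟩ := hu ε' hε'
  obtain ⟨N, hN⟩ := exists_nat_gt (2 / δ)
  refine ⟨N, fun n hn => ?_⟩
  have hn1 : 2 / ((n : ℝ) + 1) < δ := by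
    have : (N : ℝ) ≤ n := by exact_mod_cast hn
    rw [div_lt_iff₀ (by positivity)]
    rw [div_lt_iff₀ hδ] at hN
    nlinarith
  have hk := isKernel_kap n
  have hpt : ∀ y, |cv (kap n) g y - g y| ≤ ε' := fun y =>
    abs_cv_sub_le hk (fun x hx => kap_eq_zero n (hn1.le.trans hx)) hg y
      (fun x hx => (by simpa [Real.dist_eq] using (hδ' hx).le))
  have hzero : ∀ y, y ∉ K → cv (kap n) g y - g y = 0 := by
    intro y hy
    have hy' : r + 2 < ‖y‖ := by simpa [K] using hy
    have hg0 : ∀ x, r < ‖x‖ → g x = 0 := by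
      intro x hx
      by_contra h
      have := hr (subset_tsupport _ h)
      simp at this
      linarith
    have : cv (kap n) g y = 0 := by
      refine integral_eq_zero_of_ae (ae_of_all _ fun x => ?_)
      simp only [Pi.zero_apply, mul_eq_zero]
      rcases lt_or_ge r ‖x‖ with hx | hx
      · exact Or.inr (hg0 x hx)
      · left
        refine kap_eq_zero n (le_trans ?_ (norm_sub_norm_le y x |>.trans' (by linarith : (2 : ℝ) ≤ _)))
        rw [div_le_iff₀ (by positivity)]
        nlinarith [(Nat.cast_nonneg n : (0 : ℝ) ≤ n)]
    rw [this, hg0 y (by linarith)]; simp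
  have hsq : ‖convL hk (hm.toLp g) - hm.toLp g‖ ^ 2 ≤ ε' ^ 2 * V := by
    rw [norm_sq_L2]
    have e : ∫ x, (convL hk (hm.toLp g) - hm.toLp g : L2) x ^ 2 =
        ∫ x, (cv (kap n) g x - g x) ^ 2 := by
      refine integral_congr_ae ?_
      filter_upwards [Lp.coeFn_sub (convL hk (hm.toLp g)) (hm.toLp g),
        coeFn_convL hk (hm.toLp g), hm.coeFn_toLp] with x h1 h2 h3
      rw [h1, Pi.sub_apply, h2, h3, cv_congr hm.coeFn_toLp]
    rw [e]
    have e2 : ∫ x, (cv (kap n) g x - g x) ^ 2 = ∫ x in K, (cv (kap n) g x - g x) ^ 2 := by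
      refine (setIntegral_eq_integral_of_forall_compl_eq_zero fun x hx => ?_).symm
      rw [hzero x hx]; simp
    rw [e2]
    have := norm_setIntegral_le_of_norm_le_const (μ := volume) (s := K)
      (f := fun x => (cv (kap n) g x - g x) ^ 2) (C := ε' ^ 2) hK.lt_top (fun x _ => by
        rw [Real.norm_eq_abs, abs_pow]
        exact pow_le_pow_left₀ (abs_nonneg _) (hpt x) 2)
    exact (le_abs_self _).trans this
  rw [dist_eq_norm]
  have h3 : ε' ^ 2 * V < ε ^ 2 := by
    have e3 : ε = ε' * (V + 1) := by simp only [ε']; field_simp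
    rw [e3, mul_pow]
    exact mul_lt_mul_of_pos_left (by nlinarith) (by positivity)
  exact lt_of_pow_lt_pow_left₀ 2 hε.le (hsq.trans_lt h3)

/-- Density of continuous compactly supported functions together with the contraction property:
three errors, each at most `ε/4`. -/
theorem tendsto_convL (f : L2) :
    Tendsto (fun n => convL (isKernel_kap n) f) atTop (𝓝 f) := by
  rw [Metric.tendsto_atTop]
  intro ε hε
  obtain ⟨g, hgc, hgn, hg, hgm⟩ := (Lp.memLp f).exists_hasCompactSupport_eLpNorm_sub_le
    (by norm_num) (ε := ENNReal.ofReal (ε / 4)) (by simpa using hε)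
  have hd : ‖f - hgm.toLp g‖ ≤ ε / 4 := by
    have : f - hgm.toLp g = ((Lp.memLp f).sub hgm).toLp _ := by
      rw [MemLp.toLp_sub (Lp.memLp f) hgm, Lp.toLp_coeFn]
    rw [this, Lp.norm_toLp]
    exact ENNReal.toReal_le_of_le_ofReal (by linarith) hgn
  obtain ⟨N, hN⟩ := Metric.tendsto_atTop.1 (tendsto_convL_of_continuous hg hgc hgm) (ε / 4)
    (by linarith)
  refine ⟨N, fun n hn => ?_⟩
  have h1 := hN n hn
  rw [dist_eq_norm] at h1 ⊢
  have e : convL (isKernel_kap n) f - f = convL (isKernel_kap n) (f - hgm.toLp g) +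
      (convL (isKernel_kap n) (hgm.toLp g) - hgm.toLp g) - (f - hgm.toLp g) := by
    rw [map_sub]; abel
  rw [e]
  have h2 := (norm_convL_le (isKernel_kap n) (f - hgm.toLp g)).trans hd
  refine (norm_sub_le _ _).trans_lt ?_
  have := norm_add_le (convL (isKernel_kap n) (f - hgm.toLp g))
    (convL (isKernel_kap n) (hgm.toLp g) - hgm.toLp g)
  linarith

theorem tendsto_moll (p : W) : Tendsto (fun n => moll (isKernel_kap n) p) atTop (𝓝 p) := by
  rw [tendsto_subtype_rng]
  refine Tendsto.prodMk_nhds (tendsto_convL _) (tendsto_pi_nhds.2 fun j => ?_)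
  exact tendsto_convL (W.der j p)

end CubicQuintic

namespace CubicQuintic

/-! ### Integral inequalities -/

theorem sq_integral_abs_mul_le {f g : Plane → ℝ} (hf : MemLp f 2 volume) (hg : MemLp g 2 volume) :
    (∫ x, |f x * g x|) ^ 2 ≤ (∫ x, f x ^ 2) * ∫ x, g x ^ 2 := by
  have key : ∀ {h : Plane → ℝ} (hh : MemLp h 2 volume), ‖hh.abs.toLp _‖ ^ 2 = ∫ x, h x ^ 2 := by
    intro h hh
    rw [norm_sq_L2]
    refine integral_congr_ae (hh.abs.coeFn_toLp.mono fun x hx => ?_)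
    simp only [hx, sq_abs, Pi.abs_apply]
  have e : inner ℝ (hf.abs.toLp _) (hg.abs.toLp _) = ∫ x, |f x * g x| := by
    rw [inner_L2]
    refine integral_congr_ae ?_
    filter_upwards [hf.abs.coeFn_toLp, hg.abs.coeFn_toLp] with x h1 h2
    rw [h1, h2, abs_mul, Pi.abs_apply, Pi.abs_apply]
  rw [← key hf, ← key hg, ← mul_pow, ← e]
  have h0 : 0 ≤ inner ℝ (hf.abs.toLp _) (hg.abs.toLp _) := by
    rw [e]; exact integral_nonneg fun x => abs_nonneg _
  exact pow_le_pow_left₀ h0 (real_inner_le_norm _ _) 2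

/-- Fatou's lemma, in the form that carries inequalities from test functions to the whole Sobolev
space and yields integrability of the limit as well. -/
theorem integral_le_of_ae_tendsto {F : ℕ → Plane → ℝ} {G : Plane → ℝ} {B : ℝ}
    (h0 : ∀ m x, 0 ≤ F m x) (hi : ∀ m, Integrable (F m)) (hB : ∀ m, ∫ x, F m x ≤ B)
    (hG : ∀ᵐ x, Tendsto (fun m => F m x) atTop (𝓝 (G x))) :
    Integrable G ∧ ∫ x, G x ≤ B := by
  have hB0 : 0 ≤ B := (integral_nonneg (h0 0)).trans (hB 0)
  have hGm : AEStronglyMeasurable G :=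
    aestronglyMeasurable_of_tendsto_ae atTop (fun m => (hi m).1) hG
  have hG0 : 0 ≤ᵐ[volume] G := by
    filter_upwards [hG] with x hx
    exact ge_of_tendsto' hx fun m => h0 m x
  have hle : ∫⁻ x, ENNReal.ofReal (G x) ≤ ENNReal.ofReal B := by
    calc ∫⁻ x, ENNReal.ofReal (G x)
        = ∫⁻ x, liminf (fun m => ENNReal.ofReal (F m x)) atTop := by
          refine lintegral_congr_ae ?_
          filter_upwards [hG] with x hx
          exact ((ENNReal.continuous_ofReal.tendsto _).comp hx).liminf_eq.symm
      _ ≤ liminf (fun m => ∫⁻ x, ENNReal.ofReal (F m x)) atTop :=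
          lintegral_liminf_le' fun m => (hi m).1.aemeasurable.ennreal_ofReal
      _ ≤ ENNReal.ofReal B := by
          refine liminf_le_of_le (by isBoundedDefault) fun b hb => ?_
          obtain ⟨m, hm⟩ := hb.exists
          refine hm.trans ?_
          rw [← ofReal_integral_eq_lintegral_ofReal (hi m) (ae_of_all _ (h0 m))]
          exact ENNReal.ofReal_le_ofReal (hB m)
  have hGi : Integrable G := by
    refine ⟨hGm, ?_⟩
    rw [hasFiniteIntegral_iff_ofReal hG0]
    exact hle.trans_lt ENNReal.ofReal_lt_top
  refine ⟨hGi, ?_⟩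
  rw [← ofReal_integral_eq_lintegral_ofReal hGi hG0] at hle
  exact (ENNReal.ofReal_le_ofReal_iff hB0).1 hle

theorem norm_clm_le (L : Plane →L[ℝ] ℝ) :
    ‖L‖ ≤ |L (EuclideanSpace.single 0 1)| + |L (EuclideanSpace.single 1 1)| := by
  refine L.opNorm_le_bound (by positivity) fun v => ?_
  have hv : v = v 0 • EuclideanSpace.single 0 (1 : ℝ) + v 1 • EuclideanSpace.single 1 (1 : ℝ) := by
    ext i
    fin_cases i <;> simp
  have h0 : |v 0| ≤ ‖v‖ := PiLp.norm_apply_le v 0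
  have h1 : |v 1| ≤ ‖v‖ := PiLp.norm_apply_le v 1
  conv_lhs => rw [hv]
  rw [map_add, map_smul, map_smul, Real.norm_eq_abs]
  refine (abs_add_le _ _).trans ?_
  simp only [smul_eq_mul, abs_mul]
  nlinarith [abs_nonneg (L (EuclideanSpace.single 0 1)), abs_nonneg (L (EuclideanSpace.single 1 1))]

/-- The Gagliardo–Nirenberg–Sobolev inequality in the plane, for test functions. -/
theorem exists_gns : ∃ C : ℝ, 0 ≤ C ∧ ∀ w : Plane → ℝ, IsTest w →
    ∫ x, w x ^ 2 ≤ C * (∫ x, (|pderiv 0 w x| + |pderiv 1 w x|)) ^ 2 := by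
  set c := eLpNormLESNormFDerivOneConst (volume : Measure Plane) 2
  refine ⟨(c : ℝ) ^ 2, by positivity, fun w hw => ?_⟩
  -- In dimension two the exponent conjugate to the dimension is `2`: the embedding is `W^{1,1} →
  -- L²`.
  have hdim : NNReal.HolderConjugate (Module.finrank ℝ Plane : NNReal) 2 := by
    rw [finrank_euclideanSpace]
    simp only [Fintype.card_fin, Nat.cast_ofNat]
    exact NNReal.HolderConjugate.two_two
  have h := eLpNorm_le_eLpNorm_fderiv_one (volume : Measure Plane) (hw.1.of_le (by simp)) hw.2 hdim
  have hfi : Integrable (fderiv ℝ w) :=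
    (hw.1.continuous_fderiv (by simp)).integrable_of_hasCompactSupport (hw.2.fderiv (𝕜 := ℝ))
  have hpi : Integrable (fun x => |pderiv 0 w x| + |pderiv 1 w x|) :=
    (hw.pderiv 0).integrable.abs.add (hw.pderiv 1).integrable.abs
  have h1 : (eLpNorm (fderiv ℝ w) 1 volume).toReal ≤ ∫ x, (|pderiv 0 w x| + |pderiv 1 w x|) := by
    rw [eLpNorm_one_eq_lintegral_enorm, ← integral_norm_eq_lintegral_enorm hfi.1]
    exact integral_mono hfi.norm hpi fun x => norm_clm_le _
  have h2 : (eLpNorm w 2 volume).toReal ^ 2 = ∫ x, w x ^ 2 := by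
    rw [← Lp.norm_toLp w hw.memLp, norm_sq_L2]
    exact integral_congr_ae (hw.memLp.coeFn_toLp.mono fun x hx => by simp [hx])
  rw [← h2, ← mul_pow]
  refine pow_le_pow_left₀ ENNReal.toReal_nonneg ?_ 2
  have hfin : eLpNorm (fderiv ℝ w) 1 volume ≠ ⊤ := (memLp_one_iff_integrable.2 hfi).2.ne
  have h3 := ENNReal.toReal_mono (ENNReal.mul_ne_top ENNReal.coe_ne_top hfin) h
  rw [ENNReal.toReal_mul] at h3
  exact h3.trans (mul_le_mul_of_nonneg_left h1 (by simp))

theorem IsTest.pow {w : Plane → ℝ} (hw : IsTest w) {n : ℕ} (hn : n ≠ 0) :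
    IsTest (fun x => w x ^ n) := by
  refine ⟨hw.1.pow n, ?_⟩
  exact hw.2.comp_left (g := fun t : ℝ => t ^ n) (by simp [hn])

/-- Induction on the exponent. The `W^{1,1} → L²` inequality is applied to `w^(k+2)`, whose gradient
`(k+2) w^(k+1) ∇w` is estimated by Cauchy–Schwarz; the norm of `w^(k+1)` is the previous case. -/
theorem exists_sobolev_test (k : ℕ) : ∃ C : ℝ, 0 ≤ C ∧ ∀ (w : Plane → ℝ) (B : ℝ), IsTest w →
    ∫ x, w x ^ 2 ≤ B ^ 2 → (∀ j, ∫ x, pderiv j w x ^ 2 ≤ B ^ 2) →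
    ∫ x, w x ^ (2 * (k + 1)) ≤ C * B ^ (2 * (k + 1)) := by
  induction k with
  | zero => exact ⟨1, zero_le_one, fun w B _ h _ => by simpa using h⟩
  | succ k ih =>
    obtain ⟨C, hC, ih⟩ := ih
    obtain ⟨c, hc, gns⟩ := exists_gns
    -- The square `(k+2)²` comes from the power rule, and the `4` from `(X + Y)² ≤ 2X² + 2Y²` with
    -- two partial derivatives.
    refine ⟨c * ((k + 2) ^ 2 * (4 * C)), by positivity, fun w B hw h0 h1 => ?_⟩
    have h := gns _ (hw.pow (n := k + 2) (by omega))
    have hp : IsTest (fun x => w x ^ (k + 1)) := hw.pow (by omega)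
    have e : ∀ j x, |pderiv j (fun y => w y ^ (k + 2)) x| =
        (k + 2) * |w x ^ (k + 1) * pderiv j w x| := by
      intro j x
      rw [pderiv_pow (differentiableAt_of_smooth hw.1 x)]
      simp only [Nat.add_one_sub_one, Nat.cast_add, Nat.cast_ofNat, abs_mul, mul_assoc]
      rw [abs_of_nonneg (by positivity : (0 : ℝ) ≤ (k : ℝ) + 2)]
    have hint : ∀ j, Integrable (fun x => |w x ^ (k + 1) * pderiv j w x|) := fun j =>
      (hp.mul_smooth (contDiff_pderiv hw.1 j)).integrable.abs
    have hI := ih w B hw h0 h1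
    set I := ∫ x, w x ^ (2 * (k + 1)) with hIdef
    have hcs : ∀ j, (∫ x, |w x ^ (k + 1) * pderiv j w x|) ^ 2 ≤ I * B ^ 2 := by
      intro j
      refine (sq_integral_abs_mul_le hp.memLp (hw.memLp_pderiv j)).trans ?_
      have : ∫ x, (w x ^ (k + 1)) ^ 2 = I := by
        simp_rw [hIdef, ← pow_mul, mul_comm]
      rw [this]
      refine mul_le_mul_of_nonneg_left (h1 j) ?_
      exact integral_nonneg fun x => by rw [pow_mul]; positivity
    simp_rw [e] at h
    rw [integral_add ((hint 0).const_mul _) ((hint 1).const_mul _), integral_const_mul,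
      integral_const_mul, ← mul_add, mul_pow] at h
    set X := ∫ x, |w x ^ (k + 1) * pderiv 0 w x|
    set Y := ∫ x, |w x ^ (k + 1) * pderiv 1 w x|
    have hXY : (X + Y) ^ 2 ≤ 4 * (I * B ^ 2) := by nlinarith [hcs 0, hcs 1, sq_nonneg (X - Y)]
    have e2 : ∫ x, w x ^ (2 * (k + 1 + 1)) = ∫ x, (w x ^ (k + 2)) ^ 2 := by
      simp_rw [← pow_mul]; congr 1; ext x; congr 1; ring
    rw [e2]
    refine h.trans ?_
    rw [mul_assoc]
    refine mul_le_mul_of_nonneg_left ?_ hc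
    rw [mul_assoc]
    refine mul_le_mul_of_nonneg_left (hXY.trans ?_) (by positivity)
    have e3 : B ^ (2 * (k + 1 + 1)) = B ^ (2 * (k + 1)) * B ^ 2 := by ring
    rw [e3]
    nlinarith [sq_nonneg B, mul_le_mul_of_nonneg_right hI (sq_nonneg B)]

/-! ### Approximation by test functions -/

/-- A square-integrable function is radial if it is almost everywhere a function of `|x|`. -/
def L2.IsRadial (f : L2) : Prop := ∃ g : ℝ → ℝ, ∀ᵐ x : Plane, f x = g ‖x‖

theorem exists_isometry {x y : Plane} (h : ‖x‖ = ‖y‖) : ∃ A : Plane ≃ₗᵢ[ℝ] Plane, A x = y :=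
  ⟨_, Submodule.reflection_sub h⟩

/-- Any two points of equal norm are exchanged by a linear isometry, and a change of variables by it
preserves measure, kernel and `f`. -/
theorem cv_radial {k : Plane → ℝ} (hk : ∀ x y : Plane, ‖x‖ = ‖y‖ → k x = k y) {f : L2}
    (hf : f.IsRadial) {x y : Plane} (h : ‖x‖ = ‖y‖) : cv k f x = cv k f y := by
  obtain ⟨A, rfl⟩ := exists_isometry h
  obtain ⟨g, hg⟩ := hf
  have hA := A.measurePreserving
  have hfA : ∀ᵐ z, f (A z) = f z := by
    filter_upwards [hg, hA.quasiMeasurePreserving.ae hg] with z h1 h2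
    rw [h1, h2, A.norm_map]
  have e : cv k f (A x) = ∫ z, k (A x - A z) * f (A z) :=
    (hA.integral_comp A.toHomeomorph.measurableEmbedding (fun z => k (A x - z) * f z)).symm
  rw [e, cv]
  refine integral_congr_ae (hfA.mono fun z hz => ?_)
  simp only [hz]
  rw [hk (A x - A z) (x - z) (by rw [← map_sub, A.norm_map])]

/-- Mollify, then multiply by wide radial cutoffs. Convergence in `L²` gives convergence almost
everywhere along a subsequence, and kernel and cutoffs are both radial, so radial symmetry survives.
-/
theorem exists_test_approx : ∃ C : ℝ, 1 ≤ C ∧ ∀ p : W, ∃ w : ℕ → Plane → ℝ,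
    (∀ m, IsTest (w m)) ∧ (∀ᵐ x, Tendsto (fun m => w m x) atTop (𝓝 (W.val p x))) ∧
    (∀ m, ∫ x, w m x ^ 2 ≤ (C * ‖p‖) ^ 2) ∧
    (∀ m j, ∫ x, pderiv j (w m) x ^ 2 ≤ (C * ‖p‖) ^ 2) ∧
    ((W.val p).IsRadial → ∀ m x y, ‖x‖ = ‖y‖ → w m x = w m y) := by
  obtain ⟨b0, hb0, hb0'⟩ := (isTest_bump.pderiv 0).exists_bound
  obtain ⟨b1, hb1, hb1'⟩ := (isTest_bump.pderiv 1).exists_bound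
  set b := b0 + b1
  have hb : ∀ j x, |pderiv j bump x| ≤ b := by
    intro j x
    fin_cases j
    · exact (hb0' x).trans (by simp [b, hb1])
    · exact (hb1' x).trans (by simp [b, hb0])
  have hbn : 0 ≤ b := by positivity
  -- For the product rule: `2b² + 2 ≤ (2(b + 1))²`, where `b` bounds the derivatives of every
  -- cutoff.
  refine ⟨2 * (b + 1), by linarith, fun p => ?_⟩
  obtain ⟨ns, hns, hae⟩ := (tendstoInMeasure_of_tendsto_Lp
    (tendsto_convL (W.val p))).exists_seq_tendsto_ae
  set v : ℕ → Plane → ℝ := fun m => cv (kap (ns m)) (W.val p)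
  have hv : ∀ m, ContDiff ℝ ∞ (v m) := fun m =>
    contDiff_cv (isKernel_kap _).test (L2.locallyIntegrable _)
  have hvL : ∀ m, MemLp (v m) 2 volume := fun m => (isKernel_kap _).memLp_cv _
  have hv2 : ∀ m, ∫ x, v m x ^ 2 ≤ ‖p‖ ^ 2 := fun m => by
    have h1 := norm_convL_le (isKernel_kap (ns m)) (W.val p)
    have h2 : ∫ x, v m x ^ 2 = ‖convL (isKernel_kap (ns m)) (W.val p)‖ ^ 2 := by
      rw [norm_sq_L2]
      exact integral_congr_ae ((coeFn_convL (isKernel_kap (ns m)) (W.val p)).mono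
        fun x hx => by simp [hx, v])
    rw [h2]
    exact pow_le_pow_left₀ (norm_nonneg _) (h1.trans (W.norm_val_le p)) 2
  have hvd : ∀ m j, pderiv j (v m) = cv (kap (ns m)) (W.der j p) := fun m j =>
    pderiv_cv_val (isKernel_kap _).test p j
  have hvdL : ∀ m j, MemLp (pderiv j (v m)) 2 volume := fun m j => by
    rw [hvd]; exact (isKernel_kap _).memLp_cv _
  have hvd2 : ∀ m j, ∫ x, pderiv j (v m) x ^ 2 ≤ ‖p‖ ^ 2 := fun m j => by
    have h1 := norm_convL_le (isKernel_kap (ns m)) (W.der j p)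
    have h2 : ∫ x, pderiv j (v m) x ^ 2 = ‖convL (isKernel_kap (ns m)) (W.der j p)‖ ^ 2 := by
      rw [norm_sq_L2, hvd]
      exact integral_congr_ae ((coeFn_convL (isKernel_kap (ns m)) (W.der j p)).mono
        fun x hx => by simp [hx])
    rw [h2]
    exact pow_le_pow_left₀ (norm_nonneg _) (h1.trans (W.norm_der_le p j)) 2
  set z : ℕ → Plane → ℝ := fun m x => bump (((m : ℝ) + 1)⁻¹ • x)
  have hzt : ∀ m, IsTest (z m) := fun m => isTest_bump.comp_smul (by positivity)
  have hz0 : ∀ m x, 0 ≤ z m x := fun m x => bump_nonneg _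
  have hz1 : ∀ m x, z m x ≤ 1 := fun m x => bump_le_one _
  have hzd : ∀ m j x, |pderiv j (z m) x| ≤ b := by
    intro m j x
    rw [pderiv_comp_smul _ _ _ (differentiableAt_of_smooth contDiff_bump _), abs_mul]
    have : |((m : ℝ) + 1)⁻¹| ≤ 1 := by
      rw [abs_of_nonneg (by positivity)]
      exact inv_le_one_of_one_le₀ (by linarith [(Nat.cast_nonneg m : (0 : ℝ) ≤ m)])
    calc _ ≤ 1 * b := mul_le_mul this (hb _ _) (abs_nonneg _) zero_le_one
      _ = b := one_mul _
  have hwt : ∀ m, IsTest (fun x => z m x * v m x) := fun m => (hzt m).mul_smooth (hv m)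
  refine ⟨fun m x => z m x * v m x, hwt, ?_, fun m => ?_, fun m j => ?_, fun hr m x y hxy => ?_⟩
  · have hall : ∀ᵐ x, ∀ m, convL (isKernel_kap (ns m)) (W.val p) x = v m x :=
      ae_all_iff.2 fun m => coeFn_convL (isKernel_kap (ns m)) (W.val p)
    filter_upwards [hae, hall] with x hx hx'
    have h1 : Tendsto (fun m => v m x) atTop (𝓝 (W.val p x)) := by
      refine hx.congr fun m => ?_
      exact hx' m
    have h2 : ∀ᶠ m in atTop, z m x = 1 := by
      obtain ⟨N, hN⟩ := exists_nat_gt ‖x‖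
      filter_upwards [eventually_ge_atTop N] with m hm
      refine bump_eq_one ?_
      have hm' : (N : ℝ) ≤ m := by exact_mod_cast hm
      rw [norm_smul, Real.norm_of_nonneg (by positivity), inv_mul_le_iff₀ (by positivity)]
      linarith
    refine h1.congr' ?_
    filter_upwards [h2] with m hm
    rw [hm, one_mul]
  · have : ∫ x, (z m x * v m x) ^ 2 ≤ ∫ x, v m x ^ 2 := by
      refine integral_mono (hwt m).memLp.integrable_sq (hvL m).integrable_sq fun x => ?_
      simp only [mul_pow]
      have := pow_le_one₀ (n := 2) (hz0 m x) (hz1 m x)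
      nlinarith [sq_nonneg (v m x)]
    refine this.trans ((hv2 m).trans ?_)
    exact pow_le_pow_left₀ (norm_nonneg _) (by nlinarith [norm_nonneg p]) 2
  · have hle : ∀ x, pderiv j (fun y => z m y * v m y) x ^ 2 ≤
        2 * b ^ 2 * v m x ^ 2 + 2 * pderiv j (v m) x ^ 2 := by
      intro x
      rw [pderiv_mul (differentiableAt_of_smooth (hzt m).1 x) (differentiableAt_of_smooth (hv m) x)]
      have h1 : pderiv j (z m) x ^ 2 ≤ b ^ 2 := by
        rw [← sq_abs]; exact pow_le_pow_left₀ (abs_nonneg _) (hzd m j x) 2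
      have h2 := pow_le_one₀ (n := 2) (hz0 m x) (hz1 m x)
      have h3 := mul_le_mul_of_nonneg_right h1 (sq_nonneg (v m x))
      have h4 := mul_le_mul_of_nonneg_right h2 (sq_nonneg (pderiv j (v m) x))
      nlinarith [sq_nonneg (pderiv j (z m) x * v m x - z m x * pderiv j (v m) x)]
    have hi1 := (hvL m).integrable_sq.const_mul (2 * b ^ 2)
    have hi2 := (hvdL m j).integrable_sq.const_mul 2
    refine (integral_mono ((hwt m).memLp_pderiv j).integrable_sq (hi1.add hi2) hle).trans ?_
    simp only [Pi.add_apply]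
    rw [integral_add hi1 hi2, integral_const_mul, integral_const_mul]
    have := mul_le_mul_of_nonneg_left (hv2 m) (sq_nonneg b)
    nlinarith [hvd2 m j, sq_nonneg ‖p‖, mul_nonneg hbn (sq_nonneg ‖p‖)]
  · have h1 : z m x = z m y := bump_congr (by rw [norm_smul, norm_smul, hxy])
    have h2 : v m x = v m y := cv_radial (fun a b h => kap_congr _ h) hr hxy
    simp only [h1, h2]

/-- Sobolev embedding of `H¹` into all even Lebesgue spaces. -/
theorem exists_sobolev (k : ℕ) : ∃ C : ℝ, 0 ≤ C ∧ ∀ p : W,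
    Integrable (fun x => W.val p x ^ (2 * (k + 1))) ∧
    ∫ x, W.val p x ^ (2 * (k + 1)) ≤ C * ‖p‖ ^ (2 * (k + 1)) := by
  obtain ⟨C₁, hC₁, h₁⟩ := exists_sobolev_test k
  obtain ⟨C₂, hC₂, h₂⟩ := exists_test_approx
  refine ⟨C₁ * C₂ ^ (2 * (k + 1)), by positivity, fun p => ?_⟩
  obtain ⟨w, hw, hlim, hB0, hB1, -⟩ := h₂ p
  rw [mul_assoc, ← mul_pow]
  refine integral_le_of_ae_tendsto (F := fun m x => w m x ^ (2 * (k + 1)))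
    (fun m x => by rw [pow_mul]; positivity) (fun m => ((hw m).pow (by omega)).integrable)
    (fun m => h₁ (w m) _ (hw m) (hB0 m) (hB1 m)) ?_
  filter_upwards [hlim] with x hx
  exact hx.pow _

end CubicQuintic

namespace CubicQuintic

/-! ### The radial Sobolev inequality -/

theorem norm_fderiv_radial {w : Plane → ℝ} (hw : IsTest w)
    (hr : ∀ x y : Plane, ‖x‖ = ‖y‖ → w x = w y) {x y : Plane} (h : ‖x‖ = ‖y‖) :
    ‖fderiv ℝ w x‖ = ‖fderiv ℝ w y‖ := by
  obtain ⟨A, rfl⟩ := exists_isometry h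
  have e : w = fun z => w (A z) := by
    ext z; exact hr _ _ (A.norm_map z).symm
  have h1 : fderiv ℝ w x = (fderiv ℝ w (A x)).comp (A : Plane →L[ℝ] Plane) := by
    conv_lhs => rw [e]
    exact ((differentiableAt_of_smooth hw.1 (A x)).hasFDerivAt.comp x
      (A : Plane →L[ℝ] Plane).hasFDerivAt).fderiv
  rw [h1]
  exact ContinuousLinearMap.opNorm_comp_linearIsometryEquiv _ A

/-- Strauss's argument: `r w(r)² = -r ∫_r^∞ 2 w w' ds ≤ 2 ∫ s |w| |w'| ds`, because `r ≤ s` in the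
integral. In polar coordinates the last integral is a multiple of `∫ |w| |∇w| dx`, to which
Cauchy–Schwarz applies. -/
theorem exists_radial_test : ∃ C : ℝ, 0 ≤ C ∧ ∀ (w : Plane → ℝ) (B : ℝ), IsTest w → 0 ≤ B →
    (∀ x y : Plane, ‖x‖ = ‖y‖ → w x = w y) → ∫ x, w x ^ 2 ≤ B ^ 2 →
    (∀ j, ∫ x, pderiv j w x ^ 2 ≤ B ^ 2) → ∀ x, ‖x‖ * w x ^ 2 ≤ C * B ^ 2 := by
  set c := volume.real (Metric.ball (0 : Plane) 1)
  have hc : 0 < c := by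
    refine ENNReal.toReal_pos (Metric.measure_ball_pos _ _ one_pos).ne' measure_ball_lt_top.ne
  -- Polar coordinates carry the factor `2c`, with `c` the area of the unit disc, and the planar
  -- integral is at most `2B²`; so the radial integral is at most `B²/c`.
  refine ⟨2 / c, by positivity, fun w B hw hB hr h0 h1 x => ?_⟩
  set e : Plane := EuclideanSpace.single 0 1
  have he : ‖e‖ = 1 := by simp [e]
  set H : ℝ → ℝ := fun s => |w (s • e)| * ‖fderiv ℝ w (s • e)‖
  have hse : ∀ s : ℝ, 0 ≤ s → ‖s • e‖ = s := fun s hs => by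
    rw [norm_smul, he, mul_one, Real.norm_of_nonneg hs]
  have hH : ∀ z : Plane, H ‖z‖ = |w z| * ‖fderiv ℝ w z‖ := by
    intro z
    have hz := hse ‖z‖ (norm_nonneg z)
    simp only [H]
    rw [hr _ _ hz, norm_fderiv_radial hw hr hz]
  have hfc : Continuous (fderiv ℝ w) := hw.1.continuous_fderiv (by simp)
  have hHc : Continuous H := by
    have h1 : Continuous fun s : ℝ => s • e := by fun_prop
    exact (hw.continuous.comp h1).abs.mul (hfc.comp h1).norm
  -- the planar integral controls the radial one
  have hint : Integrable (fun z : Plane => H ‖z‖) := by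
    simp_rw [hH]
    refine (hw.continuous.abs.mul hfc.norm).integrable_of_hasCompactSupport ?_
    exact (hw.2.comp_left (g := fun t : ℝ => |t|) abs_zero).mul_right
  have hpol := integral_fun_norm_addHaar (volume : Measure Plane) H
  have hdim : Module.finrank ℝ Plane = 2 := by simp
  have hradint := (integrable_fun_norm_addHaar (volume : Measure Plane)).1 hint
  simp only [hdim, Nat.add_one_sub_one, pow_one, smul_eq_mul, nsmul_eq_mul, Nat.cast_ofNat]
    at hpol hradint
  have hbound : ∫ z : Plane, H ‖z‖ ≤ 2 * B ^ 2 := by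
    simp_rw [hH]
    have hle : ∀ z, |w z| * ‖fderiv ℝ w z‖ ≤ |w z * pderiv 0 w z| + |w z * pderiv 1 w z| := by
      intro z
      rw [abs_mul, abs_mul, ← mul_add]
      exact mul_le_mul_of_nonneg_left (norm_clm_le _) (abs_nonneg _)
    have hi : ∀ j, Integrable (fun z => |w z * pderiv j w z|) := fun j =>
      (hw.mul_smooth (contDiff_pderiv hw.1 j)).integrable.abs
    have hcs : ∀ j, ∫ z, |w z * pderiv j w z| ≤ B ^ 2 := by
      intro j
      refine le_of_sq_le_sq ((sq_integral_abs_mul_le hw.memLp (hw.memLp_pderiv j)).trans ?_)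
        (by positivity)
      rw [sq (B ^ 2)]
      exact mul_le_mul h0 (h1 j) (integral_nonneg fun x => sq_nonneg _) (by positivity)
    simp_rw [hH] at hint
    refine (integral_mono hint ((hi 0).add (hi 1)) hle).trans ?_
    simp only [Pi.add_apply]
    rw [integral_add (hi 0) (hi 1)]
    linarith [hcs 0, hcs 1]
  rcases eq_or_lt_of_le (norm_nonneg x) with hx | hx
  · rw [← hx]; simp; positivity
  set r := ‖x‖
  obtain ⟨S₀, hS₀⟩ := hw.2.isCompact.isBounded.subset_closedBall (0 : Plane)
  -- A radius beyond the support, replacing infinity in the fundamental theorem of calculus, and at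
  -- least `r` so that the interval is correctly oriented.
  set S := max (S₀ + 1) r
  have hrS : r ≤ S := le_max_right _ _
  have hwS : w (S • e) = 0 := by
    by_contra h
    have := hS₀ (subset_tsupport _ h)
    rw [mem_closedBall_zero_iff, hse S (hx.le.trans hrS)] at this
    have : S₀ + 1 ≤ S := le_max_left _ _
    linarith
  have hd : ∀ s : ℝ, HasDerivAt (fun s : ℝ => w (s • e) ^ 2)
      (2 * w (s • e) * fderiv ℝ w (s • e) e) s := by
    intro s
    have h1 : HasDerivAt (fun s : ℝ => s • e) e s := by
      simpa using (hasDerivAt_id s).smul_const e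
    have h2 := (differentiableAt_of_smooth hw.1 (s • e)).hasFDerivAt.comp_hasDerivAt s h1
    simpa using h2.fun_pow 2
  have hdc : Continuous (fun s : ℝ => 2 * w (s • e) * fderiv ℝ w (s • e) e) := by
    have h1 : Continuous fun s : ℝ => s • e := by fun_prop
    exact ((hw.continuous.comp h1).const_mul 2).mul ((hfc.comp h1).clm_apply continuous_const)
  have hftc := intervalIntegral.integral_eq_sub_of_hasDerivAt (a := r) (b := S)
    (fun s _ => hd s) (hdc.intervalIntegrable _ _)
  rw [hwS] at hftc
  have hwx : w (r • e) = w x := hr _ _ (hse r hx.le)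
  rw [hwx] at hftc
  have h2 : r * w x ^ 2 ≤ ∫ s in r..S, 2 * (s * H s) := by
    have : r * w x ^ 2 = ∫ s in r..S, -(r * (2 * w (s • e) * fderiv ℝ w (s • e) e)) := by
      rw [intervalIntegral.integral_neg, intervalIntegral.integral_const_mul, hftc]; ring
    rw [this]
    refine intervalIntegral.integral_mono_on hrS
      ((continuous_const.mul hdc).neg.intervalIntegrable _ _)
      ((continuous_const.mul (continuous_id.mul hHc)).intervalIntegrable _ _) fun s hs => ?_
    have hb : |w (s • e) * fderiv ℝ w (s • e) e| ≤ H s := by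
      rw [abs_mul]
      refine mul_le_mul_of_nonneg_left ?_ (abs_nonneg _)
      have := (fderiv ℝ w (s • e)).le_opNorm e
      rwa [he, mul_one] at this
    have hb' := (abs_le.1 hb).1
    have hH0 : 0 ≤ H s := (abs_nonneg _).trans hb
    nlinarith [hs.1, mul_le_mul_of_nonneg_right hs.1 hH0]
  have h3 : ∫ s in r..S, 2 * (s * H s) ≤ 2 * ∫ s in Ioi (0 : ℝ), s * H s := by
    rw [intervalIntegral.integral_const_mul, intervalIntegral.integral_of_le hrS]
    refine mul_le_mul_of_nonneg_left ?_ zero_le_two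
    refine setIntegral_mono_set hradint ?_ ?_
    · filter_upwards [ae_restrict_mem measurableSet_Ioi] with s hs
      exact mul_nonneg (le_of_lt hs) (mul_nonneg (abs_nonneg _) (norm_nonneg _))
    · exact LE.le.eventuallyLE fun s hs => hx.trans hs.1
  rw [hpol] at hbound
  have h4 : ∫ s in Ioi (0 : ℝ), s * H s ≤ B ^ 2 / c := by
    rw [le_div_iff₀ hc]
    simp only [c] at hbound ⊢
    linarith
  calc r * w x ^ 2 ≤ 2 * (B ^ 2 / c) := h2.trans (h3.trans (by linarith))
    _ = 2 / c * B ^ 2 := by ring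

/-- The radial Sobolev inequality `|x| |f(x)|² ≤ C ‖f‖_{H¹}²`. -/
theorem exists_radial_sobolev : ∃ C : ℝ, 0 ≤ C ∧ ∀ p : W, (W.val p).IsRadial →
    ∀ᵐ x, ‖x‖ * W.val p x ^ 2 ≤ C * ‖p‖ ^ 2 := by
  obtain ⟨C₁, hC₁, h₁⟩ := exists_radial_test
  obtain ⟨C₂, hC₂, h₂⟩ := exists_test_approx
  refine ⟨C₁ * C₂ ^ 2, by positivity, fun p hp => ?_⟩
  obtain ⟨w, hw, hlim, hB0, hB1, hr⟩ := h₂ p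
  filter_upwards [hlim] with x hx
  rw [mul_assoc, ← mul_pow]
  exact le_of_tendsto' ((hx.pow 2).const_mul _) fun m =>
    h₁ (w m) _ (hw m) (by positivity) (hr hp m) (hB0 m) (hB1 m) x

end CubicQuintic

namespace CubicQuintic

/-! ### Nonlinear functionals on the Sobolev space -/

theorem exists_eLpNorm_le (m : ℕ) (hm : 1 ≤ m) : ∃ C : NNReal, ∀ p : W,
    MemLp (W.val p) ((2 * m : ℕ) : ENNReal) volume ∧
    eLpNorm (W.val p) ((2 * m : ℕ) : ENNReal) volume ≤ C * ENNReal.ofReal ‖p‖ := by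
  obtain ⟨k, rfl⟩ : ∃ k, m = k + 1 := ⟨m - 1, by omega⟩
  obtain ⟨C, hC, h⟩ := exists_sobolev k
  set P : ENNReal := ((2 * (k + 1) : ℕ) : ENNReal) with hP
  have hP0 : P ≠ 0 := by simp [hP]
  have hPt : P ≠ ⊤ := ENNReal.natCast_ne_top _
  have hPr : P.toReal = (2 * (k + 1) : ℕ) := by simp only [hP, ENNReal.toReal_natCast]
  have hPpos : 0 < P.toReal := ENNReal.toReal_pos hP0 hPt
  refine ⟨(C ^ P.toReal⁻¹).toNNReal, fun p => ?_⟩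
  have e : ∀ x, ‖W.val p x‖ ^ P.toReal = W.val p x ^ (2 * (k + 1)) := fun x => by
    rw [hPr, Real.rpow_natCast, Real.norm_eq_abs, pow_mul, pow_mul, sq_abs]
  have hmem : MemLp (W.val p) P volume := by
    rw [← integrable_norm_rpow_iff (Lp.aestronglyMeasurable _) hP0 hPt]
    simp_rw [e]
    exact (h p).1
  refine ⟨hmem, ?_⟩
  rw [hmem.eLpNorm_eq_integral_rpow_norm hP0 hPt]
  simp_rw [e]
  change _ ≤ ENNReal.ofReal (C ^ P.toReal⁻¹) * ENNReal.ofReal ‖p‖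
  rw [← ENNReal.ofReal_mul (by positivity)]
  refine ENNReal.ofReal_le_ofReal ?_
  have h1 : ∫ x, W.val p x ^ (2 * (k + 1)) ≤ C * ‖p‖ ^ P.toReal := by
    rw [hPr, Real.rpow_natCast]; exact (h p).2
  have h0 : 0 ≤ ∫ x, W.val p x ^ (2 * (k + 1)) :=
    integral_nonneg fun x => by rw [pow_mul]; positivity
  calc (∫ x, W.val p x ^ (2 * (k + 1))) ^ P.toReal⁻¹
      ≤ (C * ‖p‖ ^ P.toReal) ^ P.toReal⁻¹ :=
        Real.rpow_le_rpow h0 h1 (inv_nonneg.2 hPpos.le)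
    _ = C ^ P.toReal⁻¹ * ‖p‖ := by
        rw [Real.mul_rpow hC (by positivity), Real.rpow_rpow_inv (norm_nonneg _) hPpos.ne']

/-- A nonlinear map on the Sobolev space, into all even Lebesgue spaces, bounded on bounded sets
and continuous. -/
structure Good (F : W × W → Plane → ℝ) : Prop where
  memLp : ∀ m : ℕ, 1 ≤ m → ∀ y, MemLp (F y) ((2 * m : ℕ) : ENNReal) volume
  bdd : ∀ m : ℕ, 1 ≤ m → ∀ r : ℝ, ∃ C : NNReal, ∀ y, ‖y‖ ≤ r →
    eLpNorm (F y) ((2 * m : ℕ) : ENNReal) volume ≤ C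
  cont : ∀ m : ℕ, 1 ≤ m → ∀ y₀, Tendsto
    (fun y => eLpNorm (F y - F y₀) ((2 * m : ℕ) : ENNReal) volume) (𝓝 y₀) (𝓝 0)

theorem one_le_two_mul_cast {m : ℕ} (hm : 1 ≤ m) : (1 : ENNReal) ≤ ((2 * m : ℕ) : ENNReal) := by
  exact_mod_cast (by omega : 1 ≤ 2 * m)

theorem good_of_linear (L : W × W →L[ℝ] W) : Good (fun y => W.val (L y)) where
  memLp m hm y := ((exists_eLpNorm_le m hm).choose_spec (L y)).1
  bdd m hm r := by
    obtain ⟨C, hC⟩ := exists_eLpNorm_le m hm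
    refine ⟨C * Real.toNNReal (‖L‖ * r), fun y hy => (hC _).2.trans ?_⟩
    rw [ENNReal.coe_mul]
    gcongr
    refine ENNReal.ofReal_le_ofReal ((L.le_opNorm y).trans ?_)
    gcongr
  cont m hm y₀ := by
    obtain ⟨C, hC⟩ := exists_eLpNorm_le m hm
    have h1 : Tendsto (fun y => (C : ENNReal) * ENNReal.ofReal ‖L (y - y₀)‖) (𝓝 y₀) (𝓝 0) := by
      have hc : Continuous fun y => (C : ENNReal) * ENNReal.ofReal ‖L (y - y₀)‖ :=
        (ENNReal.continuous_const_mul ENNReal.coe_ne_top).comp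
          (ENNReal.continuous_ofReal.comp (L.continuous.comp (continuous_id.sub continuous_const)).norm)
      simpa using hc.tendsto y₀
    refine tendsto_of_tendsto_of_tendsto_of_le_of_le tendsto_const_nhds h1 (fun _ => zero_le) ?_
    intro y
    refine le_trans (le_of_eq ?_) (hC (L (y - y₀))).2
    refine eLpNorm_congr_ae ?_
    rw [map_sub, map_sub]
    exact (Lp.coeFn_sub _ _).symm

theorem Good.add {F G : W × W → Plane → ℝ} (hF : Good F) (hG : Good G) :
    Good (fun y x => F y x + G y x) where
  memLp m hm y := (hF.memLp m hm y).add (hG.memLp m hm y)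
  bdd m hm r := by
    obtain ⟨C, hC⟩ := hF.bdd m hm r
    obtain ⟨D, hD⟩ := hG.bdd m hm r
    refine ⟨C + D, fun y hy => ?_⟩
    rw [ENNReal.coe_add]
    exact (eLpNorm_add_le (hF.memLp m hm y).1 (hG.memLp m hm y).1 (one_le_two_mul_cast hm)).trans
      (add_le_add (hC y hy) (hD y hy))
  cont m hm y₀ := by
    have h := (hF.cont m hm y₀).add (hG.cont m hm y₀)
    rw [add_zero] at h
    refine tendsto_of_tendsto_of_tendsto_of_le_of_le tendsto_const_nhds h (fun _ => zero_le) ?_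
    intro y
    have e : ((fun x => F y x + G y x) - fun x => F y₀ x + G y₀ x) =
        (F y - F y₀) + (G y - G y₀) := by ext x; simp; ring
    simp only [e]
    exact eLpNorm_add_le ((hF.memLp m hm y).sub (hF.memLp m hm y₀)).1
      ((hG.memLp m hm y).sub (hG.memLp m hm y₀)).1 (one_le_two_mul_cast hm)

theorem eLpNorm_mul_le_of_holder {f g : Plane → ℝ} (hf : AEStronglyMeasurable f)
    (hg : AEStronglyMeasurable g) (p q r : ENNReal) [ENNReal.HolderTriple p q r] :
    eLpNorm (fun x => f x * g x) r volume ≤ eLpNorm f p volume * eLpNorm g q volume := by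
  have h := eLpNorm_le_eLpNorm_mul_eLpNorm_of_nnnorm (p := p) (q := q) (r := r) hf hg
    (fun a b : ℝ => a * b) 1 (ae_of_all _ fun x => by simp [nnnorm_mul])
  rwa [ENNReal.coe_one, one_mul] at h

theorem eLpNorm_mul_le {f g : Plane → ℝ} (hf : AEStronglyMeasurable f) (hg : AEStronglyMeasurable g)
    (m : ℕ) : eLpNorm (fun x => f x * g x) ((2 * m : ℕ) : ENNReal) volume ≤
      eLpNorm f ((2 * (2 * m) : ℕ) : ENNReal) volume *
      eLpNorm g ((2 * (2 * m) : ℕ) : ENNReal) volume := by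
  have : ENNReal.HolderTriple ((2 * (2 * m) : ℕ) : ENNReal) ((2 * (2 * m) : ℕ) : ENNReal)
      ((2 * m : ℕ) : ENNReal) := by
    constructor
    push_cast
    rw [ENNReal.mul_inv (by simp) (by simp), ← add_mul, ENNReal.inv_two_add_inv_two, one_mul]
  exact eLpNorm_mul_le_of_holder hf hg _ _ _

/-- Hölder places a product in `L^{2m}` when both factors are in `L^{4m}`. This doubling is why
`Good` asks for all even exponents: only then is the class closed under products. -/
theorem Good.mul {F G : W × W → Plane → ℝ} (hF : Good F) (hG : Good G) :
    Good (fun y x => F y x * G y x) where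
  memLp m hm y := by
    refine ⟨(hF.memLp m hm y).1.mul (hG.memLp m hm y).1,
      (eLpNorm_mul_le (hF.memLp m hm y).1 (hG.memLp m hm y).1 m).trans_lt ?_⟩
    exact ENNReal.mul_lt_top (hF.memLp (2 * m) (by omega) y).2 (hG.memLp (2 * m) (by omega) y).2
  bdd m hm r := by
    obtain ⟨C, hC⟩ := hF.bdd (2 * m) (by omega) r
    obtain ⟨D, hD⟩ := hG.bdd (2 * m) (by omega) r
    refine ⟨C * D, fun y hy => ?_⟩
    rw [ENNReal.coe_mul]
    exact (eLpNorm_mul_le (hF.memLp m hm y).1 (hG.memLp m hm y).1 m).trans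
      (mul_le_mul' (hC y hy) (hD y hy))
  cont m hm y₀ := by
    -- Continuity uses `FG - F₀G₀ = (F - F₀)G + F₀(G - G₀)`, so `G` must be bounded on a
    -- neighbourhood of the base point.
    obtain ⟨D, hD⟩ := hG.bdd (2 * m) (by omega) (‖y₀‖ + 1)
    have hF0 := (hF.memLp (2 * m) (by omega) y₀).2
    have h1 := ENNReal.Tendsto.mul_const (b := (D : ENNReal)) (hF.cont (2 * m) (by omega) y₀)
      (Or.inr ENNReal.coe_ne_top)
    have h2 := ENNReal.Tendsto.const_mul
      (a := eLpNorm (F y₀) ((2 * (2 * m) : ℕ) : ENNReal) volume)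
      (hG.cont (2 * m) (by omega) y₀) (Or.inr hF0.ne)
    have h := h1.add h2
    rw [zero_mul, mul_zero, add_zero] at h
    refine tendsto_of_tendsto_of_tendsto_of_le_of_le' tendsto_const_nhds h
      (Eventually.of_forall fun _ => zero_le) ?_
    have hnear : ∀ᶠ y in 𝓝 y₀, ‖y‖ ≤ ‖y₀‖ + 1 :=
      (continuous_norm.tendsto y₀).eventually (eventually_le_nhds (by linarith))
    filter_upwards [hnear] with y hy
    have e : ((fun x => F y x * G y x) - fun x => F y₀ x * G y₀ x) =
        (fun x => (F y - F y₀) x * G y x) + (fun x => F y₀ x * (G y - G y₀) x) := by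
      ext x; simp; ring
    rw [e]
    have m1 := ((hF.memLp m hm y).sub (hF.memLp m hm y₀)).1
    have m2 := ((hG.memLp m hm y).sub (hG.memLp m hm y₀)).1
    refine (eLpNorm_add_le (m1.mul (hG.memLp m hm y).1) ((hF.memLp m hm y₀).1.mul m2)
      (one_le_two_mul_cast hm)).trans (add_le_add ?_ ?_)
    · exact (eLpNorm_mul_le m1 (hG.memLp m hm y).1 m).trans (mul_le_mul' le_rfl (hD y hy))
    · exact eLpNorm_mul_le (hF.memLp m hm y₀).1 m2 m

theorem Good.const_mul {F : W × W → Plane → ℝ} (hF : Good F) (c : ℝ) :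
    Good (fun y x => c * F y x) where
  memLp m hm y := (hF.memLp m hm y).const_mul c
  bdd m hm r := by
    obtain ⟨C, hC⟩ := hF.bdd m hm r
    refine ⟨‖c‖₊ * C, fun y hy => ?_⟩
    rw [ENNReal.coe_mul]
    exact (eLpNorm_const_smul_le (c := c)).trans (mul_le_mul' le_rfl (hC y hy))
  cont m hm y₀ := by
    have h := ENNReal.Tendsto.const_mul (a := ‖c‖ₑ) (hF.cont m hm y₀) (Or.inr enorm_ne_top)
    rw [mul_zero] at h
    refine tendsto_of_tendsto_of_tendsto_of_le_of_le tendsto_const_nhds h (fun _ => zero_le) ?_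
    intro y
    have e : ((fun x => c * F y x) - fun x => c * F y₀ x) = c • (F y - F y₀) := by
      ext x; simp; ring
    simp only [e]
    exact eLpNorm_const_smul_le

theorem Good.memLp_two {F : W × W → Plane → ℝ} (hF : Good F) (y : W × W) :
    MemLp (F y) 2 volume := by simpa using hF.memLp 1 le_rfl y

/-- A good nonlinear map, as a map into square-integrable functions. -/
noncomputable def Good.toL2 {F : W × W → Plane → ℝ} (hF : Good F) (y : W × W) : L2 :=
  (hF.memLp_two y).toLp _

theorem Good.coeFn_toL2 {F : W × W → Plane → ℝ} (hF : Good F) (y : W × W) :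
    hF.toL2 y =ᵐ[volume] F y := (hF.memLp_two y).coeFn_toLp

theorem Good.continuous_toL2 {F : W × W → Plane → ℝ} (hF : Good F) : Continuous hF.toL2 := by
  rw [continuous_iff_continuousAt]
  intro y₀
  have h := hF.cont 1 le_rfl y₀
  simp only [mul_one, Nat.cast_ofNat] at h
  rw [ContinuousAt, Good.toL2]
  exact (Lp.tendsto_Lp_iff_tendsto_eLpNorm'' (fun y => F y) hF.memLp_two (F y₀)
    (hF.memLp_two y₀)).2 h

theorem Good.exists_norm_toL2_le {F : W × W → Plane → ℝ} (hF : Good F) (r : ℝ) :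
    ∃ C : ℝ, 0 ≤ C ∧ ∀ y, ‖y‖ ≤ r → ‖hF.toL2 y‖ ≤ C := by
  obtain ⟨C, hC⟩ := hF.bdd 1 le_rfl r
  simp only [mul_one, Nat.cast_ofNat] at hC
  refine ⟨C, C.2, fun y hy => ?_⟩
  rw [Good.toL2, Lp.norm_toLp]
  exact ENNReal.toReal_le_coe_of_le_coe (hC y hy)

/-- The density `|u|²`. -/
noncomputable def dens (y : W × W) (x : Plane) : ℝ := W.val y.1 x * W.val y.1 x +
  W.val y.2 x * W.val y.2 x

theorem good_re : Good (fun y => W.val y.1) := good_of_linear (ContinuousLinearMap.fst ℝ W W)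

theorem good_im : Good (fun y => W.val y.2) := good_of_linear (ContinuousLinearMap.snd ℝ W W)

theorem good_dens : Good dens := (good_re.mul good_re).add (good_im.mul good_im)

theorem good_dens_sq : Good (fun y x => dens y x * dens y x) := good_dens.mul good_dens

/-- The factor `-|u|² + |u|⁴` of the nonlinearity. -/
noncomputable def fac (y : W × W) (x : Plane) : ℝ := -1 * dens y x + dens y x * dens y x

theorem good_fac : Good fac := (good_dens.const_mul (-1)).add good_dens_sq

theorem good_nonlin_re : Good (fun y x => fac y x * W.val y.1 x) := good_fac.mul good_re

theorem good_nonlin_im : Good (fun y x => fac y x * W.val y.2 x) := good_fac.mul good_im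

/-- The real part of the nonlinearity. -/
noncomputable def nre : W × W → L2 := good_nonlin_re.toL2

/-- The imaginary part of the nonlinearity. -/
noncomputable def nim : W × W → L2 := good_nonlin_im.toL2

/-- The density `|u|²` in `L²`. -/
noncomputable def densL : W × W → L2 := good_dens.toL2

/-- The density `|u|⁴` in `L²`. -/
noncomputable def densSqL : W × W → L2 := good_dens_sq.toL2

/-! ### Weighted pairings -/

/-- The weighted pairing `∫ c f g`. -/
noncomputable def pair (c : Plane → ℝ) (f g : L2) : ℝ := ∫ x, c x * (f x * g x)

/-- A bounded continuous weight. -/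
structure IsWeight (c : Plane → ℝ) : Prop where
  continuous : Continuous c
  bounded : ∃ C, ∀ x, |c x| ≤ C

theorem IsTest.isWeight {c : Plane → ℝ} (hc : IsTest c) : IsWeight c :=
  ⟨hc.continuous, hc.exists_bound.imp fun _ h => h.2⟩

theorem IsWeight.abs_pair_le {c : Plane → ℝ} (hc : IsWeight c) {C : ℝ} (hC : ∀ x, |c x| ≤ C)
    (f g : L2) : |pair c f g| ≤ C * (‖f‖ * ‖g‖) :=
  (abs_integral_mul_le hc.continuous.aestronglyMeasurable hC f g).2

theorem IsWeight.integrable {c : Plane → ℝ} (hc : IsWeight c) (f g : L2) :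
    Integrable (fun x => c x * (f x * g x)) := by
  obtain ⟨C, hC⟩ := hc.bounded
  exact (abs_integral_mul_le hc.continuous.aestronglyMeasurable hC f g).1

theorem IsWeight.pair_add_left {c : Plane → ℝ} (hc : IsWeight c) (f f' g : L2) :
    pair c (f + f') g = pair c f g + pair c f' g := by
  rw [pair, pair, pair, ← integral_add (hc.integrable f g) (hc.integrable f' g)]
  refine integral_congr_ae ((Lp.coeFn_add f f').mono fun x hx => ?_)
  simp only [hx, Pi.add_apply]; ring

theorem pair_comm (c : Plane → ℝ) (f g : L2) : pair c f g = pair c g f := by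
  simp only [pair, mul_comm]

theorem pair_smul_left (c : Plane → ℝ) (a : ℝ) (f g : L2) :
    pair c (a • f) g = a * pair c f g := by
  rw [pair, pair, ← integral_const_mul]
  refine integral_congr_ae ((Lp.coeFn_smul a f).mono fun x hx => ?_)
  simp only [hx, Pi.smul_apply, smul_eq_mul]; ring

theorem IsWeight.continuous_pair {c : Plane → ℝ} (hc : IsWeight c) :
    Continuous (fun fg : L2 × L2 => pair c fg.1 fg.2) := by
  obtain ⟨C, hC⟩ := hc.bounded
  let B : L2 →ₗ[ℝ] L2 →ₗ[ℝ] ℝ := LinearMap.mk₂ ℝ (pair c) hc.pair_add_left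
    (fun a f g => by rw [pair_smul_left, smul_eq_mul])
    (fun f g g' => by rw [pair_comm, hc.pair_add_left, pair_comm c g, pair_comm c g'])
    (fun a f g => by rw [pair_comm, pair_smul_left, pair_comm, smul_eq_mul])
  let B' := B.mkContinuous₂ C fun f g => by
    rw [mul_assoc]; exact hc.abs_pair_le hC f g
  exact (B'.continuous.comp continuous_fst).clm_apply continuous_snd

theorem IsWeight.continuous_pair_comp {Y : Type*} [TopologicalSpace Y] {c : Plane → ℝ}
    (hc : IsWeight c) {f g : Y → L2} (hf : Continuous f) (hg : Continuous g) :
    Continuous (fun y => pair c (f y) (g y)) :=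
  hc.continuous_pair.comp (hf.prodMk hg)

end CubicQuintic

namespace CubicQuintic

/-! ### Integration by parts in weighted pairings -/

/-- The weighted pairing of functions. -/
noncomputable def wint (c f g : Plane → ℝ) : ℝ := ∫ x, c x * (f x * g x)

theorem wint_comm (c f g : Plane → ℝ) : wint c f g = wint c g f := by
  simp only [wint, mul_comm]

theorem IsTest.integrable_wint {c f g : Plane → ℝ} (hc : IsTest c) (hf : Continuous f)
    (hg : Continuous g) : Integrable (fun x => c x * (f x * g x)) :=
  (hc.continuous.mul (hf.mul hg)).integrable_of_hasCompactSupport hc.2.mul_right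

theorem wint_add_left {c f f' g : Plane → ℝ} (hc : IsTest c) (hf : Continuous f)
    (hf' : Continuous f') (hg : Continuous g) :
    wint c (fun x => f x + f' x) g = wint c f g + wint c f' g := by
  rw [wint, wint, wint, ← integral_add (hc.integrable_wint hf hg) (hc.integrable_wint hf' hg)]
  congr 1; ext x; ring

theorem wint_sub_left {c f f' g : Plane → ℝ} (hc : IsTest c) (hf : Continuous f)
    (hf' : Continuous f') (hg : Continuous g) :
    wint c (fun x => f x - f' x) g = wint c f g - wint c f' g := by
  rw [wint, wint, wint, ← integral_sub (hc.integrable_wint hf hg) (hc.integrable_wint hf' hg)]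
  congr 1; ext x; ring

theorem wint_add_weight {c c' f g : Plane → ℝ} (hc : IsTest c) (hc' : IsTest c')
    (hf : Continuous f) (hg : Continuous g) :
    wint (fun x => c x + c' x) f g = wint c f g + wint c' f g := by
  rw [wint, wint, wint, ← integral_add (hc.integrable_wint hf hg) (hc'.integrable_wint hf hg)]
  congr 1; ext x; ring

/-- The three terms add up to the integral of `∂ⱼ(c f g)`. -/
theorem wint_ibp {c f g : Plane → ℝ} (hc : IsTest c) (hf : ContDiff ℝ ∞ f)
    (hg : ContDiff ℝ ∞ g) (j : Fin 2) :
    wint (pderiv j c) f g + wint c (pderiv j f) g + wint c f (pderiv j g) = 0 := by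
  have h := integral_pderiv_mul hc (hf.mul hg) j
  have e : ∀ x, c x * pderiv j (fun y => f y * g y) x =
      c x * (pderiv j f x * g x) + c x * (f x * pderiv j g x) := fun x => by
    rw [pderiv_mul (differentiableAt_of_smooth hf x) (differentiableAt_of_smooth hg x)]; ring
  change ∫ x, pderiv j c x * (f x * g x) = -∫ x, c x * pderiv j (fun y => f y * g y) x at h
  simp_rw [e] at h
  rw [integral_add (hc.integrable_wint (contDiff_pderiv hf j).continuous hg.continuous)
    (hc.integrable_wint hf.continuous (contDiff_pderiv hg j).continuous)] at h
  simp only [wint]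
  linarith

/-- The divergence of a vector field. -/
noncomputable def dvg (X : Fin 2 → Plane → ℝ) (x : Plane) : ℝ :=
  pderiv 0 (X 0) x + pderiv 1 (X 1) x

theorem isTest_dvg {X : Fin 2 → Plane → ℝ} (hX : ∀ k, IsTest (X k)) : IsTest (dvg X) :=
  ((hX 0).pderiv 0).add ((hX 1).pderiv 1)

/-- The Laplacian. -/
noncomputable def lap (a : Plane → ℝ) (x : Plane) : ℝ :=
  pderiv 0 (pderiv 0 a) x + pderiv 1 (pderiv 1 a) x

theorem contDiff_lap {a : Plane → ℝ} (ha : ContDiff ℝ ∞ a) : ContDiff ℝ ∞ (lap a) :=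
  (contDiff_pderiv (contDiff_pderiv ha 0) 0).add (contDiff_pderiv (contDiff_pderiv ha 1) 1)

theorem wint_lap_left {c a g : Plane → ℝ} (hc : IsTest c) (ha : ContDiff ℝ ∞ a)
    (hg : Continuous g) :
    wint c (lap a) g = wint c (pderiv 0 (pderiv 0 a)) g + wint c (pderiv 1 (pderiv 1 a)) g :=
  wint_add_left hc (contDiff_pderiv (contDiff_pderiv ha 0) 0).continuous
    (contDiff_pderiv (contDiff_pderiv ha 1) 1).continuous hg

/-- The Pohozaev identity for a smooth function and a compactly supported vector field. -/
theorem pohozaev {X : Fin 2 → Plane → ℝ} (hX : ∀ k, IsTest (X k)) {a : Plane → ℝ}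
    (ha : ContDiff ℝ ∞ a) :
    -(2 * (wint (X 0) (lap a) (pderiv 0 a) + wint (X 1) (lap a) (pderiv 1 a)) +
        wint (dvg X) (lap a) a) =
      2 * (wint (pderiv 0 (X 0)) (pderiv 0 a) (pderiv 0 a) +
        wint (pderiv 0 (X 1)) (pderiv 0 a) (pderiv 1 a) +
        wint (pderiv 1 (X 0)) (pderiv 1 a) (pderiv 0 a) +
        wint (pderiv 1 (X 1)) (pderiv 1 a) (pderiv 1 a)) +
      (wint (pderiv 0 (dvg X)) a (pderiv 0 a) + wint (pderiv 1 (dvg X)) a (pderiv 1 a)) := by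
  have hd := isTest_dvg hX
  have s : ∀ j, ContDiff ℝ ∞ (pderiv j a) := contDiff_pderiv ha
  have ss : ∀ j k, ContDiff ℝ ∞ (pderiv j (pderiv k a)) := fun j k => contDiff_pderiv (s k) j
  -- With mixed derivatives identified, the terms containing second derivatives are common to the
  -- integrations by parts below, and the claim becomes a linear combination of them with every
  -- `wint` as an unknown.
  have hsym : pderiv 1 (pderiv 0 a) = pderiv 0 (pderiv 1 a) := funext fun x => pderiv_comm ha 1 0 x
  rw [wint_lap_left (hX 0) ha (s 0).continuous, wint_lap_left (hX 1) ha (s 1).continuous,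
    wint_lap_left hd ha ha.continuous]
  have i000 := wint_ibp (hX 0) (s 0) (s 0) 0
  have i001 := wint_ibp (hX 1) (s 0) (s 1) 0
  have i110 := wint_ibp (hX 0) (s 1) (s 0) 1
  have i111 := wint_ibp (hX 1) (s 1) (s 1) 1
  have k010 := wint_ibp (hX 0) (s 1) (s 1) 0
  have k101 := wint_ibp (hX 1) (s 0) (s 0) 1
  have d0 := wint_ibp hd (s 0) ha 0
  have d1 := wint_ibp hd (s 1) ha 1
  have e0 : wint (dvg X) (pderiv 0 a) (pderiv 0 a) = _ :=
    wint_add_weight ((hX 0).pderiv 0) ((hX 1).pderiv 1) (s 0).continuous (s 0).continuous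
  have e1 : wint (dvg X) (pderiv 1 a) (pderiv 1 a) = _ :=
    wint_add_weight ((hX 0).pderiv 0) ((hX 1).pderiv 1) (s 1).continuous (s 1).continuous
  rw [hsym] at i110 k101
  rw [wint_comm (X 0) (pderiv 0 a) (pderiv 0 (pderiv 0 a))] at i000
  rw [wint_comm (X 1) (pderiv 1 a) (pderiv 1 (pderiv 1 a))] at i111
  rw [wint_comm (X 0) (pderiv 1 a) (pderiv 0 (pderiv 1 a))] at i110 k010
  rw [wint_comm (X 1) (pderiv 0 a) (pderiv 0 (pderiv 1 a))] at i001 k101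
  rw [wint_comm _ a (pderiv 0 a), wint_comm _ a (pderiv 1 a)]
  linarith

/-- The derivative of the localized momentum, after spatial integrations by parts. -/
theorem momentum_identity {X : Fin 2 → Plane → ℝ} (hX : ∀ k, IsTest (X k)) {a b p q : Plane → ℝ}
    (ha : ContDiff ℝ ∞ a) (hb : ContDiff ℝ ∞ b) (hp : ContDiff ℝ ∞ p) (hq : ContDiff ℝ ∞ q)
    {at' bt : Plane → ℝ} (hat : at' = fun x => q x - lap b x) (hbt : bt = fun x => lap a x - p x) :
    ∑ k, (wint (X k) at' (pderiv k b) + wint (X k) a (pderiv k bt) -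
      (wint (X k) bt (pderiv k a) + wint (X k) b (pderiv k at'))) =
    (2 * (wint (pderiv 0 (X 0)) (pderiv 0 a) (pderiv 0 a) +
        wint (pderiv 0 (X 1)) (pderiv 0 a) (pderiv 1 a) +
        wint (pderiv 1 (X 0)) (pderiv 1 a) (pderiv 0 a) +
        wint (pderiv 1 (X 1)) (pderiv 1 a) (pderiv 1 a)) +
      (wint (pderiv 0 (dvg X)) a (pderiv 0 a) + wint (pderiv 1 (dvg X)) a (pderiv 1 a))) +
    (2 * (wint (pderiv 0 (X 0)) (pderiv 0 b) (pderiv 0 b) +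
        wint (pderiv 0 (X 1)) (pderiv 0 b) (pderiv 1 b) +
        wint (pderiv 1 (X 0)) (pderiv 1 b) (pderiv 0 b) +
        wint (pderiv 1 (X 1)) (pderiv 1 b) (pderiv 1 b)) +
      (wint (pderiv 0 (dvg X)) b (pderiv 0 b) + wint (pderiv 1 (dvg X)) b (pderiv 1 b))) +
    ((2 * (wint (X 0) p (pderiv 0 a) + wint (X 1) p (pderiv 1 a)) + wint (dvg X) p a) +
     (2 * (wint (X 0) q (pderiv 0 b) + wint (X 1) q (pderiv 1 b)) + wint (dvg X) q b)) := by
  have hd := isTest_dvg hX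
  have sa : ∀ j, ContDiff ℝ ∞ (pderiv j a) := contDiff_pderiv ha
  have sb : ∀ j, ContDiff ℝ ∞ (pderiv j b) := contDiff_pderiv hb
  have hla := contDiff_lap ha
  have hlb := contDiff_lap hb
  have hats : ContDiff ℝ ∞ at' := hat ▸ hq.sub hlb
  have hbts : ContDiff ℝ ∞ bt := hbt ▸ hla.sub hp
  rw [← pohozaev hX ha, ← pohozaev hX hb]
  -- Here `at'` and `bt` are the time derivatives of `a` and `b`. Moving the gradient off them
  -- doubles the terms `X·∇` and creates the terms with `div X`; substituting the equation then
  -- leaves two Pohozaev expressions and the forcing.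
  have i0 := wint_ibp (hX 0) ha hbts 0
  have i1 := wint_ibp (hX 1) ha hbts 1
  have j0 := wint_ibp (hX 0) hb hats 0
  have j1 := wint_ibp (hX 1) hb hats 1
  have e0 : wint (dvg X) bt a = _ :=
    wint_add_weight ((hX 0).pderiv 0) ((hX 1).pderiv 1) hbts.continuous ha.continuous
  have e1 : wint (dvg X) at' b = _ :=
    wint_add_weight ((hX 0).pderiv 0) ((hX 1).pderiv 1) hats.continuous hb.continuous
  have ea : ∀ c g, IsTest c → Continuous g → wint c at' g = wint c q g - wint c (lap b) g :=
    fun c g hc hg => hat ▸ wint_sub_left hc hq.continuous hlb.continuous hg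
  have eb : ∀ c g, IsTest c → Continuous g → wint c bt g = wint c (lap a) g - wint c p g :=
    fun c g hc hg => hbt ▸ wint_sub_left hc hla.continuous hp.continuous hg
  rw [Fin.sum_univ_two]
  rw [wint_comm _ a bt, wint_comm _ (pderiv 0 a) bt] at i0
  rw [wint_comm _ a bt, wint_comm _ (pderiv 1 a) bt] at i1
  rw [wint_comm _ b at', wint_comm _ (pderiv 0 b) at'] at j0
  rw [wint_comm _ b at', wint_comm _ (pderiv 1 b) at'] at j1
  have a0 := ea _ _ (hX 0) (sb 0).continuous
  have a1 := ea _ _ (hX 1) (sb 1).continuous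
  have a2 := ea _ _ hd hb.continuous
  have b0 := eb _ _ (hX 0) (sa 0).continuous
  have b1 := eb _ _ (hX 1) (sa 1).continuous
  have b2 := eb _ _ hd ha.continuous
  linarith

/-- The derivative of the localized mass, after spatial integrations by parts. -/
theorem mass_identity {ζ : Plane → ℝ} (hζ : IsTest ζ) {a b p q : Plane → ℝ}
    (ha : ContDiff ℝ ∞ a) (hb : ContDiff ℝ ∞ b) (hp : ContDiff ℝ ∞ p) (hq : ContDiff ℝ ∞ q)
    {at' bt : Plane → ℝ} (hat : at' = fun x => q x - lap b x) (hbt : bt = fun x => lap a x - p x) :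
    (wint ζ at' a + wint ζ a at') + (wint ζ bt b + wint ζ b bt) =
      2 * (wint (pderiv 0 ζ) a (pderiv 0 b) + wint (pderiv 1 ζ) a (pderiv 1 b) -
        (wint (pderiv 0 ζ) b (pderiv 0 a) + wint (pderiv 1 ζ) b (pderiv 1 a))) +
      2 * (wint ζ q a - wint ζ p b) := by
  have sa : ∀ j, ContDiff ℝ ∞ (pderiv j a) := contDiff_pderiv ha
  have sb : ∀ j, ContDiff ℝ ∞ (pderiv j b) := contDiff_pderiv hb
  have h1 : wint ζ at' a = wint ζ q a - wint ζ (lap b) a :=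
    hat ▸ wint_sub_left hζ hq.continuous (contDiff_lap hb).continuous ha.continuous
  have h2 : wint ζ bt b = wint ζ (lap a) b - wint ζ p b :=
    hbt ▸ wint_sub_left hζ (contDiff_lap ha).continuous hp.continuous hb.continuous
  rw [wint_comm ζ a at', wint_comm ζ b bt, h1, h2, wint_lap_left hζ hb ha.continuous,
    wint_lap_left hζ ha hb.continuous]
  have i0 := wint_ibp hζ ha (sb 0) 0
  have i1 := wint_ibp hζ ha (sb 1) 1
  have j0 := wint_ibp hζ hb (sa 0) 0
  have j1 := wint_ibp hζ hb (sa 1) 1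
  rw [wint_comm ζ a] at i0 i1
  rw [wint_comm ζ b, wint_comm ζ (pderiv 0 b)] at j0
  rw [wint_comm ζ b, wint_comm ζ (pderiv 1 b)] at j1
  linarith

/-- The contribution of the nonlinearity to the virial identity, for smooth functions. -/
theorem nonlinear_identity {X : Fin 2 → Plane → ℝ} (hX : ∀ k, IsTest (X k)) {a b : Plane → ℝ}
    (ha : ContDiff ℝ ∞ a) (hb : ContDiff ℝ ∞ b) {s f : Plane → ℝ}
    (hs : s = fun x => a x * a x + b x * b x) (hf : f = fun x => -1 * s x + s x * s x) :
    (2 * (wint (X 0) (fun x => f x * a x) (pderiv 0 a) +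
        wint (X 1) (fun x => f x * a x) (pderiv 1 a)) + wint (dvg X) (fun x => f x * a x) a) +
     (2 * (wint (X 0) (fun x => f x * b x) (pderiv 0 b) +
        wint (X 1) (fun x => f x * b x) (pderiv 1 b)) + wint (dvg X) (fun x => f x * b x) b) =
    -(1 / 2) * wint (dvg X) s s + 2 / 3 * wint (dvg X) (fun x => s x * s x) s := by
  have hd := isTest_dvg hX
  have hss : ContDiff ℝ ∞ s := hs ▸ (ha.mul ha).add (hb.mul hb)
  have hs2 : ContDiff ℝ ∞ (fun x => s x * s x) := hss.mul hss
  have hfs : ContDiff ℝ ∞ f := hf ▸ (contDiff_const.mul hss).add hs2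
  have hfa : Continuous (fun x => f x * a x) := hfs.continuous.mul ha.continuous
  have hfb : Continuous (fun x => f x * b x) := hfs.continuous.mul hb.continuous
  have da := differentiableAt_of_smooth ha
  have db := differentiableAt_of_smooth hb
  have ds : ∀ k x, pderiv k s x = 2 * (a x * pderiv k a x + b x * pderiv k b x) := by
    intro k x
    rw [hs, pderiv_add ((da x).fun_mul (da x)) ((db x).fun_mul (db x)), pderiv_mul (da x) (da x),
      pderiv_mul (db x) (db x)]
    ring
  -- Since `2(a ∂ₖa + b ∂ₖb) = ∂ₖs`, the left side is the integral of `Xₖ(s² - s) ∂ₖs = Xₖ ∂ₖ(s³/3 -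
  -- s²/2)`.
  have key : ∀ k, 2 * wint (X k) (fun x => f x * a x) (pderiv k a) +
      2 * wint (X k) (fun x => f x * b x) (pderiv k b) =
      1 / 2 * wint (pderiv k (X k)) s s -
        1 / 3 * wint (pderiv k (X k)) (fun x => s x * s x) s := by
    intro k
    have dsc := (contDiff_pderiv hss k).continuous
    have i1 := wint_ibp (hX k) hss hss k
    have i2 := wint_ibp (hX k) hs2 hss k
    have e1 : pderiv k (fun x => s x * s x) = fun x => s x * pderiv k s x + s x * pderiv k s x := by
      ext x
      rw [pderiv_mul (differentiableAt_of_smooth hss x) (differentiableAt_of_smooth hss x)]; ring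
    have hsp : Continuous (fun x => s x * pderiv k s x) := hss.continuous.mul dsc
    rw [e1, wint_add_left (hX k) hsp hsp hss.continuous] at i2
    have e2 : wint (X k) (fun x => s x * pderiv k s x) s =
        wint (X k) (fun x => s x * s x) (pderiv k s) := by
      simp only [wint]; congr 1; ext x; ring
    rw [e2] at i2
    rw [wint_comm (X k) (pderiv k s) s] at i1
    have e3 : 2 * wint (X k) (fun x => f x * a x) (pderiv k a) +
        2 * wint (X k) (fun x => f x * b x) (pderiv k b) =
        wint (X k) (fun x => s x * s x) (pderiv k s) - wint (X k) s (pderiv k s) := by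
      rw [← wint_sub_left (hX k) hs2.continuous hss.continuous dsc]
      simp only [wint]
      rw [← integral_const_mul, ← integral_const_mul, ← integral_add
        (((hX k).integrable_wint hfa
          (contDiff_pderiv ha k).continuous).const_mul 2)
        (((hX k).integrable_wint hfb
          (contDiff_pderiv hb k).continuous).const_mul 2)]
      congr 1; ext x
      rw [ds, hf]; ring
    linarith
  -- This contributes `div X (s³ - s²)`; added to `div X (½s² - ⅓s³)` from the previous step it
  -- leaves `-½s² + ⅔s³`.
  have e4 : wint (dvg X) (fun x => f x * a x) a + wint (dvg X) (fun x => f x * b x) b =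
      wint (dvg X) (fun x => s x * s x) s - wint (dvg X) s s := by
    rw [← wint_sub_left hd hs2.continuous hss.continuous hss.continuous]
    simp only [wint]
    rw [← integral_add (hd.integrable_wint hfa ha.continuous)
      (hd.integrable_wint hfb hb.continuous)]
    congr 1; ext x
    rw [hf, hs]; ring
  have w1 : wint (dvg X) s s = _ :=
    wint_add_weight ((hX 0).pderiv 0) ((hX 1).pderiv 1) hss.continuous hss.continuous
  have w2 : wint (dvg X) (fun x => s x * s x) s = _ :=
    wint_add_weight ((hX 0).pderiv 0) ((hX 1).pderiv 1) hs2.continuous hss.continuous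
  have k0 := key 0
  have k1 := key 1
  linarith

end CubicQuintic

namespace CubicQuintic

/-! ### The equation as a real system -/

/-- The real and imaginary parts of a solution, as curves in the real Sobolev space. -/
structure RealSol (A B : ℝ → W) : Prop where
  contA : Continuous A
  contB : Continuous B
  eqA : ∀ η : Plane → ℝ, IsTest η → ∀ t : ℝ, 0 ≤ t →
    (∫ x, η x * W.val (A t) x) - ∫ x, η x * W.val (A 0) x =
      ∫ s in (0 : ℝ)..t, ((∑ j, ∫ x, pderiv j η x * W.der j (B s) x) +
        ∫ x, η x * nim (A s, B s) x)
  eqB : ∀ η : Plane → ℝ, IsTest η → ∀ t : ℝ, 0 ≤ t →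
    (∫ x, η x * W.val (B t) x) - ∫ x, η x * W.val (B 0) x =
      -∫ s in (0 : ℝ)..t, ((∑ j, ∫ x, pderiv j η x * W.der j (A s) x) +
        ∫ x, η x * nre (A s, B s) x)

theorem exists_abs_cv_le {k : Plane → ℝ} (hk : IsTest k) :
    ∃ C, 0 ≤ C ∧ ∀ (f : L2) y, |cv k f y| ≤ C * ‖f‖ := by
  refine ⟨‖hk.memLp.toLp k‖, norm_nonneg _, fun f y => ?_⟩
  have hy := hk.comp_const_sub y
  have e : ‖hy.memLp.toLp _‖ = ‖hk.memLp.toLp k‖ := by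
    refine (pow_left_inj₀ (norm_nonneg _) (norm_nonneg _) two_ne_zero).1 ?_
    rw [norm_toLp_sq, norm_toLp_sq]
    exact integral_sub_left_eq_self (fun z => k z ^ 2) volume y
  have := abs_real_inner_le_norm (hy.memLp.toLp _) f
  rwa [inner_toLp, e] at this

theorem continuous_integral_test_mul {η : Plane → ℝ} (hη : IsTest η) {F : ℝ → L2}
    (hF : Continuous F) : Continuous (fun t => ∫ x, η x * F t x) := by
  simp_rw [← inner_toLp hη.memLp]
  exact continuous_const.inner hF

theorem continuous_cv {k : Plane → ℝ} (hk : IsTest k) (f : L2) : Continuous (cv k f) :=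
  (contDiff_cv hk (L2.locallyIntegrable f)).continuous

theorem integral_pderiv_const_sub {k : Plane → ℝ} (hk : IsTest k) (f : Plane → ℝ) (y : Plane)
    (j : Fin 2) : ∫ x, pderiv j (fun z => k (y - z)) x * f x = - cv (pderiv j k) f y := by
  simp_rw [pderiv_const_sub k y _ j (differentiableAt_of_smooth hk.1 _), neg_mul]
  rw [integral_neg]
  rfl

/-- A family of continuous functions depending differentiably on time, locally uniformly. -/
structure TimeDiff (P dP : ℝ → Plane → ℝ) (t₀ : ℝ) : Prop where
  cont : ∀ t, Continuous (P t)
  contd : ∀ t, Continuous (dP t)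
  deriv : ∀ᶠ t in 𝓝 t₀, ∀ y, HasDerivAt (fun s => P s y) (dP t y) t
  bdd : ∃ C, 0 ≤ C ∧ ∀ᶠ t in 𝓝 t₀, ∀ y, |P t y| ≤ C
  bddd : ∃ C, 0 ≤ C ∧ ∀ᶠ t in 𝓝 t₀, ∀ y, |dP t y| ≤ C

/-- Differentiation under the integral sign, dominated by a multiple of the compactly supported
weight. -/
theorem TimeDiff.hasDerivAt_wint {P dP Q dQ : ℝ → Plane → ℝ} {t₀ : ℝ} (hP : TimeDiff P dP t₀)
    (hQ : TimeDiff Q dQ t₀) {c : Plane → ℝ} (hc : IsTest c) :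
    HasDerivAt (fun t => wint c (P t) (Q t)) (wint c (dP t₀) (Q t₀) + wint c (P t₀) (dQ t₀)) t₀ := by
  obtain ⟨C₁, h₁, b₁⟩ := hP.bdd
  obtain ⟨C₂, h₂, b₂⟩ := hP.bddd
  obtain ⟨C₃, h₃, b₃⟩ := hQ.bdd
  obtain ⟨C₄, h₄, b₄⟩ := hQ.bddd
  have hs := b₁.and (b₂.and (b₃.and (b₄.and (hP.deriv.and hQ.deriv))))
  have key := hasDerivAt_integral_of_dominated_loc_of_deriv_le
    (μ := (volume : Measure Plane)) (F := fun t y => c y * (P t y * Q t y))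
    (F' := fun t y => c y * (dP t y * Q t y + P t y * dQ t y)) (x₀ := t₀)
    (bound := fun y => |c y| * (C₂ * C₃ + C₁ * C₄)) hs
    (Eventually.of_forall fun t =>
      (hc.integrable_wint (hP.cont t) (hQ.cont t)).aestronglyMeasurable)
    (hc.integrable_wint (hP.cont t₀) (hQ.cont t₀))
    (hc.continuous.mul (((hP.contd t₀).mul (hQ.cont t₀)).add
      ((hP.cont t₀).mul (hQ.contd t₀)))).aestronglyMeasurable
    (ae_of_all _ fun y t ht => by
      obtain ⟨g1, g2, g3, g4, -⟩ := ht
      rw [Real.norm_eq_abs, abs_mul]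
      refine mul_le_mul_of_nonneg_left ((abs_add_le _ _).trans ?_) (abs_nonneg _)
      rw [abs_mul, abs_mul]
      exact add_le_add (mul_le_mul (g2 y) (g3 y) (abs_nonneg _) h₂)
        (mul_le_mul (g1 y) (g4 y) (abs_nonneg _) h₁))
    (hc.integrable.abs.mul_const _)
    (ae_of_all _ fun y t ht => by
      obtain ⟨-, -, -, -, g5, g6⟩ := ht
      exact ((g5 y).mul (g6 y)).const_mul (c y))
  refine key.2.congr_deriv ?_
  rw [wint, wint, ← integral_add (hc.integrable_wint (hP.contd t₀) (hQ.cont t₀))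
    (hc.integrable_wint (hP.cont t₀) (hQ.contd t₀))]
  congr 1; ext y; ring

theorem exists_bound_cv_comp {k : Plane → ℝ} (hk : IsTest k) {F : ℝ → L2} (hF : Continuous F)
    (t₀ : ℝ) : ∃ C, 0 ≤ C ∧ ∀ᶠ t in 𝓝 t₀, ∀ y, |cv k (F t) y| ≤ C := by
  obtain ⟨C, hC, h⟩ := exists_abs_cv_le hk
  refine ⟨C * (‖F t₀‖ + 1), by positivity, ?_⟩
  have : ∀ᶠ t in 𝓝 t₀, ‖F t‖ ≤ ‖F t₀‖ + 1 :=
    (hF.norm.tendsto t₀).eventually (eventually_le_nhds (by linarith))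
  filter_upwards [this] with t ht y
  exact (h _ _).trans (mul_le_mul_of_nonneg_left ht hC)

/-- The right-hand side of the equation, mollified. -/
noncomputable def rhs (k : Plane → ℝ) (D : Fin 2 → L2) (n : L2) (y : Plane) : ℝ :=
  cv k n y - (cv (pderiv 0 k) (D 0) y + cv (pderiv 1 k) (D 1) y)

theorem continuous_rhs {k : Plane → ℝ} (hk : IsTest k) (D : Fin 2 → L2) (n : L2) :
    Continuous (rhs k D n) :=
  (continuous_cv hk _).sub ((continuous_cv (hk.pderiv 0) _).add (continuous_cv (hk.pderiv 1) _))

theorem exists_bound_rhs {k : Plane → ℝ} (hk : IsTest k) {D : ℝ → Fin 2 → L2} {n : ℝ → L2}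
    (hD : ∀ j, Continuous (fun t => D t j)) (hn : Continuous n) (t₀ : ℝ) :
    ∃ C, 0 ≤ C ∧ ∀ᶠ t in 𝓝 t₀, ∀ y, |rhs k (D t) (n t) y| ≤ C := by
  obtain ⟨C₁, h₁, b₁⟩ := exists_bound_cv_comp hk hn t₀
  obtain ⟨C₂, h₂, b₂⟩ := exists_bound_cv_comp (hk.pderiv 0) (hD 0) t₀
  obtain ⟨C₃, h₃, b₃⟩ := exists_bound_cv_comp (hk.pderiv 1) (hD 1) t₀
  refine ⟨C₁ + (C₂ + C₃), by positivity, ?_⟩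
  filter_upwards [b₁, b₂, b₃] with t g1 g2 g3 y
  refine (abs_sub _ _).trans (add_le_add (g1 y) ((abs_add_le _ _).trans (add_le_add (g2 y) (g3 y))))

/-- Testing the equation with `k (y - ·)` expresses the mollified function as the time integral of a
continuous function. Positivity of `t₀` leaves room for a two-sided derivative, the equation being
available only for `t ≥ 0`. -/
theorem timeDiff_of_equation {k : Plane → ℝ} (hk : IsTest k) {F n : ℝ → L2} {D : ℝ → Fin 2 → L2}
    (hF : Continuous F) (hD : ∀ j, Continuous (fun t => D t j)) (hn : Continuous n)
    (h : ∀ η : Plane → ℝ, IsTest η → ∀ t : ℝ, 0 ≤ t →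
      (∫ x, η x * F t x) - ∫ x, η x * F 0 x =
      ∫ s in (0 : ℝ)..t, ((∑ j, ∫ x, pderiv j η x * D s j x) + ∫ x, η x * n s x))
    {t₀ : ℝ} (ht₀ : 0 < t₀) :
    TimeDiff (fun t => cv k (F t)) (fun t => rhs k (D t) (n t)) t₀ where
  cont t := continuous_cv hk _
  contd t := continuous_rhs hk _ _
  bdd := exists_bound_cv_comp hk hF t₀
  bddd := exists_bound_rhs hk hD hn t₀
  deriv := by
    filter_upwards [lt_mem_nhds ht₀] with t ht y
    have hη := hk.comp_const_sub y
    set g : ℝ → ℝ := fun s => (∑ j, ∫ x, pderiv j (fun z => k (y - z)) x * D s j x) +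
      ∫ x, k (y - x) * n s x with hg
    have hgc : Continuous g :=
      (continuous_finsetSum _ fun j _ => continuous_integral_test_mul (hη.pderiv j) (hD j)).add
        (continuous_integral_test_mul hη hn)
    have hgt : ∀ s, g s = rhs k (D s) (n s) y := by
      intro s
      simp only [hg, Fin.sum_univ_two, integral_pderiv_const_sub hk]
      rw [rhs, cv, cv, cv]; ring
    have h1 : HasDerivAt (fun s => cv k (F 0) y + ∫ r in (0 : ℝ)..s, g r) (g t) t :=
      (hgc.integral_hasStrictDerivAt 0 t).hasDerivAt.const_add _
    rw [hgt] at h1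
    refine h1.congr_of_eventuallyEq ?_
    filter_upwards [lt_mem_nhds ht] with s hs
    have := h _ hη s hs.le
    simp only [cv]
    linarith

theorem RealSol.continuous_pair {A B : ℝ → W} (h : RealSol A B) :
    Continuous (fun t => (A t, B t)) := h.contA.prodMk h.contB

theorem continuous_nre : Continuous nre := good_nonlin_re.continuous_toL2

theorem continuous_nim : Continuous nim := good_nonlin_im.continuous_toL2

theorem RealSol.timeDiffA {A B : ℝ → W} (h : RealSol A B) {k : Plane → ℝ} (hk : IsTest k)
    {t₀ : ℝ} (ht₀ : 0 < t₀) :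
    TimeDiff (fun t => cv k (W.val (A t)))
      (fun t => rhs k (fun j => W.der j (B t)) (nim (A t, B t))) t₀ :=
  timeDiff_of_equation hk (W.val.continuous.comp h.contA)
    (fun j => (W.der j).continuous.comp h.contB) (continuous_nim.comp h.continuous_pair) h.eqA ht₀

theorem RealSol.timeDiffB {A B : ℝ → W} (h : RealSol A B) {k : Plane → ℝ} (hk : IsTest k)
    {t₀ : ℝ} (ht₀ : 0 < t₀) :
    TimeDiff (fun t => cv k (W.val (B t)))
      (fun t => rhs k (fun j => -W.der j (A t)) (-nre (A t, B t))) t₀ := by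
  refine timeDiff_of_equation (F := fun t => W.val (B t)) (n := fun t => -nre (A t, B t))
    (D := fun t j => -W.der j (A t)) hk (W.val.continuous.comp h.contB)
    (fun j => ((W.der j).continuous.comp h.contA).neg)
    (continuous_nre.comp h.continuous_pair).neg ?_ ht₀
  intro η hη t ht
  rw [h.eqB η hη t ht, ← intervalIntegral.integral_neg]
  refine intervalIntegral.integral_congr fun s _ => ?_
  have hneg : ∀ (θ : Plane → ℝ) (f : L2), ∫ x, θ x * (-f : L2) x = -∫ x, θ x * f x := by
    intro θ f
    rw [← integral_neg]
    refine integral_congr_ae ((Lp.coeFn_neg f).mono fun x hx => ?_)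
    simp only [hx, Pi.neg_apply, mul_neg]
  simp only [hneg, Fin.sum_univ_two]
  ring

theorem cv_neg (k : Plane → ℝ) (f : L2) : cv k (-f : L2) = fun y => - cv k f y := by
  ext y
  rw [cv_congr (Lp.coeFn_neg f)]
  simp [cv, integral_neg]

theorem rhs_eq {k : Plane → ℝ} (hk : IsTest k) (p : W) (n : L2) :
    rhs k (fun j => W.der j p) n = fun y => cv k n y - lap (cv k (W.val p)) y := by
  ext y
  rw [rhs, lap]
  have : ∀ j, pderiv j (pderiv j (cv k (W.val p))) y = cv (pderiv j k) (W.der j p) y := by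
    intro j
    rw [pderiv_cv_val hk, pderiv_cv hk (L2.locallyIntegrable _)]
  rw [this, this]

theorem rhs_neg_eq {k : Plane → ℝ} (hk : IsTest k) (p : W) (n : L2) :
    rhs k (fun j => -W.der j p) (-n) = fun y => lap (cv k (W.val p)) y - cv k n y := by
  have h := congrFun (rhs_eq hk p n)
  ext y
  have hy := h y
  rw [rhs] at hy ⊢
  simp only [cv_neg]
  linarith

/-- The kernel `∂ᵢk` is also a test function, so the gradient of the mollified solution has a time
derivative by the same argument; this identifies it as the gradient of the mollified right-hand
side. -/
theorem rhs_pderiv {k : Plane → ℝ} (hk : IsTest k) (D : Fin 2 → L2) (n : L2) (i : Fin 2) :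
    rhs (pderiv i k) D n = pderiv i (rhs k D n) := by
  have hsm : ∀ (c : Plane → ℝ) (f : L2), IsTest c → ∀ y, DifferentiableAt ℝ (cv c f) y :=
    fun c f hc y => differentiableAt_of_smooth (contDiff_cv hc (L2.locallyIntegrable f)) y
  ext y
  have e : rhs k D n = fun y => cv k n y -
    (cv (pderiv 0 k) (D 0) y + cv (pderiv 1 k) (D 1) y) := rfl
  rw [e, pderiv_sub (hsm _ _ hk y) ((hsm _ _ (hk.pderiv 0) y).fun_add (hsm _ _ (hk.pderiv 1) y)),
    pderiv_add (hsm _ _ (hk.pderiv 0) y) (hsm _ _ (hk.pderiv 1) y),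
    pderiv_cv hk (L2.locallyIntegrable _), pderiv_cv (hk.pderiv 0) (L2.locallyIntegrable _),
    pderiv_cv (hk.pderiv 1) (L2.locallyIntegrable _), rhs,
    funext (pderiv_comm hk.1 i 0), funext (pderiv_comm hk.1 i 1)]

/-! ### Passing to the limit in the mollified identities -/

theorem pair_eq_wint {c : Plane → ℝ} {f g : L2} {F G : Plane → ℝ} (hf : f =ᵐ[volume] F)
    (hg : g =ᵐ[volume] G) : pair c f g = wint c F G := by
  refine integral_congr_ae ?_
  filter_upwards [hf, hg] with x h1 h2
  rw [h1, h2]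

/-- Bounded pointwise convergence, on `[0, T]`, of a sequence of continuous curves. -/
structure DomConv {E : Type*} [NormedAddCommGroup E] (T : ℝ) (h : ℕ → ℝ → E) (H : ℝ → E) : Prop where
  cont : ∀ n, Continuous (h n)
  lim : ∀ s, Tendsto (fun n => h n s) atTop (𝓝 (H s))
  bdd : ∃ C, 0 ≤ C ∧ ∀ n, ∀ s ∈ Icc 0 T, ‖h n s‖ ≤ C

theorem DomConv.tendsto_integral {T : ℝ} (hT : 0 ≤ T) {h : ℕ → ℝ → ℝ} {H : ℝ → ℝ}
    (hh : DomConv T h H) :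
    Tendsto (fun n => ∫ s in (0 : ℝ)..T, h n s) atTop (𝓝 (∫ s in (0 : ℝ)..T, H s)) := by
  obtain ⟨C, hC, hb⟩ := hh.bdd
  refine intervalIntegral.tendsto_integral_filter_of_dominated_convergence (fun _ => C)
    (Eventually.of_forall fun n => (hh.cont n).aestronglyMeasurable)
    (Eventually.of_forall fun n => ae_of_all _ fun s hs => hb n s ?_)
    intervalIntegrable_const (ae_of_all _ fun s _ => hh.lim s)
  rw [uIoc_of_le hT] at hs
  exact ⟨hs.1.le, hs.2⟩

theorem DomConv.add {T : ℝ} {h k : ℕ → ℝ → ℝ} {H K : ℝ → ℝ} (hh : DomConv T h H)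
    (hk : DomConv T k K) : DomConv T (fun n s => h n s + k n s) (fun s => H s + K s) where
  cont n := (hh.cont n).add (hk.cont n)
  lim s := (hh.lim s).add (hk.lim s)
  bdd := by
    obtain ⟨C, hC, hb⟩ := hh.bdd
    obtain ⟨D, hD, hd⟩ := hk.bdd
    exact ⟨C + D, by positivity, fun n s hs =>
      (norm_add_le _ _).trans (add_le_add (hb n s hs) (hd n s hs))⟩

theorem DomConv.const_mul {T : ℝ} {h : ℕ → ℝ → ℝ} {H : ℝ → ℝ} (hh : DomConv T h H) (c : ℝ) :
    DomConv T (fun n s => c * h n s) (fun s => c * H s) where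
  cont n := (hh.cont n).const_mul c
  lim s := (hh.lim s).const_mul c
  bdd := by
    obtain ⟨C, hC, hb⟩ := hh.bdd
    refine ⟨|c| * C, by positivity, fun n s hs => ?_⟩
    rw [norm_mul, Real.norm_eq_abs]
    exact mul_le_mul_of_nonneg_left (hb n s hs) (abs_nonneg _)

theorem DomConv.sub {T : ℝ} {h k : ℕ → ℝ → ℝ} {H K : ℝ → ℝ} (hh : DomConv T h H)
    (hk : DomConv T k K) : DomConv T (fun n s => h n s - k n s) (fun s => H s - K s) := by
  simpa [sub_eq_add_neg] using hh.add (hk.const_mul (-1))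

theorem DomConv.pair {T : ℝ} {f g : ℕ → ℝ → L2} {F G : ℝ → L2} (hf : DomConv T f F)
    (hg : DomConv T g G) {c : Plane → ℝ} (hc : IsWeight c) :
    DomConv T (fun n s => pair c (f n s) (g n s)) (fun s => pair c (F s) (G s)) where
  cont n := hc.continuous_pair_comp (hf.cont n) (hg.cont n)
  lim s := (hc.continuous_pair.tendsto (F s, G s)).comp ((hf.lim s).prodMk_nhds (hg.lim s))
  bdd := by
    obtain ⟨K, hK⟩ := hc.bounded
    have hK0 : 0 ≤ K := (abs_nonneg _).trans (hK 0)
    obtain ⟨C, hC, hb⟩ := hf.bdd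
    obtain ⟨D, hD, hd⟩ := hg.bdd
    refine ⟨K * (C * D), by positivity, fun n s hs => (hc.abs_pair_le hK _ _).trans ?_⟩
    exact mul_le_mul_of_nonneg_left (mul_le_mul (hb n s hs) (hd n s hs) (norm_nonneg _) hC) hK0

/-- The mollification operators along the approximate identity. -/
noncomputable def mol (n : ℕ) : L2 →L[ℝ] L2 := convL (isKernel_kap n)

theorem domConv_mol (T : ℝ) {F : ℝ → L2} (hF : Continuous F) :
    DomConv T (fun n s => mol n (F s)) F where
  cont n := (mol n).continuous.comp hF
  lim s := tendsto_convL (F s)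
  bdd := by
    obtain ⟨C, hC⟩ := (isCompact_Icc (a := (0 : ℝ)) (b := T)).exists_bound_of_continuousOn
      hF.continuousOn
    refine ⟨max C 0, le_max_right _ _, fun n s hs => ?_⟩
    exact (norm_convL_le _ _).trans ((hC s hs).trans (le_max_left _ _))

theorem mol_ae (n : ℕ) (f : L2) : mol n f =ᵐ[volume] cv (kap n) f := coeFn_convL _ f

end CubicQuintic

namespace CubicQuintic

/-! ### The virial identity -/

/-- The localized momentum `Im ∫ ū X·∇u`. -/
noncomputable def mom (X : Fin 2 → Plane → ℝ) (y : W × W) : ℝ :=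
  ∑ k, (pair (X k) (W.val y.1) (W.der k y.2) - pair (X k) (W.val y.2) (W.der k y.1))

/-- The kinetic part of the virial identity. -/
noncomputable def kin (X : Fin 2 → Plane → ℝ) (a : L2) (D : Fin 2 → L2) : ℝ :=
  2 * (pair (pderiv 0 (X 0)) (D 0) (D 0) + pair (pderiv 0 (X 1)) (D 0) (D 1) +
    pair (pderiv 1 (X 0)) (D 1) (D 0) + pair (pderiv 1 (X 1)) (D 1) (D 1)) +
  (pair (pderiv 0 (dvg X)) a (D 0) + pair (pderiv 1 (dvg X)) a (D 1))

/-- The forcing part of the virial identity. -/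
noncomputable def frc (X : Fin 2 → Plane → ℝ) (p a : L2) (D : Fin 2 → L2) : ℝ :=
  2 * (pair (X 0) p (D 0) + pair (X 1) p (D 1)) + pair (dvg X) p a

theorem DomConv.kin {T : ℝ} {a : ℕ → ℝ → L2} {a' : ℝ → L2} {D : Fin 2 → ℕ → ℝ → L2}
    {D' : Fin 2 → ℝ → L2} (ha : DomConv T a a') (hD : ∀ j, DomConv T (D j) (D' j))
    {X : Fin 2 → Plane → ℝ} (hX : ∀ k, IsTest (X k)) :
    DomConv T (fun n s => kin X (a n s) (fun j => D j n s))
      (fun s => CubicQuintic.kin X (a' s) (fun j => D' j s)) := by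
  have hw : ∀ j k, IsWeight (pderiv j (X k)) := fun j k => ((hX k).pderiv j).isWeight
  have hd : ∀ j, IsWeight (pderiv j (dvg X)) := fun j => ((isTest_dvg hX).pderiv j).isWeight
  exact ((((((hD 0).pair (hD 0) (hw 0 0)).add ((hD 0).pair (hD 1) (hw 0 1))).add
    ((hD 1).pair (hD 0) (hw 1 0))).add ((hD 1).pair (hD 1) (hw 1 1))).const_mul 2).add
    ((ha.pair (hD 0) (hd 0)).add (ha.pair (hD 1) (hd 1)))

theorem DomConv.frc {T : ℝ} {p a : ℕ → ℝ → L2} {p' a' : ℝ → L2} {D : Fin 2 → ℕ → ℝ → L2}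
    {D' : Fin 2 → ℝ → L2} (hp : DomConv T p p') (ha : DomConv T a a')
    (hD : ∀ j, DomConv T (D j) (D' j)) {X : Fin 2 → Plane → ℝ} (hX : ∀ k, IsTest (X k)) :
    DomConv T (fun n s => frc X (p n s) (a n s) (fun j => D j n s))
      (fun s => CubicQuintic.frc X (p' s) (a' s) (fun j => D' j s)) :=
  (((hp.pair (hD 0) (hX 0).isWeight).add (hp.pair (hD 1) (hX 1).isWeight)).const_mul 2).add
    (hp.pair ha (isTest_dvg hX).isWeight)

theorem mol_der_ae (n : ℕ) (p : W) (j : Fin 2) :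
    mol n (W.der j p) =ᵐ[volume] pderiv j (cv (kap n) (W.val p)) := by
  rw [pderiv_cv_val (isKernel_kap n).test]
  exact mol_ae n _

theorem smooth_cv (n : ℕ) (f : L2) : ContDiff ℝ ∞ (cv (kap n) f) :=
  contDiff_cv (isKernel_kap n).test (L2.locallyIntegrable f)

theorem kin_mol (X : Fin 2 → Plane → ℝ) (n : ℕ) (p : W) {a : Plane → ℝ}
    (ha : a = cv (kap n) (W.val p)) :
    kin X (mol n (W.val p)) (fun j => mol n (W.der j p)) =
      2 * (wint (pderiv 0 (X 0)) (pderiv 0 a) (pderiv 0 a) +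
        wint (pderiv 0 (X 1)) (pderiv 0 a) (pderiv 1 a) +
        wint (pderiv 1 (X 0)) (pderiv 1 a) (pderiv 0 a) +
        wint (pderiv 1 (X 1)) (pderiv 1 a) (pderiv 1 a)) +
      (wint (pderiv 0 (dvg X)) a (pderiv 0 a) + wint (pderiv 1 (dvg X)) a (pderiv 1 a)) := by
  subst ha
  simp only [kin, pair_eq_wint (mol_der_ae n p _) (mol_der_ae n p _),
    pair_eq_wint (mol_ae n (W.val p)) (mol_der_ae n p _)]

theorem frc_mol (X : Fin 2 → Plane → ℝ) (n : ℕ) (p : W) (f : L2) {a g : Plane → ℝ}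
    (ha : a = cv (kap n) (W.val p)) (hg : f =ᵐ[volume] g) :
    frc X f (mol n (W.val p)) (fun j => mol n (W.der j p)) =
      2 * (wint (X 0) g (pderiv 0 a) + wint (X 1) g (pderiv 1 a)) + wint (dvg X) g a := by
  subst ha
  simp only [frc, pair_eq_wint hg (mol_der_ae n p _), pair_eq_wint hg (mol_ae n (W.val p))]

/-- The mollified solution satisfies the linear equation with the mollified nonlinearity as forcing,
so the identity for smooth functions applies. Mollification does not commute with the nonlinearity,
hence the forcing stays an independent argument of `frc` until the limit has been taken. -/
theorem RealSol.hasDerivAt_mom_mol {A B : ℝ → W} (h : RealSol A B) {X : Fin 2 → Plane → ℝ}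
    (hX : ∀ k, IsTest (X k)) (n : ℕ) {t : ℝ} (ht : 0 < t) :
    HasDerivAt (fun t => ∑ k, (pair (X k) (mol n (W.val (A t))) (mol n (W.der k (B t))) -
        pair (X k) (mol n (W.val (B t))) (mol n (W.der k (A t)))))
      (kin X (mol n (W.val (A t))) (fun j => mol n (W.der j (A t))) +
        kin X (mol n (W.val (B t))) (fun j => mol n (W.der j (B t))) +
        (frc X (mol n (nre (A t, B t))) (mol n (W.val (A t))) (fun j => mol n (W.der j (A t))) +
         frc X (mol n (nim (A t, B t))) (mol n (W.val (B t))) (fun j => mol n (W.der j (B t))))) t := by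
  have hk := (isKernel_kap n).test
  have hder : ∀ (p : W) (j : Fin 2),
      mol n (W.der j p) =ᵐ[volume] cv (pderiv j (kap n)) (W.val p) := fun p j => by
    rw [cv_pderiv_val hk]; exact mol_ae n _
  have e : (fun t => ∑ k, (pair (X k) (mol n (W.val (A t))) (mol n (W.der k (B t))) -
        pair (X k) (mol n (W.val (B t))) (mol n (W.der k (A t))))) =
      fun t => ∑ k, (wint (X k) (cv (kap n) (W.val (A t))) (cv (pderiv k (kap n)) (W.val (B t))) -
        wint (X k) (cv (kap n) (W.val (B t))) (cv (pderiv k (kap n)) (W.val (A t)))) := by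
    ext t
    simp only [pair_eq_wint (mol_ae n _) (hder _ _)]
  rw [e]
  have hd := HasDerivAt.fun_sum (u := Finset.univ) fun k (_ : k ∈ (Finset.univ : Finset (Fin 2))) =>
    (((h.timeDiffA hk ht).hasDerivAt_wint (h.timeDiffB (hk.pderiv k) ht) (hX k)).sub
      ((h.timeDiffB hk ht).hasDerivAt_wint (h.timeDiffA (hk.pderiv k) ht) (hX k)))
  refine hd.congr_deriv ?_
  have ha := smooth_cv n (W.val (A t))
  have hb := smooth_cv n (W.val (B t))
  have hp := smooth_cv n (nre (A t, B t))
  have hq := smooth_cv n (nim (A t, B t))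
  rw [kin_mol X n (A t) rfl, kin_mol X n (B t) rfl, frc_mol X n (A t) _ rfl (mol_ae n _),
    frc_mol X n (B t) _ rfl (mol_ae n _),
    ← momentum_identity hX ha hb hp hq (rhs_eq hk (B t) _) (rhs_neg_eq hk (A t) _)]
  refine Finset.sum_congr rfl fun k _ => ?_
  rw [rhs_pderiv hk, rhs_pderiv hk, pderiv_cv hk (L2.locallyIntegrable _),
    pderiv_cv hk (L2.locallyIntegrable _)]

theorem RealSol.continuous_valA {A B : ℝ → W} (h : RealSol A B) :
    Continuous (fun t => W.val (A t)) := W.val.continuous.comp h.contA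

theorem RealSol.continuous_valB {A B : ℝ → W} (h : RealSol A B) :
    Continuous (fun t => W.val (B t)) := W.val.continuous.comp h.contB

theorem RealSol.continuous_derA {A B : ℝ → W} (h : RealSol A B) (j : Fin 2) :
    Continuous (fun t => W.der j (A t)) := (W.der j).continuous.comp h.contA

theorem RealSol.continuous_derB {A B : ℝ → W} (h : RealSol A B) (j : Fin 2) :
    Continuous (fun t => W.der j (B t)) := (W.der j).continuous.comp h.contB

theorem RealSol.continuous_nre {A B : ℝ → W} (h : RealSol A B) :
    Continuous (fun t => nre (A t, B t)) := CubicQuintic.continuous_nre.comp h.continuous_pair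

theorem RealSol.continuous_nim {A B : ℝ → W} (h : RealSol A B) :
    Continuous (fun t => nim (A t, B t)) := CubicQuintic.continuous_nim.comp h.continuous_pair

/-- If mollified quantities satisfy the fundamental theorem of calculus, so do their limits. -/
theorem sub_eq_integral_of_domConv {T : ℝ} (hT : 0 ≤ T) {φ h : ℕ → ℝ → ℝ} {Φ H : ℝ → ℝ}
    (hφ : DomConv T φ Φ) (hh : DomConv T h H)
    (hd : ∀ n, ∀ t, 0 < t → HasDerivAt (φ n) (h n t) t) :
    Φ T - Φ 0 = ∫ s in (0 : ℝ)..T, H s := by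
  have e : ∀ n, φ n T - φ n 0 = ∫ s in (0 : ℝ)..T, h n s := fun n =>
    (intervalIntegral.integral_eq_sub_of_hasDerivAt_of_le hT (hφ.cont n).continuousOn
      (fun t ht => hd n t ht.1) ((hh.cont n).intervalIntegrable _ _)).symm
  refine tendsto_nhds_unique ((hφ.lim T).sub (hφ.lim 0)) ?_
  simp_rw [e]
  exact hh.tendsto_integral hT

theorem RealSol.virial_frc {A B : ℝ → W} (h : RealSol A B) {X : Fin 2 → Plane → ℝ}
    (hX : ∀ k, IsTest (X k)) {T : ℝ} (hT : 0 ≤ T) :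
    mom X (A T, B T) - mom X (A 0, B 0) = ∫ t in (0 : ℝ)..T,
      (kin X (W.val (A t)) (fun j => W.der j (A t)) +
        kin X (W.val (B t)) (fun j => W.der j (B t)) +
        (frc X (nre (A t, B t)) (W.val (A t)) (fun j => W.der j (A t)) +
         frc X (nim (A t, B t)) (W.val (B t)) (fun j => W.der j (B t)))) := by
  have dA := domConv_mol T h.continuous_valA
  have dB := domConv_mol T h.continuous_valB
  have dDA := fun j => domConv_mol T (h.continuous_derA j)
  have dDB := fun j => domConv_mol T (h.continuous_derB j)
  have dp := domConv_mol T h.continuous_nre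
  have dq := domConv_mol T h.continuous_nim
  have hφ : DomConv T (fun n t => ∑ k,
      (pair (X k) (mol n (W.val (A t))) (mol n (W.der k (B t))) -
        pair (X k) (mol n (W.val (B t))) (mol n (W.der k (A t)))))
      (fun t => mom X (A t, B t)) := by
    simp only [mom, Fin.sum_univ_two]
    exact ((dA.pair (dDB 0) (hX 0).isWeight).sub (dB.pair (dDA 0) (hX 0).isWeight)).add
      ((dA.pair (dDB 1) (hX 1).isWeight).sub (dB.pair (dDA 1) (hX 1).isWeight))
  exact sub_eq_integral_of_domConv hT hφ (((dA.kin dDA hX).add (dB.kin dDB hX)).add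
    ((dp.frc dA dDA hX).add (dq.frc dB dDB hX))) fun n t ht => h.hasDerivAt_mom_mol hX n ht

theorem continuous_frc {Y : Type*} [TopologicalSpace Y] {X : Fin 2 → Plane → ℝ}
    (hX : ∀ k, IsTest (X k)) {p a : Y → L2} {D : Fin 2 → Y → L2} (hp : Continuous p)
    (ha : Continuous a) (hD : ∀ j, Continuous (D j)) :
    Continuous (fun y => frc X (p y) (a y) (fun j => D j y)) :=
  (((hX 0).isWeight.continuous_pair_comp hp (hD 0)).add
    ((hX 1).isWeight.continuous_pair_comp hp (hD 1))).const_mul 2 |>.add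
    ((isTest_dvg hX).isWeight.continuous_pair_comp hp ha)

theorem continuous_kin {Y : Type*} [TopologicalSpace Y] {X : Fin 2 → Plane → ℝ}
    (hX : ∀ k, IsTest (X k)) {a : Y → L2} {D : Fin 2 → Y → L2}
    (ha : Continuous a) (hD : ∀ j, Continuous (D j)) :
    Continuous (fun y => kin X (a y) (fun j => D j y)) := by
  have hw : ∀ j k, IsWeight (pderiv j (X k)) := fun j k => ((hX k).pderiv j).isWeight
  have hd : ∀ j, IsWeight (pderiv j (dvg X)) := fun j => ((isTest_dvg hX).pderiv j).isWeight
  exact ((((((hw 0 0).continuous_pair_comp (hD 0) (hD 0)).add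
    ((hw 0 1).continuous_pair_comp (hD 0) (hD 1))).add
    ((hw 1 0).continuous_pair_comp (hD 1) (hD 0))).add
    ((hw 1 1).continuous_pair_comp (hD 1) (hD 1))).const_mul 2).add
    (((hd 0).continuous_pair_comp ha (hD 0)).add ((hd 1).continuous_pair_comp ha (hD 1)))

/-- The nonlinear part of the virial identity. -/
noncomputable def nlin (X : Fin 2 → Plane → ℝ) (y : W × W) : ℝ :=
  -(1 / 2) * pair (dvg X) (densL y) (densL y) + 2 / 3 * pair (dvg X) (densSqL y) (densL y)

theorem continuous_densL : Continuous densL := good_dens.continuous_toL2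

theorem continuous_densSqL : Continuous densSqL := good_dens_sq.continuous_toL2

theorem continuous_nlin {X : Fin 2 → Plane → ℝ} (hX : ∀ k, IsTest (X k)) :
    Continuous (nlin X) :=
  (((isTest_dvg hX).isWeight.continuous_pair_comp continuous_densL
    continuous_densL).const_mul _).add
    (((isTest_dvg hX).isWeight.continuous_pair_comp continuous_densSqL
      continuous_densL).const_mul _)

/-- Both sides are continuous on `H¹ × H¹`, and the identity holds for mollified functions by
calculus. This is a statement about single functions, independent of the equation. -/
theorem frc_nonlinear {X : Fin 2 → Plane → ℝ} (hX : ∀ k, IsTest (X k)) (y : W × W) :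
    frc X (nre y) (W.val y.1) (fun j => W.der j y.1) +
      frc X (nim y) (W.val y.2) (fun j => W.der j y.2) = nlin X y := by
  set L : W × W → ℝ := fun y => frc X (nre y) (W.val y.1) (fun j => W.der j y.1) +
      frc X (nim y) (W.val y.2) (fun j => W.der j y.2) with hL
  have hLc : Continuous L :=
    (continuous_frc hX continuous_nre (W.val.continuous.comp continuous_fst)
      fun j => (W.der j).continuous.comp continuous_fst).add
    (continuous_frc hX continuous_nim (W.val.continuous.comp continuous_snd)
      fun j => (W.der j).continuous.comp continuous_snd)
  let ym : ℕ → W × W := fun n => (moll (isKernel_kap n) y.1, moll (isKernel_kap n) y.2)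
  have hym : Tendsto ym atTop (𝓝 y) := (tendsto_moll y.1).prodMk_nhds (tendsto_moll y.2)
  refine tendsto_nhds_unique ((hLc.tendsto y).comp hym) ?_
  refine (((continuous_nlin hX).tendsto y).comp hym).congr fun n => ?_
  set a := cv (kap n) (W.val y.1) with ha
  set b := cv (kap n) (W.val y.2) with hb
  have hav : W.val (ym n).1 =ᵐ[volume] a := mol_ae n _
  have hbv : W.val (ym n).2 =ᵐ[volume] b := mol_ae n _
  set s : Plane → ℝ := fun x => a x * a x + b x * b x with hs
  set f : Plane → ℝ := fun x => -1 * s x + s x * s x with hf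
  have hds : dens (ym n) =ᵐ[volume] s := by
    filter_upwards [hav, hbv] with x h1 h2
    simp only [dens, h1, h2, hs]
  have e1 : densL (ym n) =ᵐ[volume] s := (good_dens.coeFn_toL2 _).trans hds
  have e2 : densSqL (ym n) =ᵐ[volume] fun x => s x * s x := by
    refine (good_dens_sq.coeFn_toL2 _).trans ?_
    filter_upwards [hds] with x h1
    rw [h1]
  have e3 : nre (ym n) =ᵐ[volume] fun x => f x * a x := by
    refine (good_nonlin_re.coeFn_toL2 _).trans ?_
    filter_upwards [hds, hav] with x h1 h2
    rw [h2, fac, h1]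
  have e4 : nim (ym n) =ᵐ[volume] fun x => f x * b x := by
    refine (good_nonlin_im.coeFn_toL2 _).trans ?_
    filter_upwards [hds, hbv] with x h1 h2
    rw [h2, fac, h1]
  have key := nonlinear_identity hX (smooth_cv n (W.val y.1)) (smooth_cv n (W.val y.2)) hs hf
  have f1 := frc_mol X n y.1 (nre (ym n)) ha e3
  have f2 := frc_mol X n y.2 (nim (ym n)) hb e4
  simp only [Function.comp_apply, nlin, pair_eq_wint e1 e1, pair_eq_wint e2 e1, hL]
  rw [← key]
  exact (congrArg₂ (· + ·) f1 f2).symm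

/-- The virial identity for a compactly supported vector field. -/
theorem RealSol.virial {A B : ℝ → W} (h : RealSol A B) {X : Fin 2 → Plane → ℝ}
    (hX : ∀ k, IsTest (X k)) {T : ℝ} (hT : 0 ≤ T) :
    mom X (A T, B T) - mom X (A 0, B 0) = ∫ t in (0 : ℝ)..T,
      (kin X (W.val (A t)) (fun j => W.der j (A t)) +
        kin X (W.val (B t)) (fun j => W.der j (B t)) + nlin X (A t, B t)) := by
  rw [h.virial_frc hX hT]
  refine intervalIntegral.integral_congr fun t _ => ?_
  simp only [← frc_nonlinear hX (A t, B t)]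

/-! ### Conservation of mass -/

theorem RealSol.hasDerivAt_mass_mol {A B : ℝ → W} (h : RealSol A B) {ζ : Plane → ℝ}
    (hζ : IsTest ζ) (n : ℕ) {t : ℝ} (ht : 0 < t) :
    HasDerivAt (fun t => pair ζ (mol n (W.val (A t))) (mol n (W.val (A t))) +
        pair ζ (mol n (W.val (B t))) (mol n (W.val (B t))))
      (2 * (pair (pderiv 0 ζ) (mol n (W.val (A t))) (mol n (W.der 0 (B t))) +
          pair (pderiv 1 ζ) (mol n (W.val (A t))) (mol n (W.der 1 (B t))) -
        (pair (pderiv 0 ζ) (mol n (W.val (B t))) (mol n (W.der 0 (A t))) +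
          pair (pderiv 1 ζ) (mol n (W.val (B t))) (mol n (W.der 1 (A t))))) +
        2 * (pair ζ (mol n (nim (A t, B t))) (mol n (W.val (A t))) -
          pair ζ (mol n (nre (A t, B t))) (mol n (W.val (B t))))) t := by
  have hk := (isKernel_kap n).test
  simp only [pair_eq_wint (mol_ae n _) (mol_ae n _), ← pderiv_cv_val hk]
  rw [← mass_identity hζ (smooth_cv n _) (smooth_cv n _) (smooth_cv n _) (smooth_cv n _)
    (rhs_eq hk (B t) _) (rhs_neg_eq hk (A t) _)]
  exact ((h.timeDiffA hk ht).hasDerivAt_wint (h.timeDiffA hk ht) hζ).add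
    ((h.timeDiffB hk ht).hasDerivAt_wint (h.timeDiffB hk ht) hζ)

theorem RealSol.mass_flux {A B : ℝ → W} (h : RealSol A B) {ζ : Plane → ℝ} (hζ : IsTest ζ)
    {T : ℝ} (hT : 0 ≤ T) :
    (pair ζ (W.val (A T)) (W.val (A T)) + pair ζ (W.val (B T)) (W.val (B T))) -
      (pair ζ (W.val (A 0)) (W.val (A 0)) + pair ζ (W.val (B 0)) (W.val (B 0))) =
    ∫ t in (0 : ℝ)..T, 2 * (pair (pderiv 0 ζ) (W.val (A t)) (W.der 0 (B t)) +
          pair (pderiv 1 ζ) (W.val (A t)) (W.der 1 (B t)) -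
        (pair (pderiv 0 ζ) (W.val (B t)) (W.der 0 (A t)) +
          pair (pderiv 1 ζ) (W.val (B t)) (W.der 1 (A t)))) := by
  have dA := domConv_mol T h.continuous_valA
  have dB := domConv_mol T h.continuous_valB
  have dDA := fun j => domConv_mol T (h.continuous_derA j)
  have dDB := fun j => domConv_mol T (h.continuous_derB j)
  have dp := domConv_mol T h.continuous_nre
  have dq := domConv_mol T h.continuous_nim
  have hw := hζ.isWeight
  have hwd := fun j => (hζ.pderiv j).isWeight
  have key := sub_eq_integral_of_domConv hT ((dA.pair dA hw).add (dB.pair dB hw))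
    ((((dA.pair (dDB 0) (hwd 0)).add (dA.pair (dDB 1) (hwd 1))).sub
      ((dB.pair (dDA 0) (hwd 0)).add (dB.pair (dDA 1) (hwd 1)))).const_mul 2 |>.add
      (((dq.pair dA hw).sub (dp.pair dB hw)).const_mul 2))
    fun n t ht => h.hasDerivAt_mass_mol hζ n ht
  rw [key]
  refine intervalIntegral.integral_congr fun t _ => ?_
  -- Gauge invariance: the nonlinearity is a real multiple of `u`, so it creates no mass.
  have e : pair ζ (nim (A t, B t)) (W.val (A t)) = pair ζ (nre (A t, B t)) (W.val (B t)) := by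
    refine integral_congr_ae ?_
    filter_upwards [good_nonlin_im.coeFn_toL2 (A t, B t), good_nonlin_re.coeFn_toL2 (A t, B t)]
      with x h1 h2
    rw [nim, nre, h1, h2]; ring
  simp only [e, sub_self, mul_zero, add_zero]

/-- The mass seen through a cutoff at radius of order `m` changes only by a flux through its
gradient, of size `O(1/m)` on a bounded time interval; then `m → ∞`. -/
theorem RealSol.mass_conservation {A B : ℝ → W} (h : RealSol A B) {M : ℝ}
    (hA : ∀ t, ‖A t‖ ≤ M) (hB : ∀ t, ‖B t‖ ≤ M) {T : ℝ} (hT : 0 ≤ T) :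
    ‖W.val (A T)‖ ^ 2 + ‖W.val (B T)‖ ^ 2 = ‖W.val (A 0)‖ ^ 2 + ‖W.val (B 0)‖ ^ 2 := by
  have hM : 0 ≤ M := (norm_nonneg _).trans (hA 0)
  set z : ℕ → Plane → ℝ := fun m x => bump (((m : ℝ) + 1)⁻¹ • x)
  have hzt : ∀ m, IsTest (z m) := fun m => isTest_bump.comp_smul (by positivity)
  have hlim : ∀ f : L2, Tendsto (fun m => pair (z m) f f) atTop (𝓝 (‖f‖ ^ 2)) := by
    intro f
    rw [norm_sq_L2]
    refine tendsto_integral_of_dominated_convergence (fun x => f x ^ 2)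
      (fun m => ((hzt m).isWeight.integrable f f).1) (Lp.memLp f).integrable_sq
      (fun m => ae_of_all _ fun x => ?_) (ae_of_all _ fun x => ?_)
    · rw [Real.norm_eq_abs, abs_mul, abs_of_nonneg (bump_nonneg _), ← sq,
        abs_of_nonneg (sq_nonneg _)]
      exact mul_le_of_le_one_left (sq_nonneg _) (bump_le_one _)
    · refine tendsto_const_nhds.congr' ?_
      obtain ⟨N, hN⟩ := exists_nat_gt ‖x‖
      filter_upwards [eventually_ge_atTop N] with m hm
      have hm' : (N : ℝ) ≤ m := by exact_mod_cast hm
      have : z m x = 1 := by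
        refine bump_eq_one ?_
        rw [norm_smul, Real.norm_of_nonneg (by positivity), inv_mul_le_iff₀ (by positivity)]
        linarith
      rw [this]; ring
  obtain ⟨b0, hb0, hb0'⟩ := (isTest_bump.pderiv 0).exists_bound
  obtain ⟨b1, hb1, hb1'⟩ := (isTest_bump.pderiv 1).exists_bound
  have hzd : ∀ m (j : Fin 2) x, |pderiv j (z m) x| ≤ ((m : ℝ) + 1)⁻¹ * (b0 + b1) := by
    intro m j x
    rw [pderiv_comp_smul _ _ _ (differentiableAt_of_smooth contDiff_bump _), abs_mul,
      abs_of_nonneg (by positivity : (0 : ℝ) ≤ ((m : ℝ) + 1)⁻¹)]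
    refine mul_le_mul_of_nonneg_left ?_ (by positivity)
    fin_cases j
    · exact (hb0' _).trans (by linarith)
    · exact (hb1' _).trans (by linarith)
  set d : ℕ → ℝ := fun m => (pair (z m) (W.val (A T)) (W.val (A T)) +
      pair (z m) (W.val (B T)) (W.val (B T))) -
      (pair (z m) (W.val (A 0)) (W.val (A 0)) + pair (z m) (W.val (B 0)) (W.val (B 0))) with hd
  have h1 : Tendsto d atTop (𝓝 ((‖W.val (A T)‖ ^ 2 + ‖W.val (B T)‖ ^ 2) -
      (‖W.val (A 0)‖ ^ 2 + ‖W.val (B 0)‖ ^ 2))) :=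
    ((hlim _).add (hlim _)).sub ((hlim _).add (hlim _))
  -- The `8` is the factor `2` of the flux times its four pairings.
  have h2 : ∀ m, |d m| ≤ (8 * ((b0 + b1) * (M * M)) * T) * ((m : ℝ) + 1)⁻¹ := by
    intro m
    rw [hd]
    simp only [h.mass_flux (hzt m) hT]
    have hb : ∀ t j (p q : W), ‖p‖ ≤ M → ‖q‖ ≤ M →
        |pair (pderiv j (z m)) (W.val p) (W.der t q)| ≤
          ((m : ℝ) + 1)⁻¹ * (b0 + b1) * (M * M) := by
      intro t j p q hp hq
      refine (((hzt m).pderiv j).isWeight.abs_pair_le (hzd m j) _ _).trans ?_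
      refine mul_le_mul_of_nonneg_left ?_ (by positivity)
      exact mul_le_mul ((W.norm_val_le p).trans hp) ((W.norm_der_le q t).trans hq)
        (norm_nonneg _) hM
    have := intervalIntegral.norm_integral_le_of_norm_le_const (a := 0) (b := T)
      (C := 8 * (((m : ℝ) + 1)⁻¹ * (b0 + b1) * (M * M)))
      (f := fun t => 2 * (pair (pderiv 0 (z m)) (W.val (A t)) (W.der 0 (B t)) +
          pair (pderiv 1 (z m)) (W.val (A t)) (W.der 1 (B t)) -
        (pair (pderiv 0 (z m)) (W.val (B t)) (W.der 0 (A t)) +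
          pair (pderiv 1 (z m)) (W.val (B t)) (W.der 1 (A t))))) (fun t _ => by
        have q1 := abs_le.1 (hb 0 0 (A t) (B t) (hA t) (hB t))
        have q2 := abs_le.1 (hb 1 1 (A t) (B t) (hA t) (hB t))
        have q3 := abs_le.1 (hb 0 0 (B t) (A t) (hB t) (hA t))
        have q4 := abs_le.1 (hb 1 1 (B t) (A t) (hB t) (hA t))
        rw [Real.norm_eq_abs, abs_le]
        constructor <;> linarith [q1.1, q1.2, q2.1, q2.2, q3.1, q3.2, q4.1, q4.2])
    rw [sub_zero, abs_of_nonneg hT] at this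
    refine this.trans (le_of_eq ?_)
    ring
  have h3 : Tendsto (fun m : ℕ => (8 * ((b0 + b1) * (M * M)) * T) * ((m : ℝ) + 1)⁻¹) atTop
      (𝓝 0) := by
    have := (tendsto_one_div_add_atTop_nhds_zero_nat (𝕜 := ℝ)).const_mul
      (8 * ((b0 + b1) * (M * M)) * T)
    simpa using this
  have h4 : Tendsto d atTop (𝓝 0) := squeeze_zero_norm h2 h3
  linarith [tendsto_nhds_unique h1 h4]

end CubicQuintic

namespace CubicQuintic

/-! ### The truncated virial vector field -/

theorem deriv_smoothTransition_nonneg (s : ℝ) : 0 ≤ deriv Real.smoothTransition s :=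
  Real.smoothTransition.monotone.deriv_nonneg

/-- A radial profile with `√s · prof s` nondecreasing, equal to one for `s ≤ 5` and to `3/√s` for
`9 ≤ s`. -/
noncomputable def prof (s : ℝ) : ℝ :=
  1 + Real.smoothTransition ((s - 5) / 4) * (3 * s ^ (-(1 / 2) : ℝ) - 1)

theorem prof_eq_one {s : ℝ} (hs : s ≤ 5) : prof s = 1 := by
  rw [prof, Real.smoothTransition.zero_of_nonpos (by linarith)]; ring

theorem prof_eq {s : ℝ} (hs : 9 ≤ s) : prof s = 3 * s ^ (-(1 / 2) : ℝ) := by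
  rw [prof, Real.smoothTransition.one_of_one_le (by linarith)]; ring

theorem contDiff_prof : ContDiff ℝ ∞ prof := by
  rw [contDiff_iff_contDiffAt]
  intro s
  rcases lt_or_ge s 5 with hs | hs
  · have : prof =ᶠ[𝓝 s] fun _ => 1 := by
      filter_upwards [gt_mem_nhds hs] with r hr
      exact prof_eq_one hr.le
    exact contDiffAt_const.congr_of_eventuallyEq this
  · have h1 : ContDiff ℝ ∞ (fun s : ℝ => Real.smoothTransition ((s - 5) / 4)) :=
      Real.smoothTransition.contDiff.comp (by fun_prop)
    have h2 : ContDiffAt ℝ ∞ (fun s : ℝ => s ^ (-(1 / 2) : ℝ)) s :=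
      Real.contDiffAt_rpow_const_of_ne (by linarith)
    exact contDiffAt_const.add (h1.contDiffAt.mul ((contDiffAt_const.mul h2).sub contDiffAt_const))

theorem rpow_neg_half {s : ℝ} (hs : 0 < s) : s ^ (-(1 / 2) : ℝ) = (√s)⁻¹ := by
  rw [Real.rpow_neg hs.le, Real.sqrt_eq_rpow]

theorem prof_nonneg (s : ℝ) : 0 ≤ prof s := by
  rcases le_or_gt s 5 with hs | hs
  · rw [prof_eq_one hs]; exact zero_le_one
  · have h0 := Real.smoothTransition.nonneg ((s - 5) / 4)
    have h1 := Real.smoothTransition.le_one ((s - 5) / 4)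
    have h2 : 0 ≤ s ^ (-(1 / 2) : ℝ) := by positivity
    rw [prof]
    nlinarith [mul_nonneg h0 h2]

theorem sqrt_mul_prof_le (s : ℝ) : √s * prof s ≤ 3 := by
  rcases le_or_gt s 5 with h5 | h5
  · rw [prof_eq_one h5, mul_one]
    exact Real.sqrt_le_iff.2 ⟨by norm_num, by linarith⟩
  · have hp : 0 < s := by linarith
    have hq : 0 < √s := Real.sqrt_pos.2 hp
    rcases le_or_gt s 9 with h9 | h9
    · have h0 := Real.smoothTransition.nonneg ((s - 5) / 4)
      have h1 := Real.smoothTransition.le_one ((s - 5) / 4)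
      have h3 : √s ≤ 3 := Real.sqrt_le_iff.2 ⟨by norm_num, by linarith⟩
      rw [prof, rpow_neg_half hp]
      have e : √s * (1 + Real.smoothTransition ((s - 5) / 4) * (3 * (√s)⁻¹ - 1)) =
          √s + Real.smoothTransition ((s - 5) / 4) * (3 - √s) := by field_simp
      rw [e]
      nlinarith
    · rw [prof_eq h9.le, rpow_neg_half hp]
      have : √s * (3 * (√s)⁻¹) = 3 := by field_simp
      linarith

theorem prof_le_two (s : ℝ) : prof s ≤ 2 := by
  rcases le_or_gt s 5 with h5 | h5
  · rw [prof_eq_one h5]; norm_num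
  · have h1 := sqrt_mul_prof_le s
    have h2 : 2 ≤ √s := Real.le_sqrt_of_sq_le (by linarith)
    nlinarith [prof_nonneg s]

theorem deriv_prof_eq_zero {s : ℝ} (hs : s < 5) : deriv prof s = 0 := by
  have : prof =ᶠ[𝓝 s] fun _ => 1 := by
    filter_upwards [gt_mem_nhds hs] with r hr
    exact prof_eq_one hr.le
  rw [this.deriv_eq]; simp

theorem deriv_prof_of_gt {s : ℝ} (hs : 9 < s) :
    deriv prof s = -(3 / 2) * s ^ (-(3 / 2) : ℝ) := by
  have : prof =ᶠ[𝓝 s] fun r => 3 * r ^ (-(1 / 2) : ℝ) := by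
    filter_upwards [lt_mem_nhds hs] with r hr
    exact prof_eq hr.le
  rw [this.deriv_eq, deriv_const_mul_field,
    (Real.hasDerivAt_rpow_const (p := -(1 / 2)) (Or.inl (by linarith : s ≠ 0))).deriv]
  norm_num
  ring

theorem deriv2_prof_of_gt {s : ℝ} (hs : 9 < s) :
    deriv (deriv prof) s = 9 / 4 * s ^ (-(5 / 2) : ℝ) := by
  have : deriv prof =ᶠ[𝓝 s] fun r => -(3 / 2) * r ^ (-(3 / 2) : ℝ) := by
    filter_upwards [lt_mem_nhds hs] with r hr
    exact deriv_prof_of_gt hr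
  rw [this.deriv_eq, deriv_const_mul_field,
    (Real.hasDerivAt_rpow_const (p := -(3 / 2)) (Or.inl (by linarith : s ≠ 0))).deriv]
  norm_num
  ring

theorem contDiff_deriv {f : ℝ → ℝ} (hf : ContDiff ℝ ∞ f) : ContDiff ℝ ∞ (deriv f) :=
  (contDiff_infty_iff_deriv.1 hf).2

theorem exists_bound_prof : ∃ C, 0 ≤ C ∧ ∀ s, 0 ≤ s →
    |s * deriv prof s| ≤ C ∧ |s ^ 2 * deriv (deriv prof) s| ≤ C := by
  have h1 := (contDiff_deriv contDiff_prof).continuous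
  have h2 := (contDiff_deriv (contDiff_deriv contDiff_prof)).continuous
  obtain ⟨C₁, hC₁⟩ := (isCompact_Icc (a := (0 : ℝ)) (b := 9)).exists_bound_of_continuousOn
    (continuous_id.mul h1).continuousOn
  obtain ⟨C₂, hC₂⟩ := (isCompact_Icc (a := (0 : ℝ)) (b := 9)).exists_bound_of_continuousOn
    ((continuous_id.pow 2).mul h2).continuousOn
  refine ⟨max (max C₁ C₂) 3, le_max_of_le_right (by norm_num), fun s hs => ?_⟩
  rcases le_or_gt s 9 with h9 | h9
  · exact ⟨(hC₁ s ⟨hs, h9⟩).trans (le_max_of_le_left (le_max_left _ _)),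
      (hC₂ s ⟨hs, h9⟩).trans (le_max_of_le_left (le_max_right _ _))⟩
  · have hp : 0 < s := by linarith
    have hle : s ^ (-(1 / 2) : ℝ) ≤ 1 :=
      Real.rpow_le_one_of_one_le_of_nonpos (by linarith) (by norm_num)
    have hge : 0 ≤ s ^ (-(1 / 2) : ℝ) := by positivity
    have e1 : s * s ^ (-(3 / 2) : ℝ) = s ^ (-(1 / 2) : ℝ) := by
      nth_rewrite 1 [← Real.rpow_one s]
      rw [← Real.rpow_add hp]; norm_num
    have e2 : s ^ 2 * s ^ (-(5 / 2) : ℝ) = s ^ (-(1 / 2) : ℝ) := by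
      rw [← Real.rpow_natCast s 2, ← Real.rpow_add hp]; norm_num
    constructor
    · rw [deriv_prof_of_gt h9]
      have : s * (-(3 / 2) * s ^ (-(3 / 2) : ℝ)) = -(3 / 2) * s ^ (-(1 / 2) : ℝ) := by
        rw [← e1]; ring
      rw [this, abs_le]
      exact ⟨by linarith [le_max_right (max C₁ C₂) 3], by linarith [le_max_right (max C₁ C₂) 3]⟩
    · rw [deriv2_prof_of_gt h9]
      have : s ^ 2 * (9 / 4 * s ^ (-(5 / 2) : ℝ)) = 9 / 4 * s ^ (-(1 / 2) : ℝ) := by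
        rw [← e2]; ring
      rw [this, abs_le]
      exact ⟨by linarith [le_max_right (max C₁ C₂) 3], by linarith [le_max_right (max C₁ C₂) 3]⟩

/-- The expression is `2√s` times the derivative of `√s · prof s` for positive `s`. That function
moves from `√s` to the constant `3` in the region where `√s ≤ 3`, so it never decreases. -/
theorem prof_add_nonneg (s : ℝ) : 0 ≤ prof s + 2 * s * deriv prof s := by
  rcases lt_or_ge s 5 with h5 | h5
  · rw [prof_eq_one h5.le, deriv_prof_eq_zero h5]; norm_num
  rcases le_or_gt s 9 with h9 | h9
  · have hp : 0 < s := by linarith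
    set τ := Real.smoothTransition ((s - 5) / 4) with hτ
    have h1 : HasDerivAt (fun s : ℝ => Real.smoothTransition ((s - 5) / 4))
        (deriv Real.smoothTransition ((s - 5) / 4) * (1 / 4)) s := by
      have hd : HasDerivAt Real.smoothTransition (deriv Real.smoothTransition ((s - 5) / 4))
          ((s - 5) / 4) :=
        ((Real.smoothTransition.contDiff (n := 1)).differentiable (by simp) _).hasDerivAt
      exact hd.comp s (((hasDerivAt_id s).sub_const 5).div_const 4)
    have h2 := (Real.hasDerivAt_rpow_const (p := -(1 / 2)) (Or.inl hp.ne')).const_mul 3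
    have h3 : HasDerivAt prof _ s := (h1.mul (h2.sub_const 1)).const_add 1
    rw [h3.deriv, prof, ← hτ]
    set τ' := deriv Real.smoothTransition ((s - 5) / 4)
    have hτ' : 0 ≤ τ' := deriv_smoothTransition_nonneg _
    have e1 : s * s ^ (-(1 / 2) - 1 : ℝ) = s ^ (-(1 / 2) : ℝ) := by
      nth_rewrite 1 [← Real.rpow_one s]
      rw [← Real.rpow_add hp]; norm_num
    have hsq : 1 ≤ 3 * s ^ (-(1 / 2) : ℝ) := by
      rw [rpow_neg_half hp]
      have h3 : √s ≤ 3 := Real.sqrt_le_iff.2 ⟨by norm_num, by linarith⟩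
      have hq : 0 < √s := Real.sqrt_pos.2 hp
      rw [← div_eq_mul_inv, le_div_iff₀ hq]; linarith
    have hτ1 : τ ≤ 1 := Real.smoothTransition.le_one _
    -- Three groups: the identity part with weight `1 - τ`, the derivative of the transition, and
    -- the power with weight `τ`. The last vanishes because `√s · 3s^(-1/2)` is constant.
    have e2 : 1 + τ * (3 * s ^ (-(1 / 2) : ℝ) - 1) +
        2 * s * (τ' * (1 / 4) * (3 * s ^ (-(1 / 2) : ℝ) - 1) +
          τ * (3 * (-(1 / 2) * s ^ (-(1 / 2) - 1 : ℝ)))) =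
        (1 - τ) + 2 * s * (τ' * (1 / 4) * (3 * s ^ (-(1 / 2) : ℝ) - 1)) +
        τ * (3 * (s ^ (-(1 / 2) : ℝ) - s * s ^ (-(1 / 2) - 1 : ℝ))) := by ring
    rw [e2, e1]
    have : 0 ≤ 2 * s * (τ' * (1 / 4) * (3 * s ^ (-(1 / 2) : ℝ) - 1)) := by
      have : 0 ≤ 3 * s ^ (-(1 / 2) : ℝ) - 1 := by linarith
      positivity
    linarith
  · have hp : 0 < s := by linarith
    have e1 : s * s ^ (-(3 / 2) : ℝ) = s ^ (-(1 / 2) : ℝ) := by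
      nth_rewrite 1 [← Real.rpow_one s]
      rw [← Real.rpow_add hp]; norm_num
    rw [prof_eq h9.le, deriv_prof_of_gt h9]
    nlinarith

/-- A cutoff profile, equal to one for `r ≤ 1` and to zero for `2 ≤ r`. -/
noncomputable def cut (r : ℝ) : ℝ := Real.smoothTransition (2 - r)

theorem contDiff_cut : ContDiff ℝ ∞ cut :=
  Real.smoothTransition.contDiff.comp (contDiff_const.sub contDiff_id)

theorem cut_eq_one {r : ℝ} (hr : r ≤ 1) : cut r = 1 :=
  Real.smoothTransition.one_of_one_le (by linarith)

theorem cut_eq_zero {r : ℝ} (hr : 2 ≤ r) : cut r = 0 :=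
  Real.smoothTransition.zero_of_nonpos (by linarith)

theorem deriv_cut_lt {r : ℝ} (hr : r < 1) : deriv cut r = 0 := by
  have : cut =ᶠ[𝓝 r] fun _ => 1 := by
    filter_upwards [gt_mem_nhds hr] with q hq
    exact cut_eq_one hq.le
  rw [this.deriv_eq]; simp

theorem deriv_cut_gt {r : ℝ} (hr : 2 < r) : deriv cut r = 0 := by
  have : cut =ᶠ[𝓝 r] fun _ => 0 := by
    filter_upwards [lt_mem_nhds hr] with q hq
    exact cut_eq_zero hq.le
  rw [this.deriv_eq]; simp

theorem deriv2_cut_gt {r : ℝ} (hr : 2 < r) : deriv (deriv cut) r = 0 := by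
  have : deriv cut =ᶠ[𝓝 r] fun _ => 0 := by
    filter_upwards [lt_mem_nhds hr] with q hq
    exact deriv_cut_gt hq
  rw [this.deriv_eq]; simp

theorem exists_bound_cut : ∃ C, 0 ≤ C ∧ ∀ r, 0 ≤ r →
    |r * deriv cut r| ≤ C ∧ |r ^ 2 * deriv (deriv cut) r| ≤ C := by
  have h1 := (contDiff_deriv contDiff_cut).continuous
  have h2 := (contDiff_deriv (contDiff_deriv contDiff_cut)).continuous
  obtain ⟨C₁, hC₁⟩ := (isCompact_Icc (a := (0 : ℝ)) (b := 2)).exists_bound_of_continuousOn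
    (continuous_id.mul h1).continuousOn
  obtain ⟨C₂, hC₂⟩ := (isCompact_Icc (a := (0 : ℝ)) (b := 2)).exists_bound_of_continuousOn
    ((continuous_id.pow 2).mul h2).continuousOn
  refine ⟨max (max C₁ C₂) 0, le_max_right _ _, fun r hr => ?_⟩
  rcases le_or_gt r 2 with h9 | h9
  · exact ⟨(hC₁ r ⟨hr, h9⟩).trans (le_max_of_le_left (le_max_left _ _)),
      (hC₂ r ⟨hr, h9⟩).trans (le_max_of_le_left (le_max_right _ _))⟩
  · simp [deriv_cut_gt h9, deriv2_cut_gt h9]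

/-- Truncated radial profiles, with scale-invariant bounds that are uniform in the truncation. -/
theorem exists_profile : ∃ C : ℝ, 0 ≤ C ∧ ∀ δ : ℝ, 0 < δ → ∃ K : ℝ → ℝ, ContDiff ℝ ∞ K ∧
    (∃ S, ∀ s, S ≤ s → K s = 0) ∧ (∀ s, s ≤ 5 → K s = 1) ∧ ∀ s, 0 ≤ s →
      0 ≤ K s ∧ √s * K s ≤ 3 ∧ K s ≤ 2 ∧ |s * deriv K s| ≤ C ∧
      |s ^ 2 * deriv (deriv K) s| ≤ C ∧ -δ ≤ K s + 2 * s * deriv K s := by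
  obtain ⟨C₁, hC₁, h₁⟩ := exists_bound_prof
  obtain ⟨C₂, hC₂, h₂⟩ := exists_bound_cut
  refine ⟨(C₁ + 2 * C₂) + 2 * C₁ * C₂, by positivity, fun δ hδ => ?_⟩
  -- The truncation acts on `N² ≤ s ≤ 2N²`. The bound `N > 3` puts it beyond the plateau `s ≤ 5`;
  -- there `prof s ≤ 3/N`, so the truncation costs at most `2 · (3/N) · C₂ ≤ δ`.
  obtain ⟨N, hN⟩ := exists_nat_gt (max 3 (6 * C₂ / δ))
  have hN3 : (3 : ℝ) < N := (le_max_left _ _).trans_lt hN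
  have hNδ : 6 * C₂ / δ < N := (le_max_right _ _).trans_lt hN
  have hN0 : (0 : ℝ) < N := by linarith
  set ν : ℝ := ((N : ℝ) ^ 2)⁻¹
  have hν : 0 < ν := by positivity
  set z : ℝ → ℝ := fun s => cut (ν * s) with hz
  have hzs : ContDiff ℝ ∞ z := contDiff_cut.comp (contDiff_const.mul contDiff_id)
  have hz' : ∀ s, deriv z s = ν * deriv cut (ν * s) := fun s => by
    simp only [hz, deriv_comp_mul_left, smul_eq_mul]
  have hz'' : ∀ s, deriv (deriv z) s = ν ^ 2 * deriv (deriv cut) (ν * s) := fun s => by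
    rw [funext hz', deriv_const_mul_field, deriv_comp_mul_left ν (deriv cut), smul_eq_mul]; ring
  have hb : ∀ s, 0 ≤ s → |s * deriv z s| ≤ C₂ ∧ |s ^ 2 * deriv (deriv z) s| ≤ C₂ := by
    intro s hs
    have := h₂ (ν * s) (by positivity)
    rw [hz', hz'']
    have e1 : s * (ν * deriv cut (ν * s)) = ν * s * deriv cut (ν * s) := by ring
    have e2 : s ^ 2 * (ν ^ 2 * deriv (deriv cut) (ν * s)) =
      (ν * s) ^ 2 * deriv (deriv cut) (ν * s) := by ring
    rw [e1, e2]; exact this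
  have hz0 : ∀ s, 0 ≤ z s := fun s => Real.smoothTransition.nonneg _
  have hz1 : ∀ s, z s ≤ 1 := fun s => Real.smoothTransition.le_one _
  have dp : Differentiable ℝ prof := contDiff_prof.differentiable (by simp)
  have dz : Differentiable ℝ z := hzs.differentiable (by simp)
  have dp' : Differentiable ℝ (deriv prof) :=
    (contDiff_deriv contDiff_prof).differentiable (by simp)
  have dz' : Differentiable ℝ (deriv z) := (contDiff_deriv hzs).differentiable (by simp)
  set K : ℝ → ℝ := fun s => prof s * z s with hK
  have hK' : ∀ s, deriv K s = deriv prof s * z s + prof s * deriv z s := fun s =>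
    deriv_fun_mul (dp s) (dz s)
  have hK'' : ∀ s, deriv (deriv K) s = deriv (deriv prof) s * z s +
      2 * (deriv prof s * deriv z s) + prof s * deriv (deriv z) s := fun s => by
    rw [funext hK', deriv_fun_add ((dp' s).fun_mul (dz s)) ((dp s).fun_mul (dz' s)),
      deriv_fun_mul (dp' s) (dz s), deriv_fun_mul (dp s) (dz' s)]
    ring
  refine ⟨K, contDiff_prof.mul hzs, ⟨2 * (N : ℝ) ^ 2, fun s hs => ?_⟩, fun s hs => ?_,
    fun s hs => ⟨mul_nonneg (prof_nonneg s) (hz0 s), ?_, ?_, ?_, ?_, ?_⟩⟩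
  · have : z s = 0 := cut_eq_zero (by
      simp only [ν]
      rw [inv_mul_eq_div, le_div_iff₀ (by positivity)]; exact hs)
    simp only [hK, this, mul_zero]
  · have : z s = 1 := cut_eq_one (by
      simp only [ν]
      rw [inv_mul_eq_div, div_le_one (by positivity)]; nlinarith)
    simp only [hK, this, prof_eq_one hs, mul_one]
  · have h3 := sqrt_mul_prof_le s
    have h0 : 0 ≤ √s * prof s := mul_nonneg (Real.sqrt_nonneg _) (prof_nonneg _)
    simp only [hK]
    rw [← mul_assoc]
    nlinarith [hz0 s, hz1 s]
  · exact (mul_le_of_le_one_right (prof_nonneg s) (hz1 s)).trans (prof_le_two s)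
  · have a1 := (h₁ s hs).1
    have a2 := (hb s hs).1
    have e : s * deriv K s = (s * deriv prof s) * z s + prof s * (s * deriv z s) := by
      rw [hK']; ring
    rw [e]
    refine (abs_add_le _ _).trans ?_
    rw [abs_mul _ (z s), abs_mul (prof s), abs_of_nonneg (hz0 s), abs_of_nonneg (prof_nonneg s)]
    have b1 : |s * deriv prof s| * z s ≤ C₁ * 1 :=
      mul_le_mul a1 (hz1 s) (hz0 s) hC₁
    have b2 : prof s * |s * deriv z s| ≤ 2 * C₂ :=
      mul_le_mul (prof_le_two s) a2 (abs_nonneg _) zero_le_two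
    nlinarith [mul_nonneg hC₁ hC₂]
  · have a1 := (h₁ s hs).1
    have a1' := (h₁ s hs).2
    have a2 := (hb s hs).1
    have a2' := (hb s hs).2
    have e : s ^ 2 * deriv (deriv K) s = (s ^ 2 * deriv (deriv prof) s) * z s +
        2 * ((s * deriv prof s) * (s * deriv z s)) + prof s * (s ^ 2 * deriv (deriv z) s) := by
      rw [hK'']; ring
    rw [e]
    refine (abs_add_le _ _).trans ?_
    refine (add_le_add_left (abs_add_le _ _) _).trans ?_
    rw [abs_mul _ (z s), abs_mul 2, abs_mul (s * deriv prof s), abs_mul (prof s),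
      abs_of_nonneg (hz0 s), abs_of_nonneg (prof_nonneg s), abs_two]
    have b1 : |s ^ 2 * deriv (deriv prof) s| * z s ≤ C₁ * 1 :=
      mul_le_mul a1' (hz1 s) (hz0 s) hC₁
    have b2 : prof s * |s ^ 2 * deriv (deriv z) s| ≤ 2 * C₂ :=
      mul_le_mul (prof_le_two s) a2' (abs_nonneg _) zero_le_two
    have b3 : |s * deriv prof s| * |s * deriv z s| ≤ C₁ * C₂ :=
      mul_le_mul a1 a2 (abs_nonneg _) hC₁
    linarith
  · have e : K s + 2 * s * deriv K s =
        z s * (prof s + 2 * s * deriv prof s) + 2 * (prof s * (s * deriv z s)) := by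
      rw [hK']; ring
    have p1 := mul_nonneg (hz0 s) (prof_add_nonneg s)
    have p2 : -δ ≤ 2 * (prof s * (s * deriv z s)) := by
      rcases lt_or_ge s ((N : ℝ) ^ 2) with hsN | hsN
      · have : deriv z s = 0 := by
          rw [hz', deriv_cut_lt, mul_zero]
          simp only [ν]
          rw [inv_mul_eq_div, div_lt_one (by positivity)]; exact hsN
        rw [this]; simp; exact hδ.le
      · have hsq : (N : ℝ) ≤ √s := Real.le_sqrt_of_sq_le hsN
        have q1 := sqrt_mul_prof_le s
        have q2 : (N : ℝ) * prof s ≤ 3 :=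
          (mul_le_mul_of_nonneg_right hsq (prof_nonneg s)).trans q1
        have q3 := (abs_le.1 (hb s hs).1).1
        have q4 : prof s * C₂ ≤ 3 * C₂ / N := by
          rw [le_div_iff₀ hN0]; nlinarith
        have q5 : 6 * C₂ / N ≤ δ := by
          rw [div_le_iff₀ hN0]
          rw [div_lt_iff₀ hδ] at hNδ
          linarith
        have q6 : -(prof s * C₂) ≤ prof s * (s * deriv z s) := by
          nlinarith [prof_nonneg s]
        have q7 : 6 * C₂ / N = 2 * (3 * C₂ / N) := by ring
        linarith
    rw [e]; linarith

end CubicQuintic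

/-! ### The virial field in the plane -/

namespace CubicQuintic

theorem norm_sq_plane (x : Plane) : ‖x‖ ^ 2 = x 0 ^ 2 + x 1 ^ 2 := by
  rw [EuclideanSpace.norm_sq_eq, Fin.sum_univ_two]
  simp

theorem abs_coord_le (x : Plane) (j : Fin 2) : |x j| ≤ ‖x‖ := PiLp.norm_apply_le x j

theorem pderiv_comp_norm_sq {K : ℝ → ℝ} (hK : Differentiable ℝ K) (j : Fin 2) (x : Plane) :
    pderiv j (fun y => K (‖y‖ ^ 2)) x = 2 * x j * deriv K (‖x‖ ^ 2) := by
  have h1 : HasFDerivAt (fun y : Plane => ‖y‖ ^ 2) _ x := (hasStrictFDerivAt_norm_sq x).hasFDerivAt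
  have h2 := (hK (‖x‖ ^ 2)).hasDerivAt.comp_hasFDerivAt x h1
  have h3 : fderiv ℝ (fun y => K (‖y‖ ^ 2)) x = _ := h2.fderiv
  rw [pderiv, h3]
  simp [EuclideanSpace.inner_single_right]
  ring

theorem contDiff_coord (k : Fin 2) : ContDiff ℝ ∞ fun x : Plane => x k :=
  (EuclideanSpace.proj (𝕜 := ℝ) k).contDiff

theorem pderiv_coord (j k : Fin 2) (x : Plane) :
    pderiv j (fun y : Plane => y k) x = if j = k then 1 else 0 := by
  have h : HasFDerivAt (fun y : Plane => y k) (EuclideanSpace.proj (𝕜 := ℝ) k) x :=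
    (EuclideanSpace.proj (𝕜 := ℝ) k).hasFDerivAt
  rw [pderiv, h.fderiv]
  simp [eq_comm]

/-- A compactly supported vector field that coincides with `x ↦ x` on the disc of radius `2R`, is
almost monotone, and satisfies scale-invariant bounds. -/
structure IsVirialField (C δ R : ℝ) (X : Fin 2 → Plane → ℝ) : Prop where
  isTest : ∀ k, IsTest (X k)
  bound : ∀ k x, |X k x| ≤ 3 * R
  form : ∀ x (ξ : Fin 2 → ℝ), -δ * (ξ 0 ^ 2 + ξ 1 ^ 2) ≤
    pderiv 0 (X 0) x * (ξ 0 * ξ 0) + pderiv 0 (X 1) x * (ξ 0 * ξ 1) +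
      pderiv 1 (X 0) x * (ξ 1 * ξ 0) + pderiv 1 (X 1) x * (ξ 1 * ξ 1)
  inner : ∀ x j k, ‖x‖ ≤ 2 * R → pderiv j (X k) x = if j = k then 1 else 0
  dvg_bound : ∀ x, |dvg X x - 2| ≤ C
  grad_dvg_bound : ∀ x j, |pderiv j (dvg X) x| ≤ C / R

/-- The field is `x K(|x|²)`. Its Jacobian `K·I + 2K' x⊗x` has tangential eigenvalue `K` and radial
eigenvalue `K + 2sK'`, with `s = |x|²`, which are the two quantities controlled from below in
`exists_profile`. The plateau `s ≤ 5` contains the disc `|x| ≤ 2`. -/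
theorem exists_unit_virialField : ∃ C : ℝ, 0 ≤ C ∧ ∀ δ : ℝ, 0 < δ → ∃ Y : Fin 2 → Plane → ℝ,
    IsVirialField C δ 1 Y := by
  obtain ⟨C, hC, h⟩ := exists_profile
  -- The divergence is `2K + 2sK'` with `0 ≤ K ≤ 2`, within `2 + 2C` of `2`; the derivative of the
  -- divergence is at most `2(4C + 2C)`.
  refine ⟨2 + 12 * C, by positivity, fun δ hδ => ?_⟩
  obtain ⟨K, hK, ⟨S, hS⟩, hK1, hb⟩ := h δ hδ
  have dK : Differentiable ℝ K := hK.differentiable (by simp)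
  have dK' : Differentiable ℝ (deriv K) := (contDiff_deriv hK).differentiable (by simp)
  have hz1 : ∀ s, s < 5 → deriv K s = 0 := fun s hs => by
    have : K =ᶠ[𝓝 s] fun _ => 1 := by
      filter_upwards [gt_mem_nhds hs] with r hr
      exact hK1 r hr.le
    rw [this.deriv_eq]; simp
  have hz2 : ∀ s, s < 5 → deriv (deriv K) s = 0 := fun s hs => by
    have : deriv K =ᶠ[𝓝 s] fun _ => 0 := by
      filter_upwards [gt_mem_nhds hs] with r hr
      exact hz1 r hr
    rw [this.deriv_eq]; simp
  have hKn : ContDiff ℝ ∞ fun x : Plane => K (‖x‖ ^ 2) := hK.comp (contDiff_norm_sq ℝ)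
  have hp : ∀ j k (x : Plane), pderiv j (fun y : Plane => y k * K (‖y‖ ^ 2)) x =
      (if j = k then 1 else 0) * K (‖x‖ ^ 2) + x k * (2 * x j * deriv K (‖x‖ ^ 2)) :=
    fun j k x => by
      rw [pderiv_mul (differentiableAt_of_smooth (contDiff_coord k) x)
        (differentiableAt_of_smooth hKn x), pderiv_coord, pderiv_comp_norm_sq dK]
  set Y : Fin 2 → Plane → ℝ := fun k x => x k * K (‖x‖ ^ 2) with hY
  have hdvg : dvg Y = fun x => (fun s => 2 * K s + 2 * (s * deriv K s)) (‖x‖ ^ 2) := by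
    funext x
    rw [dvg, hY, hp, hp]
    simp only [if_true]
    have := norm_sq_plane x
    linear_combination (2 * deriv K (‖x‖ ^ 2)) * (-this)
  have hQ : ∀ s, HasDerivAt (fun s => 2 * K s + 2 * (s * deriv K s))
      (4 * deriv K s + 2 * (s * deriv (deriv K) s)) s := fun s => by
    have h1 := (dK s).hasDerivAt.const_mul 2
    have h2 := ((hasDerivAt_id' s).fun_mul (dK' s).hasDerivAt).const_mul 2
    exact (h1.fun_add h2).congr_deriv (by ring)
  refine ⟨Y, ⟨fun k => ⟨(contDiff_coord k).mul hKn, ?_⟩, fun k x => ?_, fun x ξ => ?_,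
    fun x j k hx => ?_, fun x => ?_, fun x j => ?_⟩⟩
  · refine HasCompactSupport.intro (isCompact_closedBall (0 : Plane) (|S| + 1)) fun x hx => ?_
    have hx' : |S| + 1 < ‖x‖ := by simpa using hx
    have : S ≤ ‖x‖ ^ 2 := by nlinarith [le_abs_self S, abs_nonneg S]
    simp only [hY, hS _ this, mul_zero]
  · have hb' := hb (‖x‖ ^ 2) (by positivity)
    have h2 := hb'.2.1
    rw [Real.sqrt_sq (norm_nonneg x)] at h2
    simp only [hY]
    rw [abs_mul, abs_of_nonneg hb'.1, mul_one]
    exact (mul_le_mul_of_nonneg_right (abs_coord_le x k) hb'.1).trans h2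
  · have hb' := hb (‖x‖ ^ 2) (by positivity)
    simp only [hY, hp]
    simp only [if_true, Fin.isValue, zero_ne_one, one_ne_zero, if_false]
    set s := ‖x‖ ^ 2 with hs
    have hsx : s = x 0 ^ 2 + x 1 ^ 2 := norm_sq_plane x
    set n := ξ 0 ^ 2 + ξ 1 ^ 2 with hn
    have hn0 : 0 ≤ n := by positivity
    set p := (x 0 * ξ 0 + x 1 * ξ 1) ^ 2 with hpp
    have hps : p ≤ s * n := by
      rw [hsx, hn, hpp]; nlinarith [sq_nonneg (x 0 * ξ 1 - x 1 * ξ 0)]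
    have e : (1 * K s + x 0 * (2 * x 0 * deriv K s)) * (ξ 0 * ξ 0) +
        (0 * K s + x 1 * (2 * x 0 * deriv K s)) * (ξ 0 * ξ 1) +
        (0 * K s + x 0 * (2 * x 1 * deriv K s)) * (ξ 1 * ξ 0) +
        (1 * K s + x 1 * (2 * x 1 * deriv K s)) * (ξ 1 * ξ 1) = K s * n + 2 * deriv K s * p := by
      rw [hn, hpp]; ring
    rw [e]
    -- If `K' ≥ 0` both terms are nonnegative. Otherwise the worst direction is radial, by
    -- Cauchy–Schwarz, and the form is at least `(K + 2sK')|ξ|²`.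
    rcases le_or_gt 0 (deriv K s) with h0 | h0
    · have : 0 ≤ 2 * deriv K s * p := by positivity
      have := mul_nonneg hb'.1 hn0
      nlinarith
    · have h1 : deriv K s * (s * n) ≤ deriv K s * p := mul_le_mul_of_nonpos_left hps h0.le
      have h2 := mul_le_mul_of_nonneg_right hb'.2.2.2.2.2 hn0
      nlinarith
  · have : ‖x‖ ^ 2 < 5 := by nlinarith [norm_nonneg x]
    simp only [hY, hp, hz1 _ this, hK1 _ this.le]
    simp
  · have hb' := hb (‖x‖ ^ 2) (by positivity)
    rw [hdvg]
    have h3 := abs_le.1 hb'.2.2.2.1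
    rw [abs_le]
    constructor <;> dsimp only <;> linarith [hb'.1, hb'.2.2.1]
  · have hQd : Differentiable ℝ (fun s => 2 * K s + 2 * (s * deriv K s)) :=
      fun s => (hQ s).differentiableAt
    have e := pderiv_comp_norm_sq hQd j x
    rw [← hdvg] at e
    rw [e, (hQ _).deriv, div_one]
    rcases lt_or_ge (‖x‖ ^ 2) 5 with h5 | h5
    · rw [hz1 _ h5, hz2 _ h5]; simp; positivity
    have hb' := hb (‖x‖ ^ 2) (by positivity)
    set s := ‖x‖ ^ 2 with hs
    -- Valid because `s ≥ 5` here; it trades the factor `|x|` for the power of `s` in the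
    -- scale-invariant bounds.
    have hxs : ‖x‖ ≤ s := by rw [hs]; nlinarith [norm_nonneg x]
    have hxj : |x j| ≤ s := (abs_coord_le x j).trans hxs
    have hs0 : 0 ≤ s := by positivity
    calc |2 * x j * (4 * deriv K s + 2 * (s * deriv (deriv K) s))|
        = 2 * (|x j| * |4 * deriv K s + 2 * (s * deriv (deriv K) s)|) := by
          rw [abs_mul, abs_mul, abs_two]; ring
      _ ≤ 2 * (s * |4 * deriv K s + 2 * (s * deriv (deriv K) s)|) := by gcongr
      _ = 2 * |4 * (s * deriv K s) + 2 * (s ^ 2 * deriv (deriv K) s)| := by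
          rw [← abs_of_nonneg hs0, ← abs_mul, abs_of_nonneg hs0]; ring_nf
      _ ≤ 2 * (4 * |s * deriv K s| + 2 * |s ^ 2 * deriv (deriv K) s|) := by
          gcongr
          refine (abs_add_le _ _).trans ?_
          rw [abs_mul 4, abs_mul 2, abs_two, abs_of_pos (by norm_num : (0 : ℝ) < 4)]
      _ ≤ 2 + 12 * C := by linarith [hb'.2.2.2.1, hb'.2.2.2.2.1]

/-- Dilation of the unit field to `R Y(x/R)`: the Jacobian keeps its values, while the field gains a
factor `R` and the gradient of the divergence loses one. -/
theorem exists_virialField : ∃ C : ℝ, 0 ≤ C ∧ ∀ δ R : ℝ, 0 < δ → 0 < R →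
    ∃ X : Fin 2 → Plane → ℝ, IsVirialField C δ R X := by
  obtain ⟨C, hC, h⟩ := exists_unit_virialField
  refine ⟨C, hC, fun δ R hδ hR => ?_⟩
  obtain ⟨Y, hY⟩ := h δ hδ
  have hR' : R⁻¹ ≠ 0 := (inv_pos.2 hR).ne'
  have hp : ∀ j k x, pderiv j (fun x => R * Y k (R⁻¹ • x)) x = pderiv j (Y k) (R⁻¹ • x) :=
    fun j k x => by
      rw [pderiv_const_mul (differentiableAt_of_smooth ((hY.isTest k).comp_smul hR').1 x),
        pderiv_comp_smul _ _ _ (differentiableAt_of_smooth (hY.isTest k).1 _)]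
      field_simp
  have hd : dvg (fun k x => R * Y k (R⁻¹ • x)) = fun x => dvg Y (R⁻¹ • x) := by
    funext x
    rw [dvg, hp, hp, dvg]
  refine ⟨fun k x => R * Y k (R⁻¹ • x), ⟨fun k => ?_, fun k x => ?_, fun x ξ => ?_,
    fun x j k hx => ?_, fun x => ?_, fun x j => ?_⟩⟩
  · have := ((hY.isTest k).comp_smul hR').mul_smooth (contDiff_const (c := R))
    simpa only [mul_comm R] using this
  · rw [abs_mul, abs_of_pos hR]
    nlinarith [hY.bound k (R⁻¹ • x)]
  · simp only [hp]
    exact hY.form _ ξ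
  · rw [hp]
    refine hY.inner _ j k ?_
    rw [norm_smul, Real.norm_of_nonneg (inv_pos.2 hR).le, inv_mul_eq_div, div_le_iff₀ hR]
    linarith
  · rw [hd]; exact hY.dvg_bound _
  · rw [hd, pderiv_comp_smul _ _ _ (differentiableAt_of_smooth (isTest_dvg hY.isTest).1 _), abs_mul,
      abs_of_pos (inv_pos.2 hR), inv_mul_eq_div]
    gcongr
    simpa using hY.grad_dvg_bound (R⁻¹ • x) j

theorem IsVirialField.dvg_inner {C δ R : ℝ} {X : Fin 2 → Plane → ℝ} (h : IsVirialField C δ R X)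
    {x : Plane} (hx : ‖x‖ ≤ 2 * R) : dvg X x = 2 := by
  rw [dvg, h.inner x 0 0 hx, h.inner x 1 1 hx]; norm_num

end CubicQuintic

namespace CubicQuintic

/-! ### The localized virial estimate -/

theorem isWeight_one : IsWeight (fun _ => 1) := ⟨continuous_const, 1, by simp⟩

/-- The weighted Dirichlet energy. -/
noncomputable def dirichlet (c : Plane → ℝ) (y : W × W) : ℝ :=
  (pair c (W.der 0 y.1) (W.der 0 y.1) + pair c (W.der 1 y.1) (W.der 1 y.1)) +
    (pair c (W.der 0 y.2) (W.der 0 y.2) + pair c (W.der 1 y.2) (W.der 1 y.2))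

/-- The quartic integral `∫ |u|⁴`. -/
noncomputable def quart (y : W × W) : ℝ := pair (fun _ => 1) (densL y) (densL y)

/-- The sextic integral `∫ |u|⁶`. -/
noncomputable def sext (y : W × W) : ℝ := pair (fun _ => 1) (densSqL y) (densL y)

theorem continuous_dirichlet {c : Plane → ℝ} (hc : IsWeight c) : Continuous (dirichlet c) := by
  have h1 : ∀ j, Continuous fun y : W × W => W.der j y.1 := fun j =>
    (W.der j).continuous.comp continuous_fst
  have h2 : ∀ j, Continuous fun y : W × W => W.der j y.2 := fun j =>
    (W.der j).continuous.comp continuous_snd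
  exact ((hc.continuous_pair_comp (h1 0) (h1 0)).add (hc.continuous_pair_comp (h1 1) (h1 1))).add
    ((hc.continuous_pair_comp (h2 0) (h2 0)).add (hc.continuous_pair_comp (h2 1) (h2 1)))

theorem continuous_quart : Continuous quart :=
  isWeight_one.continuous_pair_comp continuous_densL continuous_densL

theorem continuous_sext : Continuous sext :=
  isWeight_one.continuous_pair_comp continuous_densSqL continuous_densL

theorem quart_eq (y : W × W) : quart y = ‖densL y‖ ^ 2 := by
  rw [norm_sq_L2, quart, pair]
  simp only [one_mul, sq]

theorem dens_nonneg (y : W × W) (x : Plane) : 0 ≤ dens y x :=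
  add_nonneg (mul_self_nonneg _) (mul_self_nonneg _)

theorem sext_nonneg (y : W × W) : 0 ≤ sext y := by
  refine integral_nonneg_of_ae ?_
  filter_upwards [good_dens.coeFn_toL2 y, good_dens_sq.coeFn_toL2 y] with x h1 h2
  simp only [densL, densSqL, h1, h2, Pi.zero_apply, one_mul]
  have := dens_nonneg y x
  positivity

theorem exists_quart_le (M : ℝ) : ∃ C, 0 ≤ C ∧ ∀ y : W × W, ‖y‖ ≤ M → quart y ≤ C := by
  obtain ⟨C, hC, h⟩ := good_dens.exists_norm_toL2_le M
  refine ⟨C ^ 2, by positivity, fun y hy => ?_⟩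
  rw [quart_eq]
  exact pow_le_pow_left₀ (norm_nonneg _) (h y hy) 2

/-- The localized virial functional. -/
noncomputable def vir (c : Plane → ℝ) (y : W × W) : ℝ :=
  dirichlet c y - 1 / 2 * quart y + 2 / 3 * sext y

theorem continuous_vir {c : Plane → ℝ} (hc : IsWeight c) : Continuous (vir c) :=
  ((continuous_dirichlet hc).sub (continuous_quart.const_mul _)).add (continuous_sext.const_mul _)

/-- Inside `|x| ≤ 2R` the Jacobian is the identity and `c ≤ 1`; outside, `c` vanishes and only
almost monotonicity is used, at a cost of `δ` times the full gradient norm. The term with the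
gradient of the divergence is estimated by Cauchy–Schwarz. -/
theorem IsVirialField.kin_lower_bound {C δ R M : ℝ} {X : Fin 2 → Plane → ℝ}
    (hX : IsVirialField C δ R X)
    (hδ : 0 ≤ δ) {c : Plane → ℝ} (hc : IsWeight c) (hc1 : ∀ x, c x ≤ 1)
    (hc2 : ∀ x, 2 * R < ‖x‖ → c x = 0) (hC : 0 ≤ C) (hR : 0 < R) {a : L2} {D : Fin 2 → L2}
    (ha : ‖a‖ ≤ M) (hD : ∀ j, ‖D j‖ ≤ M) :
    2 * (pair c (D 0) (D 0) + pair c (D 1) (D 1)) - (4 * δ + 2 * (C / R)) * M ^ 2 ≤ kin X a D := by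
  have hM : 0 ≤ M := (norm_nonneg _).trans ha
  have hw : ∀ j k, IsWeight (pderiv j (X k)) := fun j k => ((hX.isTest k).pderiv j).isWeight
  have hd : ∀ j, |pair (pderiv j (dvg X)) a (D j)| ≤ C / R * M ^ 2 := fun j => by
    refine (((isTest_dvg hX.isTest).pderiv j).isWeight.abs_pair_le
      (fun x => hX.grad_dvg_bound x j) a (D j)).trans ?_
    have : ‖a‖ * ‖D j‖ ≤ M * M := mul_le_mul ha (hD j) (norm_nonneg _) hM
    rw [sq]
    gcongr
  have key : pair c (D 0) (D 0) + pair c (D 1) (D 1) - δ * (‖D 0‖ ^ 2 + ‖D 1‖ ^ 2) ≤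
      pair (pderiv 0 (X 0)) (D 0) (D 0) + pair (pderiv 0 (X 1)) (D 0) (D 1) +
      pair (pderiv 1 (X 0)) (D 1) (D 0) + pair (pderiv 1 (X 1)) (D 1) (D 1) := by
    have i0 := isWeight_one.integrable (D 0) (D 0)
    have i1 := isWeight_one.integrable (D 1) (D 1)
    have e : ∀ f : L2, ‖f‖ ^ 2 = ∫ x, 1 * (f x * f x) := fun f => by
      rw [norm_sq_L2]; simp only [sq, one_mul]
    have c0 := hc.integrable (D 0) (D 0)
    have c1 := hc.integrable (D 1) (D 1)
    have w00 := (hw 0 0).integrable (D 0) (D 0)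
    have w01 := (hw 0 1).integrable (D 0) (D 1)
    have w10 := (hw 1 0).integrable (D 1) (D 0)
    have w11 := (hw 1 1).integrable (D 1) (D 1)
    simp only [e, pair]
    rw [← integral_add i0 i1, ← integral_const_mul, ← integral_add c0 c1,
      ← integral_sub (c0.fun_add c1) ((i0.fun_add i1).const_mul _), ← integral_add w00 w01,
      ← integral_add (w00.fun_add w01) w10, ← integral_add ((w00.fun_add w01).fun_add w10) w11]
    refine integral_mono (((c0.fun_add c1).sub' ((i0.fun_add i1).const_mul _)))
      (((w00.fun_add w01).fun_add w10).fun_add w11) fun x => ?_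
    have hf := hX.form x (fun j => D j x)
    have hn : 0 ≤ D 0 x * D 0 x + D 1 x * D 1 x :=
      add_nonneg (mul_self_nonneg _) (mul_self_nonneg _)
    rcases le_or_gt ‖x‖ (2 * R) with hx | hx
    · rw [hX.inner x 0 0 hx, hX.inner x 0 1 hx, hX.inner x 1 0 hx, hX.inner x 1 1 hx]
      simp only [if_true, Fin.isValue, zero_ne_one, one_ne_zero, if_false]
      nlinarith [hc1 x, mul_nonneg hδ hn, mul_le_mul_of_nonneg_right (hc1 x) hn]
    · rw [hc2 x hx]
      nlinarith
  have h0 := abs_le.1 (hd 0)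
  have h1 := abs_le.1 (hd 1)
  have d0 := pow_le_pow_left₀ (norm_nonneg _) (hD 0) 2
  have d1 := pow_le_pow_left₀ (norm_nonneg _) (hD 1) 2
  rw [kin]
  nlinarith [mul_le_mul_of_nonneg_left (add_le_add d0 d1) hδ]

theorem integral_dens (y : W × W) : Integrable (dens y) ∧
    ∫ x, dens y x = ‖W.val y.1‖ ^ 2 + ‖W.val y.2‖ ^ 2 := by
  have h1 := integrable_mul_L2 (W.val y.1) (W.val y.1)
  have h2 := integrable_mul_L2 (W.val y.2) (W.val y.2)
  refine ⟨h1.add h2, ?_⟩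
  rw [norm_sq_L2, norm_sq_L2]
  simp only [sq, dens]
  exact integral_add h1 h2

/-- The two sides differ only where `div X ≠ 2`, that is outside `|x| ≤ 2R`. There the density `q`
satisfies `q ≤ κ`, so `q²` and `q³` are at most `κq` and `κq²`, which are globally integrable. -/
theorem IsVirialField.nlin_lower_bound {C δ R κ : ℝ} {X : Fin 2 → Plane → ℝ}
    (hX : IsVirialField C δ R X) (hC : 0 ≤ C) (hκ0 : 0 ≤ κ) {y : W × W}
    (hκ : ∀ᵐ x, 2 * R < ‖x‖ → dens y x ≤ κ) :
    2 * (-(1 / 2) * quart y + 2 / 3 * sext y) -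
      C * κ * ((‖W.val y.1‖ ^ 2 + ‖W.val y.2‖ ^ 2) + quart y) ≤ nlin X y := by
  have hw := (isTest_dvg hX.isTest).isWeight
  have hi := integral_dens y
  have i4 := isWeight_one.integrable (densL y) (densL y)
  have i6 := isWeight_one.integrable (densSqL y) (densL y)
  have w4 := hw.integrable (densL y) (densL y)
  have w6 := hw.integrable (densSqL y) (densL y)
  have e : ∫ x, (2 * (-(1 / 2) * (1 * (densL y x * densL y x)) +
      2 / 3 * (1 * (densSqL y x * densL y x))) -
      C * κ * (dens y x + 1 * (densL y x * densL y x))) ≤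
      ∫ x, (-(1 / 2) * (dvg X x * (densL y x * densL y x)) +
        2 / 3 * (dvg X x * (densSqL y x * densL y x))) := by
    refine integral_mono_ae ((((i4.const_mul _).fun_add (i6.const_mul _)).const_mul _).sub'
      ((hi.1.fun_add i4).const_mul _)) ((w4.const_mul _).fun_add (w6.const_mul _)) ?_
    filter_upwards [good_dens.coeFn_toL2 y, good_dens_sq.coeFn_toL2 y, hκ] with x h1 h2 h3
    simp only [densL, densSqL, h1, h2]
    have hq := dens_nonneg y x
    set q := dens y x
    rcases le_or_gt ‖x‖ (2 * R) with hx | hx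
    · rw [hX.dvg_inner hx]
      have : 0 ≤ C * κ * (q + 1 * (q * q)) := by positivity
      linarith
    · have hqκ := h3 hx
      have hd := abs_le.1 (hX.dvg_bound x)
      have b1 : q * q ≤ κ * q := by nlinarith
      have b2 : q * q * q ≤ κ * (q * q) := by nlinarith
      nlinarith [mul_nonneg hq hq, mul_nonneg (mul_nonneg hq hq) hq,
        mul_le_mul_of_nonneg_left b1 hC, mul_le_mul_of_nonneg_left b2 hC,
        mul_le_mul_of_nonneg_right hd.1 (mul_nonneg hq hq),
        mul_le_mul_of_nonneg_right hd.2 (mul_nonneg hq hq),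
        mul_le_mul_of_nonneg_right hd.1 (mul_nonneg (mul_nonneg hq hq) hq),
        mul_le_mul_of_nonneg_right hd.2 (mul_nonneg (mul_nonneg hq hq) hq)]
  rw [integral_sub (((i4.const_mul _).fun_add (i6.const_mul _)).const_mul _)
      ((hi.1.fun_add i4).const_mul _), integral_const_mul, integral_const_mul,
    integral_add hi.1 i4, integral_add (i4.const_mul _) (i6.const_mul _),
    integral_add (w4.const_mul _) (w6.const_mul _), hi.2] at e
  simp only [integral_const_mul, one_mul] at e
  simpa only [quart, sext, nlin, pair, one_mul] using e

theorem exists_dens_decay : ∃ C, 0 ≤ C ∧ ∀ (M R : ℝ) (y : W × W), 0 < R → ‖y‖ ≤ M →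
    (W.val y.1).IsRadial → (W.val y.2).IsRadial →
    ∀ᵐ x, 2 * R < ‖x‖ → dens y x ≤ C * M ^ 2 / R := by
  obtain ⟨C, hC, h⟩ := exists_radial_sobolev
  refine ⟨C, hC, fun M R y hR hy h1 h2 => ?_⟩
  filter_upwards [h y.1 h1, h y.2 h2] with x ha hb hx
  have n1 : ‖y.1‖ ^ 2 ≤ M ^ 2 := pow_le_pow_left₀ (norm_nonneg _) ((norm_fst_le y).trans hy) 2
  have n2 : ‖y.2‖ ^ 2 ≤ M ^ 2 := pow_le_pow_left₀ (norm_nonneg _) ((norm_snd_le y).trans hy) 2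
  rw [le_div_iff₀ hR, dens]
  have m1 := mul_le_mul_of_nonneg_left n1 hC
  have m2 := mul_le_mul_of_nonneg_left n2 hC
  nlinarith [sq_nonneg (W.val y.1 x), sq_nonneg (W.val y.2 x)]

theorem IsVirialField.abs_mom_le {C δ R M : ℝ} {X : Fin 2 → Plane → ℝ}
    (hX : IsVirialField C δ R X) (hR : 0 < R) {y : W × W} (hy : ‖y‖ ≤ M) :
    |mom X y| ≤ 12 * R * M ^ 2 := by
  have hM : 0 ≤ M := (norm_nonneg _).trans hy
  have h1 : ‖y.1‖ ≤ M := (norm_fst_le y).trans hy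
  have h2 : ‖y.2‖ ≤ M := (norm_snd_le y).trans hy
  have hp : ∀ (k : Fin 2) (f g : L2), ‖f‖ ≤ M → ‖g‖ ≤ M → |pair (X k) f g| ≤ 3 * R * M ^ 2 :=
    fun k f g hf hg => by
      refine ((hX.isTest k).isWeight.abs_pair_le (hX.bound k) f g).trans ?_
      rw [sq]
      gcongr
  have v1 := (W.norm_val_le y.1).trans h1
  have v2 := (W.norm_val_le y.2).trans h2
  have a := fun k => abs_le.1 (hp k _ _ v1 ((W.norm_der_le y.2 k).trans h2))
  have b := fun k => abs_le.1 (hp k _ _ v2 ((W.norm_der_le y.1 k).trans h1))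
  rw [mom, Fin.sum_univ_two, abs_le]
  constructor <;> linarith [(a 0).1, (a 0).2, (a 1).1, (a 1).2, (b 0).1, (b 0).2, (b 1).1, (b 1).2]

/-- The localized virial estimate for radial solutions. -/
theorem exists_virial_bound (M : ℝ) : ∃ K : ℝ, 0 < K ∧ ∀ A B : ℝ → W, RealSol A B →
    (∀ t, (W.val (A t)).IsRadial) → (∀ t, (W.val (B t)).IsRadial) →
    (∀ t, ‖(A t, B t)‖ ≤ M) → ∀ T R : ℝ, 0 ≤ T → 0 < R → ∀ c : Plane → ℝ, IsWeight c →
    (∀ x, c x ≤ 1) → (∀ x, 2 * R < ‖x‖ → c x = 0) →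
    ∫ t in (0 : ℝ)..T, vir c (A t, B t) ≤ K * (R + R⁻¹ * T) := by
  obtain ⟨C, hC, hfield⟩ := exists_virialField
  obtain ⟨D, hD, hdecay⟩ := exists_dens_decay
  obtain ⟨Q, hQ, hquart⟩ := exists_quart_le M
  -- The first term collects the kinetic errors of the real and imaginary parts, each `(4 + 2C)M²/R`
  -- once `δ = 1/R`; the second is the nonlinear error with `κ = DM²/R`.
  set L := (8 + 4 * C) * M ^ 2 + C * (D * M ^ 2) * (2 * M ^ 2 + Q) with hL
  have hL0 : 0 ≤ L := by positivity
  refine ⟨12 * M ^ 2 + L + 1, by positivity, fun A B h rA rB hb T R hT hR c hc hc1 hc2 => ?_⟩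
  -- The slack in monotonicity is chosen of the same order `1/R` as the other errors.
  obtain ⟨X, hX⟩ := hfield R⁻¹ R (inv_pos.2 hR) hR
  have hRi : 0 < R⁻¹ := inv_pos.2 hR
  have hcont : Continuous fun t => (A t, B t) := h.contA.prodMk h.contB
  have hpt : ∀ t, 2 * vir c (A t, B t) - L * R⁻¹ ≤
      kin X (W.val (A t)) (fun j => W.der j (A t)) +
        kin X (W.val (B t)) (fun j => W.der j (B t)) + nlin X (A t, B t) := fun t => by
    have n1 : ‖A t‖ ≤ M := (norm_fst_le (A t, B t)).trans (hb t)
    have n2 : ‖B t‖ ≤ M := (norm_snd_le (A t, B t)).trans (hb t)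
    have k1 := hX.kin_lower_bound hRi.le hc hc1 hc2 hC hR ((W.norm_val_le (A t)).trans n1)
      (D := fun j => W.der j (A t)) fun j => (W.norm_der_le (A t) j).trans n1
    have k2 := hX.kin_lower_bound hRi.le hc hc1 hc2 hC hR ((W.norm_val_le (B t)).trans n2)
      (D := fun j => W.der j (B t)) fun j => (W.norm_der_le (B t) j).trans n2
    have k3 := hX.nlin_lower_bound hC (by positivity)
      (hdecay M R (A t, B t) hR (hb t) (rA t) (rB t))
    have q1 : ‖W.val (A t)‖ ^ 2 ≤ M ^ 2 :=
      pow_le_pow_left₀ (norm_nonneg _) ((W.norm_val_le (A t)).trans n1) 2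
    have q2 : ‖W.val (B t)‖ ^ 2 ≤ M ^ 2 :=
      pow_le_pow_left₀ (norm_nonneg _) ((W.norm_val_le (B t)).trans n2) 2
    have k4 : C * (D * M ^ 2 / R) * ((‖W.val (A t)‖ ^ 2 + ‖W.val (B t)‖ ^ 2) + quart (A t, B t)) ≤
        C * (D * M ^ 2 / R) * (2 * M ^ 2 + Q) :=
      mul_le_mul_of_nonneg_left (by linarith [hquart _ (hb t)]) (by positivity)
    have e : L * R⁻¹ = 2 * ((4 * R⁻¹ + 2 * (C / R)) * M ^ 2) +
        C * (D * M ^ 2 / R) * (2 * M ^ 2 + Q) := by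
      rw [hL]; field_simp; ring
    rw [e]
    simp only [vir, dirichlet] at *
    linarith
  have hv := h.virial hX.isTest hT
  have hi : ∫ t in (0 : ℝ)..T, (2 * vir c (A t, B t) - L * R⁻¹) ≤
      mom X (A T, B T) - mom X (A 0, B 0) := by
    rw [hv]
    refine intervalIntegral.integral_mono hT ?_ ?_ hpt
    · exact ((((continuous_vir hc).comp hcont).const_mul 2).sub
        continuous_const).intervalIntegrable _ _
    · exact (((continuous_kin hX.isTest h.continuous_valA h.continuous_derA).add
        (continuous_kin hX.isTest h.continuous_valB h.continuous_derB)).add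
        ((continuous_nlin hX.isTest).comp hcont)).intervalIntegrable _ _
  have hvc : Continuous fun t => 2 * vir c (A t, B t) :=
    ((continuous_vir hc).comp hcont).const_mul 2
  rw [intervalIntegral.integral_sub (hvc.intervalIntegrable _ _) intervalIntegrable_const,
    intervalIntegral.integral_const_mul, intervalIntegral.integral_const, sub_zero,
    smul_eq_mul] at hi
  have m1 := abs_le.1 (hX.abs_mom_le hR (hb T))
  have m2 := abs_le.1 (hX.abs_mom_le hR (hb 0))
  have hLT : 0 ≤ L * (R⁻¹ * T) := by positivity
  have hRT : 0 ≤ R⁻¹ * T := by positivity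
  nlinarith [mul_nonneg hL0 hR.le, mul_nonneg (sq_nonneg M) hRT, m1.2, m2.1]

end CubicQuintic

namespace CubicQuintic

/-! ### Real and imaginary parts -/

/-- The component of a complex gradient in direction `j`, seen through a real functional. -/
noncomputable def coordCLM (l : ℂ →L[ℝ] ℝ) (j : Fin 2) : EuclideanSpace ℂ (Fin 2) →L[ℝ] ℝ :=
  l.comp ((EuclideanSpace.proj (𝕜 := ℂ) j).restrictScalars ℝ)

theorem coeFn_compLpL_fn (l : ℂ →L[ℝ] ℝ) (v : H1) :
    ∀ᵐ x, l.compLpL 2 volume v.1.fst x = l (fn v x) :=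
  ContinuousLinearMap.coeFn_compLpL (𝕜 := ℝ) l v.1.fst

theorem coeFn_compLpL_grad (l : ℂ →L[ℝ] ℝ) (j : Fin 2) (v : H1) :
    ∀ᵐ x, (coordCLM l j).compLpL 2 volume v.1.snd x = l (grad v x j) :=
  ContinuousLinearMap.coeFn_compLpL (𝕜 := ℝ) (coordCLM l j) v.1.snd

/-- A real-linear functional commutes with the integral and with real test functions, so it
preserves the weak gradient relation. -/
theorem exists_part (l : ℂ →L[ℝ] ℝ) (v : H1) : ∃ p : W, W.val p = l.compLpL 2 volume v.1.fst ∧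
    ∀ j, W.der j p = (coordCLM l j).compLpL 2 volume v.1.snd := by
  refine W.exists_of_weak fun η hη j => ?_
  have h := congrArg l (v.2 η hη j)
  rw [map_neg, ← ContinuousLinearMap.integral_comp_comm l
    (integrable_smul_of_memLp (hη.memLp_pderiv j) (Lp.memLp v.1.fst)),
    ← ContinuousLinearMap.integral_comp_comm l
    (integrable_smul_of_memLp hη.memLp (memLp_coord v.1.snd j))] at h
  simp only [map_smul, smul_eq_mul] at h
  have e1 : ∫ x, pderiv j η x * l.compLpL 2 volume v.1.fst x = ∫ x, pderiv j η x * l (fn v x) :=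
    integral_congr_ae ((coeFn_compLpL_fn l v).mono fun x hx => by simp only [hx])
  have e2 : ∫ x, η x * (coordCLM l j).compLpL 2 volume v.1.snd x = ∫ x, η x * l (grad v x j) :=
    integral_congr_ae ((coeFn_compLpL_grad l j v).mono fun x hx => by simp only [hx])
  rw [e1, e2]
  exact h

/-- The image of an element of `H¹` under a real functional. -/
noncomputable def part (l : ℂ →L[ℝ] ℝ) (v : H1) : W := (exists_part l v).choose

theorem val_part (l : ℂ →L[ℝ] ℝ) (v : H1) : W.val (part l v) = l.compLpL 2 volume v.1.fst :=
  (exists_part l v).choose_spec.1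

theorem der_part (l : ℂ →L[ℝ] ℝ) (v : H1) (j : Fin 2) :
    W.der j (part l v) = (coordCLM l j).compLpL 2 volume v.1.snd :=
  (exists_part l v).choose_spec.2 j

theorem val_part_ae (l : ℂ →L[ℝ] ℝ) (v : H1) : ∀ᵐ x, W.val (part l v) x = l (fn v x) := by
  rw [val_part]; exact coeFn_compLpL_fn l v

theorem der_part_ae (l : ℂ →L[ℝ] ℝ) (v : H1) (j : Fin 2) :
    ∀ᵐ x, W.der j (part l v) x = l (grad v x j) := by
  rw [der_part]; exact coeFn_compLpL_grad l j v

theorem norm_part_le {l : ℂ →L[ℝ] ℝ} (hl : ∀ z, |l z| ≤ ‖z‖) (v : H1) : ‖part l v‖ ≤ ‖v‖ := by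
  refine W.norm_le (norm_nonneg _) ?_ fun j => ?_
  · refine le_trans (Lp.norm_le_norm_of_ae_le (g := v.1.fst) ?_) (WithLp.norm_fst_le _ v.1)
    filter_upwards [val_part_ae l v] with x hx
    rw [hx]; exact hl _
  · refine le_trans (Lp.norm_le_norm_of_ae_le (g := v.1.snd) ?_) (WithLp.norm_snd_le _ v.1)
    filter_upwards [der_part_ae l v j] with x hx
    rw [hx]; exact (hl _).trans (PiLp.norm_apply_le (grad v x) j)

theorem W.continuous_of_coord {Y : Type*} [TopologicalSpace Y] {f : Y → W}
    (h : Continuous fun y => W.val (f y)) (h' : ∀ j, Continuous fun y => W.der j (f y)) :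
    Continuous f :=
  continuous_induced_rng.2 (h.prodMk (continuous_pi h'))

theorem continuous_part (l : ℂ →L[ℝ] ℝ) : Continuous (part l) := by
  refine W.continuous_of_coord ?_ fun j => ?_
  · simp only [val_part]
    exact (l.compLpL 2 volume).continuous.comp
      ((WithLp.continuous_fst 2 _ _).comp continuous_subtype_val)
  · simp only [der_part]
    exact ((coordCLM l j).compLpL 2 volume).continuous.comp
      ((WithLp.continuous_snd 2 _ _).comp continuous_subtype_val)

theorem isRadial_part (l : ℂ →L[ℝ] ℝ) {v : H1} (hv : IsRadial v) : (W.val (part l v)).IsRadial := by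
  obtain ⟨f, hf⟩ := hv
  refine ⟨fun r => l (f r), ?_⟩
  filter_upwards [val_part_ae l v, hf] with x h1 h2
  rw [h1, h2]

/-- The real and imaginary parts of an element of `H¹`. -/
noncomputable def parts (v : H1) : W × W := (part Complex.reCLM v, part Complex.imCLM v)

theorem continuous_parts : Continuous parts := (continuous_part _).prodMk (continuous_part _)

theorem norm_parts_le (v : H1) : ‖parts v‖ ≤ ‖v‖ :=
  max_le (norm_part_le (fun z => Complex.abs_re_le_norm z) v)
    (norm_part_le (fun z => Complex.abs_im_le_norm z) v)

theorem dens_parts_ae (v : H1) : ∀ᵐ x, dens (parts v) x = ‖fn v x‖ ^ 2 := by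
  filter_upwards [val_part_ae Complex.reCLM v, val_part_ae Complex.imCLM v] with x h1 h2
  rw [dens, parts, h1, h2, ← Complex.normSq_eq_norm_sq, Complex.normSq_apply]
  rfl

theorem grad_parts_ae (v : H1) : ∀ᵐ x, ‖grad v x‖ ^ 2 =
    (W.der 0 (parts v).1 x * W.der 0 (parts v).1 x + W.der 1 (parts v).1 x * W.der 1 (parts v).1 x) +
    (W.der 0 (parts v).2 x * W.der 0 (parts v).2 x +
      W.der 1 (parts v).2 x * W.der 1 (parts v).2 x) := by
  filter_upwards [der_part_ae Complex.reCLM v 0, der_part_ae Complex.reCLM v 1,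
    der_part_ae Complex.imCLM v 0, der_part_ae Complex.imCLM v 1] with x h1 h2 h3 h4
  rw [parts, h1, h2, h3, h4, EuclideanSpace.norm_sq_eq, Fin.sum_univ_two,
    ← Complex.normSq_eq_norm_sq, ← Complex.normSq_eq_norm_sq, Complex.normSq_apply,
    Complex.normSq_apply]
  simp only [Complex.reCLM_apply, Complex.imCLM_apply]
  ring

/-- The coefficients are left free so that the virial and the energy densities are treated together.
-/
theorem integral_density {c : Plane → ℝ} (hc : IsWeight c) (α β γ : ℝ) (v : H1) :
    Integrable (fun x => α * c x * ‖grad v x‖ ^ 2 - β * ‖fn v x‖ ^ 4 + γ * ‖fn v x‖ ^ 6) ∧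
    ∫ x, (α * c x * ‖grad v x‖ ^ 2 - β * ‖fn v x‖ ^ 4 + γ * ‖fn v x‖ ^ 6) =
      α * dirichlet c (parts v) - β * quart (parts v) + γ * sext (parts v) := by
  set y := parts v with hy
  have d1 := hc.integrable (W.der 0 y.1) (W.der 0 y.1)
  have d2 := hc.integrable (W.der 1 y.1) (W.der 1 y.1)
  have d3 := hc.integrable (W.der 0 y.2) (W.der 0 y.2)
  have d4 := hc.integrable (W.der 1 y.2) (W.der 1 y.2)
  have i4 := isWeight_one.integrable (densL y) (densL y)
  have i6 := isWeight_one.integrable (densSqL y) (densL y)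
  have d := (d1.fun_add d2).fun_add (d3.fun_add d4)
  have hI := ((d.const_mul α).sub' (i4.const_mul β)).fun_add (i6.const_mul γ)
  have hae : (fun x => α * c x * ‖grad v x‖ ^ 2 - β * ‖fn v x‖ ^ 4 + γ * ‖fn v x‖ ^ 6) =ᵐ[volume]
      fun x => α * ((c x * (W.der 0 y.1 x * W.der 0 y.1 x) + c x * (W.der 1 y.1 x * W.der 1 y.1 x)) +
        (c x * (W.der 0 y.2 x * W.der 0 y.2 x) + c x * (W.der 1 y.2 x * W.der 1 y.2 x))) -
        β * (1 * (densL y x * densL y x)) + γ * (1 * (densSqL y x * densL y x)) := by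
    filter_upwards [grad_parts_ae v, dens_parts_ae v, good_dens.coeFn_toL2 y,
      good_dens_sq.coeFn_toL2 y] with x h1 h2 h3 h4
    rw [h1, densL, densSqL, h3, h4]
    rw [h2]
    ring
  refine ⟨hI.congr hae.symm, ?_⟩
  rw [integral_congr_ae hae, integral_add ((d.const_mul α).sub' (i4.const_mul β)) (i6.const_mul γ),
    integral_sub (d.const_mul α) (i4.const_mul β), integral_const_mul, integral_const_mul β,
    integral_const_mul γ, integral_add (d1.fun_add d2) (d3.fun_add d4), integral_add d1 d2,
    integral_add d3 d4]
  rfl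

theorem isWeight_cutoff {φ : Plane → ℝ} (hφ : IsCutoff φ) (R : ℝ) : IsWeight (cutoff φ R) :=
  ⟨hφ.smooth.continuous.comp (continuous_const_smul _), 1, fun x => by
    rw [cutoff, abs_of_nonneg (hφ.nonneg _)]; exact hφ.le_one _⟩

theorem cutoff_eq_zero {φ : Plane → ℝ} (hφ : IsCutoff φ) {R : ℝ} (hR : 0 < R) {x : Plane}
    (hx : 2 * R < ‖x‖) : cutoff φ R x = 0 := by
  refine hφ.eq_zero _ ?_
  rwa [norm_smul, Real.norm_of_nonneg (inv_pos.2 hR).le, inv_mul_eq_div, lt_div_iff₀ hR]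

theorem cutoff_eq_one {φ : Plane → ℝ} (hφ : IsCutoff φ) {R : ℝ} (hR : 0 < R) {x : Plane}
    (hx : ‖x‖ ≤ R) : cutoff φ R x = 1 := by
  refine hφ.eq_one _ ?_
  rwa [norm_smul, Real.norm_of_nonneg (inv_pos.2 hR).le, inv_mul_eq_div, div_le_one hR]

theorem integral_virialDensity {φ : Plane → ℝ} (hφ : IsCutoff φ) (R : ℝ) (v : H1) :
    Integrable (virialDensity φ R v) ∧
      ∫ x, virialDensity φ R v x = vir (cutoff φ R) (parts v) := by
  have h := integral_density (isWeight_cutoff hφ R) 1 (1 / 2) (2 / 3) v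
  simp only [one_mul] at h
  exact h

theorem integral_energyDensity {φ : Plane → ℝ} (hφ : IsCutoff φ) (R : ℝ) (v : H1) :
    Integrable (energyDensity φ R v) ∧ ∫ x, energyDensity φ R v x =
      1 / 2 * dirichlet (cutoff φ R) (parts v) - 1 / 4 * quart (parts v) +
        1 / 6 * sext (parts v) :=
  integral_density (isWeight_cutoff hφ R) _ _ _ v

theorem integral_smul_eq {η : Plane → ℝ} (hη : MemLp η 2 volume) {f : Plane → ℂ} {a b : L2}
    (h : ∀ᵐ x, f x = (a x : ℂ) + Complex.I * (b x : ℂ)) :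
    ∫ x, η x • f x =
      ((∫ x, η x * a x : ℝ) : ℂ) + Complex.I * ((∫ x, η x * b x : ℝ) : ℂ) := by
  have ha : Integrable (fun x => η x * a x) := hη.integrable_mul (Lp.memLp a)
  have hb : Integrable (fun x => η x * b x) := hη.integrable_mul (Lp.memLp b)
  rw [← integral_complex_ofReal, ← integral_complex_ofReal, ← integral_const_mul,
    ← integral_add ha.ofReal (hb.ofReal.const_mul _)]
  refine integral_congr_ae (h.mono fun x hx => ?_)
  simp only [hx, Complex.real_smul, Complex.ofReal_mul]
  ring

theorem fn_eq_ae (v : H1) : ∀ᵐ x, fn v x =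
    (W.val (parts v).1 x : ℂ) + Complex.I * (W.val (parts v).2 x : ℂ) := by
  filter_upwards [val_part_ae Complex.reCLM v, val_part_ae Complex.imCLM v] with x h1 h2
  rw [parts, h1, h2, mul_comm]
  exact (Complex.re_add_im _).symm

theorem grad_eq_ae (v : H1) (j : Fin 2) : ∀ᵐ x, grad v x j =
    (W.der j (parts v).1 x : ℂ) + Complex.I * (W.der j (parts v).2 x : ℂ) := by
  filter_upwards [der_part_ae Complex.reCLM v j, der_part_ae Complex.imCLM v j] with x h1 h2
  rw [parts, h1, h2, mul_comm]
  exact (Complex.re_add_im _).symm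

theorem nonlin_eq_ae (v : H1) : ∀ᵐ x, nonlin (fn v x) =
    (nre (parts v) x : ℂ) + Complex.I * (nim (parts v) x : ℂ) := by
  filter_upwards [fn_eq_ae v, dens_parts_ae v, good_nonlin_re.coeFn_toL2 (parts v),
    good_nonlin_im.coeFn_toL2 (parts v)] with x h1 h2 h3 h4
  rw [nre, nim, h3, h4, fac, h2, nonlin]
  push_cast
  generalize ‖fn v x‖ = n
  rw [h1]
  ring

/-- The right-hand side of the weak equation, for one real component. -/
noncomputable def weakRHS (η : Plane → ℝ) (p : W) (f : L2) : ℝ :=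
  (∑ j, ∫ x, pderiv j η x * W.der j p x) + ∫ x, η x * f x

theorem weak_rhs_eq {η : Plane → ℝ} (hη : IsTest η) (v : H1) :
    (∫ x, ∑ j : Fin 2, pderiv j η x • grad v x j) + ∫ x, η x • nonlin (fn v x) =
      (weakRHS η (parts v).1 (nre (parts v)) : ℂ) +
        Complex.I * (weakRHS η (parts v).2 (nim (parts v)) : ℂ) := by
  have hi : ∀ j ∈ Finset.univ, Integrable fun x => pderiv j η x • grad v x j := fun j _ =>
    integrable_smul_of_memLp (hη.memLp_pderiv j) (memLp_coord v.1.snd j)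
  rw [integral_finsetSum _ hi, integral_smul_eq hη.memLp (nonlin_eq_ae v)]
  simp only [integral_smul_eq (hη.memLp_pderiv _) (grad_eq_ae v _), Fin.sum_univ_two, weakRHS]
  push_cast
  ring

theorem continuous_weakRHS {η : Plane → ℝ} (hη : IsTest η) {p : ℝ → W} {f : ℝ → L2}
    (hp : Continuous p) (hf : Continuous f) : Continuous fun t => weakRHS η (p t) (f t) :=
  (continuous_finsetSum _ fun j _ => continuous_integral_test_mul (hη.pderiv j)
    ((W.der j).continuous.comp hp)).add (continuous_integral_test_mul hη hf)

/-- The solution is frozen at its initial value for negative times, which makes the curves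
continuous on all of `ℝ` without affecting the equation for `t ≥ 0`. -/
theorem IsSolution.realSol {u : ℝ → H1} (hu : IsSolution u) :
    RealSol (fun t => (parts (u (max t 0))).1) (fun t => (parts (u (max t 0))).2) := by
  have hcont : Continuous fun t => parts (u (max t 0)) :=
    continuous_parts.comp (hu.continuousOn.comp_continuous (by fun_prop) fun t => mem_Ici.2 (le_max_right _ _))
  have key : ∀ η : Plane → ℝ, IsTest η → ∀ t : ℝ, 0 ≤ t →
      Complex.I * ((((∫ x, η x * W.val (parts (u t)).1 x : ℝ) : ℂ) +
        Complex.I * ((∫ x, η x * W.val (parts (u t)).2 x : ℝ) : ℂ)) -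
        (((∫ x, η x * W.val (parts (u 0)).1 x : ℝ) : ℂ) +
        Complex.I * ((∫ x, η x * W.val (parts (u 0)).2 x : ℝ) : ℂ))) =
      ((∫ s in (0 : ℝ)..t, weakRHS η (parts (u (max s 0))).1 (nre (parts (u (max s 0)))) : ℝ) : ℂ) +
      Complex.I * ((∫ s in (0 : ℝ)..t,
        weakRHS η (parts (u (max s 0))).2 (nim (parts (u (max s 0)))) : ℝ) : ℂ) := by
    intro η hη t ht
    have h := hu.equation η hη t ht
    rw [integral_smul_eq hη.memLp (fn_eq_ae (u t)), integral_smul_eq hη.memLp (fn_eq_ae (u 0))] at h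
    rw [h]
    have c1 : Continuous fun s => (weakRHS η (parts (u (max s 0))).1
        (nre (parts (u (max s 0)))) : ℂ) := Complex.continuous_ofReal.comp
      (continuous_weakRHS hη (continuous_fst.comp hcont) (continuous_nre.comp hcont))
    have c2 : Continuous fun s => Complex.I * (weakRHS η (parts (u (max s 0))).2
        (nim (parts (u (max s 0)))) : ℂ) := continuous_const.mul (Complex.continuous_ofReal.comp
      (continuous_weakRHS hη (continuous_snd.comp hcont) (continuous_nim.comp hcont)))
    rw [← intervalIntegral.integral_ofReal, ← intervalIntegral.integral_ofReal,
      ← intervalIntegral.integral_const_mul, ← intervalIntegral.integral_add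
        (c1.intervalIntegrable _ _) (c2.intervalIntegrable _ _)]
    refine intervalIntegral.integral_congr fun s hs => ?_
    rw [uIcc_of_le ht] at hs
    simp only [weak_rhs_eq hη, max_eq_left hs.1]
  refine ⟨continuous_fst.comp hcont, continuous_snd.comp hcont, fun η hη t ht => ?_,
    fun η hη t ht => ?_⟩
  -- The factor `i` in front of the time increment exchanges the components: the imaginary part of
  -- the equation evolves `A`, the real part evolves `B`.
  · have h := congrArg Complex.im (key η hη t ht)
    simp at h
    simpa only [max_eq_left ht, max_self, weakRHS] using h
  · have h := congrArg Complex.re (key η hη t ht)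
    simp at h
    simp only [max_eq_left ht, max_self]
    rw [← neg_eq_iff_eq_neg, neg_sub]
    exact h

end CubicQuintic

/-! ### The virial estimate for complex solutions, and compactness modulo dilations -/

namespace CubicQuintic

theorem virial_estimate {φ : Plane → ℝ} (hφ : IsCutoff φ) (M : ℝ) : ∃ K : ℝ, 0 < K ∧
    ∀ u : ℝ → H1, IsSolution u → (∀ t : ℝ, 0 ≤ t → IsRadial (u t)) → BoundedBy u M →
      ∀ T R : ℝ, 0 < T → 0 < R →
        (∀ t : ℝ, 0 ≤ t → Integrable (virialDensity φ R (u t))) ∧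
        IntervalIntegrable (fun t => ∫ x, virialDensity φ R (u t) x) volume 0 T ∧
        ∫ t in (0 : ℝ)..T, ∫ x, virialDensity φ R (u t) x ≤ K * (R + R⁻¹ * T) := by
  obtain ⟨K, hK, h⟩ := exists_virial_bound M
  refine ⟨K, hK, fun u hu hr hb T R hT hR => ?_⟩
  have hs := hu.realSol
  have hcont := (continuous_vir (isWeight_cutoff hφ R)).comp (hs.contA.prodMk hs.contB)
  have heq : ∀ t ∈ uIcc 0 T, vir (cutoff φ R) (parts (u (max t 0))) =
      ∫ x, virialDensity φ R (u t) x := fun t ht => by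
    rw [uIcc_of_le hT.le] at ht
    rw [max_eq_left ht.1, (integral_virialDensity hφ R (u t)).2]
  have hm : ∀ t : ℝ, (0 : ℝ) ≤ max t 0 := fun t => le_max_right _ _
  refine ⟨fun t _ => (integral_virialDensity hφ R (u t)).1,
    (hcont.intervalIntegrable 0 T).congr fun t ht => heq t (uIoc_subset_uIcc ht), ?_⟩
  rw [← intervalIntegral.integral_congr heq]
  exact h _ _ hs (fun t => isRadial_part _ (hr _ (hm t))) (fun t => isRadial_part _ (hr _ (hm t)))
    (fun t => (norm_parts_le _).trans (hb _ (hm t))) T R hT.le hR _ (isWeight_cutoff hφ R)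
    (fun x => hφ.le_one _) fun x hx => cutoff_eq_zero hφ hR hx

/-! ### Rescaling and compactness -/

theorem exists_test_near (f : L2) {ε : ℝ} (hε : 0 < ε) :
    ∃ (h : Plane → ℝ) (ht : IsTest h), ‖f - ht.memLp.toLp h‖ ≤ ε := by
  obtain ⟨g, hg1, hg2, hg3⟩ := MemLp.exist_eLpNorm_sub_le (p := 2) (by norm_num) (by norm_num)
    (Lp.memLp f) hε
  refine ⟨g, ⟨hg2, hg1⟩, ?_⟩
  have e : f - (IsTest.memLp ⟨hg2, hg1⟩).toLp g =
      ((Lp.memLp f).sub (IsTest.memLp ⟨hg2, hg1⟩)).toLp _ := by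
    rw [MemLp.toLp_sub (Lp.memLp f), Lp.toLp_coeFn]
  rw [e, Lp.norm_toLp]
  exact ENNReal.toReal_le_of_le_ofReal hε.le hg3

/-- The `L²`-invariant dilation by the factor `r`. -/
noncomputable def resc (r : ℝ) (h : Plane → ℝ) (x : Plane) : ℝ := r⁻¹ * h (r⁻¹ • x)

theorem IsTest.resc {h : Plane → ℝ} (hh : IsTest h) {r : ℝ} (hr : 0 < r) : IsTest (resc r h) := by
  have := (hh.comp_smul (inv_pos.2 hr).ne').mul_smooth (contDiff_const (c := r⁻¹))
  simp only [mul_comm _ r⁻¹] at this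
  exact this

theorem integral_comp_smul_plane (F : Plane → ℝ) {r : ℝ} (hr : 0 < r) :
    r ^ 2 * ∫ x, F (r • x) = ∫ x, F x := by
  rw [Measure.integral_comp_smul]
  have : Module.finrank ℝ Plane = 2 := by simp
  rw [this, abs_of_pos (by positivity), smul_eq_mul]
  field_simp

theorem norm_resc {h : Plane → ℝ} (hh : IsTest h) {r : ℝ} (hr : 0 < r) :
    ‖(hh.resc hr).memLp.toLp _‖ = ‖hh.memLp.toLp h‖ := by
  refine (pow_left_inj₀ (norm_nonneg _) (norm_nonneg _) two_ne_zero).1 ?_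
  rw [norm_toLp_sq, norm_toLp_sq, ← integral_comp_smul_plane _ hr, ← integral_const_mul]
  refine integral_congr_ae (ae_of_all _ fun x => ?_)
  simp only [CubicQuintic.resc, smul_smul, inv_mul_cancel₀ hr.ne', one_smul]
  field_simp

theorem memLp_dilate {f : Plane → ℂ} (hf : MemLp f 2 volume) {r : ℝ} (hr : 0 < r) :
    MemLp (fun x => (r : ℂ) * f (r • x)) 2 volume := by
  refine MemLp.const_mul ?_ _
  refine MemLp.comp_of_map (f := fun x : Plane => r • x) ?_ (measurable_const_smul r).aemeasurable
  rw [Measure.map_addHaar_smul _ hr.ne']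
  exact hf.smul_measure ENNReal.ofReal_ne_top

/-- Up to dilation by `lam t`, the curve `f` has finite nets of test functions. -/
def HasNet (f : ℝ → L2) (lam : ℝ → ℝ) : Prop :=
  ∀ ε : ℝ, 0 < ε → ∃ F : Set (Plane → ℝ), F.Finite ∧ (∀ h ∈ F, IsTest h) ∧
    ∀ t, 0 ≤ t → ∃ h ∈ F, ∃ hm : MemLp (resc (lam t) h) 2 volume, ‖f t - hm.toLp _‖ ≤ ε

/-- Precompactness gives finitely many centres up to `ε/2`, each replaced by a test function up to
`ε/2`. The dilation is an `L²` isometry, so the error is the same before and after undoing it. -/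
theorem IsScaleFunction.hasNet {u : ℝ → H1} {lam : ℝ → ℝ} (hl : IsScaleFunction u lam)
    (l : ℂ →L[ℝ] ℝ) : HasNet (fun t => W.val (part l (u (max t 0)))) lam := by
  intro ε hε
  have hK := hl.2.image (l.compLpL 2 (volume : Measure Plane)).continuous
  obtain ⟨N, -, hN, hcov⟩ := hK.finite_cover_balls (half_pos hε)
  choose h ht hh using fun f : L2 => exists_test_near f (half_pos hε)
  refine ⟨h '' N, hN.image h, ?_, fun t h0 => ?_⟩
  · rintro _ ⟨f, -, rfl⟩; exact ht f
  have hr : 0 < lam t := zero_lt_one.trans_le (hl.1 t h0)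
  set g : Lp ℂ 2 (volume : Measure Plane) :=
    (memLp_dilate (Lp.memLp (u t).1.fst) hr).toLp _ with hg
  have hgae : g =ᵐ[volume] fun x => (lam t : ℂ) * fn (u t) (lam t • x) := MemLp.coeFn_toLp _
  have hmem := hcov (mem_image_of_mem _ (subset_closure ⟨t, h0, hgae⟩))
  simp only [mem_iUnion, Metric.mem_ball, exists_prop] at hmem
  obtain ⟨f, hf, hd⟩ := hmem
  refine ⟨h f, mem_image_of_mem _ hf, ((ht f).resc hr).memLp, ?_⟩
  have hle : ‖l.compLpL 2 volume g - (ht f).memLp.toLp (h f)‖ ≤ ε := by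
    rw [dist_eq_norm] at hd
    have := norm_sub_le_norm_sub_add_norm_sub (l.compLpL 2 volume g) f ((ht f).memLp.toLp (h f))
    linarith [hh f]
  refine le_trans (le_of_eq ?_) hle
  refine (pow_left_inj₀ (norm_nonneg _) (norm_nonneg _) two_ne_zero).1 ?_
  have e1 : ∫ x, (W.val (part l (u (max t 0))) - ((ht f).resc hr).memLp.toLp _ : L2) x ^ 2 =
      ∫ x, (l (fn (u t) x) - resc (lam t) (h f) x) ^ 2 := by
    rw [max_eq_left h0]
    refine integral_congr_ae ?_
    filter_upwards [val_part_ae l (u t), Lp.coeFn_sub (W.val (part l (u t)))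
      (((ht f).resc hr).memLp.toLp _), ((ht f).resc hr).memLp.coeFn_toLp] with x h1 h2 h3
    rw [h2, Pi.sub_apply, h1, h3]
  have e2 : ∫ x, (l.compLpL 2 volume g - (ht f).memLp.toLp (h f) : L2) x ^ 2 =
      ∫ x, (lam t * l (fn (u t) (lam t • x)) - h f x) ^ 2 := by
    refine integral_congr_ae ?_
    filter_upwards [ContinuousLinearMap.coeFn_compLpL (𝕜 := ℝ) l g, hgae,
      Lp.coeFn_sub (l.compLpL 2 volume g) ((ht f).memLp.toLp (h f)),
      (ht f).memLp.coeFn_toLp] with x h1 h2 h3 h4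
    rw [h3, Pi.sub_apply, h1, h2, h4, ← Complex.real_smul, map_smul, smul_eq_mul]
  rw [norm_sq_L2, norm_sq_L2, e1, e2, ← integral_comp_smul_plane _ hr, ← integral_const_mul]
  refine integral_congr_ae (ae_of_all _ fun x => ?_)
  simp only [resc, smul_smul, inv_mul_cancel₀ hr.ne', one_smul]
  field_simp

end CubicQuintic

namespace CubicQuintic

/-! ### Evacuation of energy -/

theorem pair_mono {c c' : Plane → ℝ} (hc : IsWeight c) (hc' : IsWeight c') (h : ∀ x, c x ≤ c' x)
    (f : L2) : pair c f f ≤ pair c' f f :=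
  integral_mono (hc.integrable f f) (hc'.integrable f f) fun x =>
    mul_le_mul_of_nonneg_right (h x) (mul_self_nonneg _)

theorem pair_nonneg {c : Plane → ℝ} (h : ∀ x, 0 ≤ c x) (f : L2) : 0 ≤ pair c f f :=
  integral_nonneg fun x => mul_nonneg (h x) (mul_self_nonneg _)

theorem dirichlet_mono {c c' : Plane → ℝ} (hc : IsWeight c) (hc' : IsWeight c')
    (h : ∀ x, c x ≤ c' x) (y : W × W) : dirichlet c y ≤ dirichlet c' y :=
  add_le_add (add_le_add (pair_mono hc hc' h _) (pair_mono hc hc' h _))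
    (add_le_add (pair_mono hc hc' h _) (pair_mono hc hc' h _))

theorem dirichlet_nonneg {c : Plane → ℝ} (h : ∀ x, 0 ≤ c x) (y : W × W) : 0 ≤ dirichlet c y :=
  add_nonneg (add_nonneg (pair_nonneg h _) (pair_nonneg h _))
    (add_nonneg (pair_nonneg h _) (pair_nonneg h _))

theorem neg_half_quart_le_vir {c : Plane → ℝ} (h : ∀ x, 0 ≤ c x) (y : W × W) :
    -(1 / 2) * quart y ≤ vir c y := by
  rw [vir]
  linarith [dirichlet_nonneg h y, sext_nonneg y]

/-- The localized energy. -/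
noncomputable def enr (c : Plane → ℝ) (y : W × W) : ℝ :=
  1 / 2 * dirichlet c y - 1 / 4 * quart y + 1 / 6 * sext y

/-- `φ` need not be monotone: a doubled radius makes the larger cutoff equal `1` wherever the
smaller one is nonzero. -/
theorem cutoff_le_cutoff {φ : Plane → ℝ} (hφ : IsCutoff φ) {r R : ℝ} (hr : 0 < r)
    (hR : 2 * r ≤ R) (x : Plane) : cutoff φ r x ≤ cutoff φ R x := by
  rcases le_or_gt ‖x‖ R with hx | hx
  · rw [cutoff_eq_one hφ (by linarith) hx]; exact hφ.le_one _
  · rw [cutoff_eq_zero hφ hr (by linarith)]; exact hφ.nonneg _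

/-- The quartic coefficients agree after doubling. The other two changes, a wider cutoff and `⅔`
instead of `⅓` on the sextic term, only help. -/
theorem two_mul_enr_le_vir {φ : Plane → ℝ} (hφ : IsCutoff φ) {r R : ℝ} (hr : 0 < r)
    (hR : 2 * r ≤ R) (y : W × W) : 2 * enr (cutoff φ r) y ≤ vir (cutoff φ R) y := by
  have := dirichlet_mono (isWeight_cutoff hφ r) (isWeight_cutoff hφ R) (cutoff_le_cutoff hφ hr hR) y
  rw [enr, vir]
  linarith [sext_nonneg y]

/-- A bounded solution, compact up to dilations, whose localized energy stays above a positive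
threshold. -/
structure Trapped (φ : Plane → ℝ) (C δ t₀ M K : ℝ) (A B : ℝ → W) (lam : ℝ → ℝ) : Prop where
  sol : RealSol A B
  bdd : ∀ t, ‖(A t, B t)‖ ≤ M
  one_le : ∀ t, 0 ≤ t → 1 ≤ lam t
  netA : HasNet (fun t => W.val (A t)) lam
  netB : HasNet (fun t => W.val (B t)) lam
  isCutoff : IsCutoff φ
  C_pos : 0 < C
  delta_pos : 0 < δ
  start_nonneg : 0 ≤ t₀
  energy : ∀ t, t₀ ≤ t → δ < enr (cutoff φ (C * lam t)) (A t, B t)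
  K_pos : 0 < K
  virial : ∀ T R, 0 ≤ T → 0 < R →
    ∫ t in (0 : ℝ)..T, vir (cutoff φ R) (A t, B t) ≤ K * (R + R⁻¹ * T)

theorem abs_integral_resc_mul_le {h : Plane → ℝ} (hh : IsTest h) {b : ℝ} (hb : ∀ x, |h x| ≤ b)
    {r : ℝ} (hr : 0 < r) {f f' g : L2} (hg : ∀ᵐ x, g x = f x * f' x) :
    |∫ x, resc r h x * g x| ≤ r⁻¹ * b * (‖f‖ * ‖f'‖) := by
  have e : ∫ x, resc r h x * g x = pair (resc r h) f f' :=
    integral_congr_ae (hg.mono fun x hx => by simp only [hx])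
  rw [e]
  refine (hh.resc hr).isWeight.abs_pair_le (fun x => ?_) f f'
  rw [resc, abs_mul, abs_of_pos (inv_pos.2 hr)]
  exact mul_le_mul_of_nonneg_left (hb _) (inv_pos.2 hr).le

theorem exists_uniform_bound {F : Set (Plane → ℝ)} (hF : F.Finite) (ht : ∀ h ∈ F, IsTest h) :
    ∃ b, 0 ≤ b ∧ ∀ h ∈ F, ∀ x, |h x| ≤ b := by
  have h1 : ∀ᶠ b : ℝ in atTop, ∀ h ∈ F, ∀ x, |h x| ≤ b := by
    refine (hF.eventually_all).2 fun h hh => ?_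
    obtain ⟨b, -, hb⟩ := (ht h hh).exists_bound
    filter_upwards [eventually_ge_atTop b] with b' hb' x
    exact (hb x).trans hb'
  obtain ⟨b, hb, hb0⟩ := (h1.and (eventually_ge_atTop 0)).exists
  exact ⟨b, hb0, hb⟩

/-- The map `u ↦ |u|² Re u` into `L²`. -/
noncomputable def cubicRe : W × W → L2 := (good_dens.mul good_re).toL2

/-- The map `u ↦ |u|² Im u` into `L²`. -/
noncomputable def cubicIm : W × W → L2 := (good_dens.mul good_im).toL2

theorem cubicRe_ae (y : W × W) : ∀ᵐ x, cubicRe y x = densL y x * W.val y.1 x := by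
  filter_upwards [(good_dens.mul good_re).coeFn_toL2 y, good_dens.coeFn_toL2 y] with x h1 h2
  rw [cubicRe, densL, h1, h2]

theorem cubicIm_ae (y : W × W) : ∀ᵐ x, cubicIm y x = densL y x * W.val y.2 x := by
  filter_upwards [(good_dens.mul good_im).coeFn_toL2 y, good_dens.coeFn_toL2 y] with x h1 h2
  rw [cubicIm, densL, h1, h2]

/-- Written this way, one factor `u` can be replaced by its approximating profile while the bounded
cubic factor is kept. -/
theorem quart_eq_inner (y : W × W) :
    quart y = inner ℝ (W.val y.1) (cubicRe y) + inner ℝ (W.val y.2) (cubicIm y) := by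
  rw [inner_L2, inner_L2, ← integral_add (integrable_mul_L2 _ _) (integrable_mul_L2 _ _), quart,
    pair]
  refine integral_congr_ae ?_
  filter_upwards [cubicRe_ae y, cubicIm_ae y, good_dens.coeFn_toL2 y] with x h1 h2 h3
  rw [h1, h2, densL, h3, dens]
  ring

namespace Trapped

variable {φ : Plane → ℝ} {C δ t₀ M K : ℝ} {A B : ℝ → W} {lam : ℝ → ℝ}

theorem M_nonneg (h : Trapped φ C δ t₀ M K A B lam) : 0 ≤ M := (norm_nonneg _).trans (h.bdd 0)

theorem lam_pos (h : Trapped φ C δ t₀ M K A B lam) {t : ℝ} (ht : 0 ≤ t) : 0 < lam t :=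
  zero_lt_one.trans_le (h.one_le t ht)

theorem normA (h : Trapped φ C δ t₀ M K A B lam) (t : ℝ) : ‖A t‖ ≤ M :=
  (norm_fst_le (A t, B t)).trans (h.bdd t)

theorem normB (h : Trapped φ C δ t₀ M K A B lam) (t : ℝ) : ‖B t‖ ≤ M :=
  (norm_snd_le (A t, B t)).trans (h.bdd t)

theorem continuous_pair (h : Trapped φ C δ t₀ M K A B lam) : Continuous fun t => (A t, B t) :=
  h.sol.contA.prodMk h.sol.contB

theorem continuous_quart_curve (h : Trapped φ C δ t₀ M K A B lam) :
    Continuous fun t => quart (A t, B t) := continuous_quart.comp h.continuous_pair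

theorem continuous_vir_curve (h : Trapped φ C δ t₀ M K A B lam) (R : ℝ) :
    Continuous fun t => vir (cutoff φ R) (A t, B t) :=
  (continuous_vir (isWeight_cutoff h.isCutoff R)).comp h.continuous_pair

end Trapped

/-- A curve with finite nets pairs weakly with spreading cubic terms. -/
theorem HasNet.exists_inner_le {f : ℝ → L2} {lam : ℝ → ℝ} (hn : HasNet f lam)
    (hl : ∀ t, 0 ≤ t → 0 < lam t) {g d : ℝ → L2} {N : ℝ} (hN : 0 ≤ N) (hg : ∀ t, ‖g t‖ ≤ N)
    (hd : ∀ t, ‖d t‖ ≤ N) (hf : ∀ t, ‖f t‖ ≤ N) (hgf : ∀ t, ∀ᵐ x, g t x = d t x * f t x)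
    {δ : ℝ} (hδ : 0 < δ) :
    ∃ Λ, 0 < Λ ∧ ∀ t, 0 ≤ t → Λ ≤ lam t → inner ℝ (f t) (g t) ≤ δ := by
  -- This fineness, multiplied by `‖g t‖ ≤ N`, costs at most `δ/2`.
  obtain ⟨F, hF, hFt, hnet⟩ := hn (δ / (2 * (N + 1))) (by positivity)
  obtain ⟨b, hb, hFb⟩ := exists_uniform_bound hF hFt
  -- A profile at scale `λ` has height at most `b/λ`; beyond this threshold its pairing is at most
  -- `bN²/λ ≤ δ/2`.
  refine ⟨2 * b * (N * N) / δ + 1, by positivity, fun t ht hΛ => ?_⟩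
  obtain ⟨h, hh, hm, hle⟩ := hnet t ht
  have hr := hl t ht
  have e : inner ℝ (f t) (g t) =
      inner ℝ (f t - hm.toLp _) (g t) + ∫ x, resc (lam t) h x * g t x := by
    rw [← inner_toLp hm, ← inner_add_left, sub_add_cancel]
  have h1 : inner ℝ (f t - hm.toLp _) (g t) ≤ δ / 2 := by
    refine (real_inner_le_norm _ _).trans ?_
    refine (mul_le_mul hle (hg t) (norm_nonneg _) (by positivity)).trans ?_
    rw [div_mul_eq_mul_div, div_le_div_iff₀ (by positivity) two_pos]
    nlinarith
  have h2 : ∫ x, resc (lam t) h x * g t x ≤ δ / 2 := by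
    refine (le_abs_self _).trans ((abs_integral_resc_mul_le (hFt h hh) (hFb h hh) hr
      (hgf t)).trans ?_)
    have h3 : ‖d t‖ * ‖f t‖ ≤ N * N := mul_le_mul (hd t) (hf t) (norm_nonneg _) hN
    have h4 : 2 * b * (N * N) / δ ≤ lam t := by linarith
    rw [div_le_iff₀ hδ] at h4
    calc (lam t)⁻¹ * b * (‖d t‖ * ‖f t‖) ≤ (lam t)⁻¹ * b * (N * N) := by gcongr
      _ = b * (N * N) / lam t := by field_simp
      _ ≤ δ / 2 := by rw [div_le_iff₀ hr]; linarith
  linarith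

namespace Trapped

variable {φ : Plane → ℝ} {C δ t₀ M K : ℝ} {A B : ℝ → W} {lam : ℝ → ℝ}

theorem exists_quart_small (h : Trapped φ C δ t₀ M K A B lam) {δ' : ℝ} (hδ' : 0 < δ') :
    ∃ Λ, 0 < Λ ∧ ∀ t, 0 ≤ t → Λ ≤ lam t → quart (A t, B t) ≤ δ' := by
  obtain ⟨N₁, h₁, b₁⟩ := (good_dens.mul good_re).exists_norm_toL2_le M
  obtain ⟨N₂, h₂, b₂⟩ := (good_dens.mul good_im).exists_norm_toL2_le M
  obtain ⟨N₃, h₃, b₃⟩ := good_dens.exists_norm_toL2_le M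
  have hM := h.M_nonneg
  set N := N₁ + N₂ + N₃ + M
  obtain ⟨Λ₁, p₁, q₁⟩ := h.netA.exists_inner_le (fun t => h.lam_pos)
    (g := fun t => cubicRe (A t, B t)) (d := fun t => densL (A t, B t)) (N := N) (by positivity)
    (fun t => (b₁ _ (h.bdd t)).trans (by simp only [N]; linarith))
    (fun t => (b₃ _ (h.bdd t)).trans (by simp only [N]; linarith))
    (fun t => ((W.norm_val_le _).trans (h.normA t)).trans (by simp only [N]; linarith))
    (fun t => cubicRe_ae _) (half_pos hδ')
  obtain ⟨Λ₂, p₂, q₂⟩ := h.netB.exists_inner_le (fun t => h.lam_pos)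
    (g := fun t => cubicIm (A t, B t)) (d := fun t => densL (A t, B t)) (N := N) (by positivity)
    (fun t => (b₂ _ (h.bdd t)).trans (by simp only [N]; linarith))
    (fun t => (b₃ _ (h.bdd t)).trans (by simp only [N]; linarith))
    (fun t => ((W.norm_val_le _).trans (h.normB t)).trans (by simp only [N]; linarith))
    (fun t => cubicIm_ae _) (half_pos hδ')
  refine ⟨max Λ₁ Λ₂, lt_max_of_lt_left p₁, fun t ht hΛ => ?_⟩
  rw [quart_eq_inner]
  have := q₁ t ht ((le_max_left _ _).trans hΛ)
  have := q₂ t ht ((le_max_right _ _).trans hΛ)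
  dsimp only at *
  linarith

theorem vir_gt (h : Trapped φ C δ t₀ M K A B lam) {t R : ℝ} (ht : t₀ ≤ t)
    (hR : 2 * (C * lam t) ≤ R) : 2 * δ < vir (cutoff φ R) (A t, B t) := by
  have hp : 0 < C * lam t := mul_pos h.C_pos (h.lam_pos (h.start_nonneg.trans ht))
  linarith [h.energy t ht, two_mul_enr_le_vir h.isCutoff hp hR (A t, B t)]

/-- The quartic integral tends to zero in mean. -/
theorem eventually_mean_quart_le (h : Trapped φ C δ t₀ M K A B lam) {θ : ℝ} (hθ : 0 < θ) :
    ∀ᶠ T : ℝ in atTop, ∫ t in (0 : ℝ)..T, quart (A t, B t) ≤ θ * T := by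
  obtain ⟨Q, hQ, hq⟩ := exists_quart_le M
  have hδ := h.delta_pos
  have hK := h.K_pos
  have ht₀ := h.start_nonneg
  -- Chosen so that `c ∫|u|⁴ ≤ cQ ≤ 2δ`: where the scale is small, the virial functional dominates
  -- `c ∫|u|⁴`.
  set c := 2 * δ / (Q + 1) with hc
  have hc0 : 0 < c := by positivity
  have hcQ : c * Q ≤ 2 * δ := by
    rw [hc, div_mul_eq_mul_div, div_le_iff₀ (by positivity)]; nlinarith
  -- Where the scale is large, the virial functional is at least `-½ ∫|u|⁴`, and the deficit `(½ +
  -- c)δ'` is made equal to `cθ/4`.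
  set δ' := c * θ / (4 * (1 / 2 + c)) with hδ'
  have hδ'0 : 0 < δ' := by positivity
  have hδ'e : (1 / 2 + c) * δ' = c * θ / 4 := by rw [hδ']; field_simp
  obtain ⟨Λ, hΛ, hsm⟩ := h.exists_quart_small hδ'0
  -- With `R = εT` the term `KR` is also `cθT/4`. The term `KT/R` and the contribution of `[0, t₀]`
  -- are bounded in `T`, and fit into a third quarter for large `T`.
  set ε := c * θ / (4 * K) with hε
  have hε0 : 0 < ε := by positivity
  have hεe : K * ε = c * θ / 4 := by rw [hε]; field_simp
  have hCp := h.C_pos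
  filter_upwards [eventually_ge_atTop t₀, eventually_gt_atTop 0,
    eventually_ge_atTop (2 * (C * Λ) / ε),
    eventually_ge_atTop ((K * ε⁻¹ + (1 / 2 + c) * Q * t₀) / (c * θ / 4))] with T hT0 hTp hT1 hT2
  set R := ε * T with hR
  have hRp : 0 < R := by positivity
  have hRΛ : 2 * (C * Λ) ≤ R := by rw [div_le_iff₀ hε0] at hT1; linarith
  rw [div_le_iff₀ (by positivity)] at hT2
  have hcp : ∀ x, 0 ≤ cutoff φ R x := fun x => h.isCutoff.nonneg _
  have hpt : ∀ t, t₀ ≤ t → c * quart (A t, B t) - c * θ / 4 ≤ vir (cutoff φ R) (A t, B t) := by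
    intro t ht
    rcases le_or_gt Λ (lam t) with hl | hl
    · have h1 := hsm t (ht₀.trans ht) hl
      have h2 := neg_half_quart_le_vir hcp (A t, B t)
      nlinarith
    · have h1 := h.vir_gt (R := R) ht (by nlinarith)
      have h2 := hq _ (h.bdd t)
      nlinarith
  have hpt0 : ∀ t, c * quart (A t, B t) - (1 / 2 + c) * Q ≤ vir (cutoff φ R) (A t, B t) := by
    intro t
    have h1 := hq _ (h.bdd t)
    have h2 := neg_half_quart_le_vir hcp (A t, B t)
    nlinarith
  have cq : Continuous fun t => c * quart (A t, B t) := h.continuous_quart_curve.const_mul c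
  have cv := h.continuous_vir_curve R
  have I1 : ∫ t in (0 : ℝ)..t₀, (c * quart (A t, B t) - (1 / 2 + c) * Q) ≤
      ∫ t in (0 : ℝ)..t₀, vir (cutoff φ R) (A t, B t) :=
    intervalIntegral.integral_mono_on ht₀ ((cq.sub continuous_const).intervalIntegrable _ _)
      (cv.intervalIntegrable _ _) fun t _ => hpt0 t
  have I2 : ∫ t in t₀..T, (c * quart (A t, B t) - c * θ / 4) ≤
      ∫ t in t₀..T, vir (cutoff φ R) (A t, B t) :=
    intervalIntegral.integral_mono_on hT0 ((cq.sub continuous_const).intervalIntegrable _ _)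
      (cv.intervalIntegrable _ _) fun t ht => hpt t ht.1
  rw [intervalIntegral.integral_sub (cq.intervalIntegrable _ _) intervalIntegrable_const,
    intervalIntegral.integral_const, smul_eq_mul] at I1 I2
  have S1 := intervalIntegral.integral_add_adjacent_intervals (cq.intervalIntegrable 0 t₀)
    (cq.intervalIntegrable t₀ T) (μ := volume)
  have S2 := intervalIntegral.integral_add_adjacent_intervals (cv.intervalIntegrable 0 t₀)
    (cv.intervalIntegrable t₀ T) (μ := volume)
  have hV := h.virial T R hTp.le hRp
  have eR : K * (R + R⁻¹ * T) = c * θ / 4 * T + K * ε⁻¹ := by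
    rw [← hεe, hR]; field_simp
  rw [eR] at hV
  have : c * ∫ t in (0 : ℝ)..T, quart (A t, B t) ≤ c * (θ * T) := by
    rw [← intervalIntegral.integral_const_mul]
    have hp : 0 ≤ c * θ / 4 * t₀ := by positivity
    have hp' : 0 ≤ c * θ / 4 * T := by positivity
    linarith
  exact le_of_mul_le_mul_left this hc0

/-- At large times the scale is comparable to time, at suitable instants. -/
theorem exists_large_scale (h : Trapped φ C δ t₀ M K A B lam) : ∃ c, 0 < c ∧
    ∀ᶠ T : ℝ in atTop, ∃ t ∈ Icc 0 T, c * T ≤ lam t := by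
  have hδ := h.delta_pos
  have hK := h.K_pos
  have ht₀ := h.start_nonneg
  have hCp := h.C_pos
  -- With `R = 2CcT` the term `KR` equals `δT/4`.
  set c := δ / (8 * K * C) with hc
  have hc0 : 0 < c := by positivity
  have hce : K * (2 * (C * c)) = δ / 4 := by rw [hc]; field_simp; norm_num
  refine ⟨c, hc0, ?_⟩
  have hmean : ∀ᶠ T : ℝ in atTop, ∫ t in (0 : ℝ)..(T / 2), quart (A t, B t) ≤ δ * (T / 2) :=
    (tendsto_id.atTop_div_const two_pos).eventually (h.eventually_mean_quart_le hδ)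
  filter_upwards [eventually_gt_atTop 0, eventually_ge_atTop (2 * t₀), hmean,
    eventually_gt_atTop (K * (2 * (C * c))⁻¹ / (δ / 4))] with T hT hT0 hm hT1
  -- If every scale up to time `T` is below `cT`, the virial integral is at least `-δT/4` on the
  -- first half, by the mean bound on the quartic term, and at least `δT` on the second. The virial
  -- estimate bounds the total by less than `δT/2`.
  by_contra hcon
  push Not at hcon
  set R := 2 * (C * c) * T with hR
  have hRp : 0 < R := by positivity
  have cv := h.continuous_vir_curve R
  have cq := h.continuous_quart_curve
  have I1 : ∫ t in (0 : ℝ)..(T / 2), -(1 / 2) * quart (A t, B t) ≤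
      ∫ t in (0 : ℝ)..(T / 2), vir (cutoff φ R) (A t, B t) :=
    intervalIntegral.integral_mono_on (by positivity) ((cq.const_mul _).intervalIntegrable _ _)
      (cv.intervalIntegrable _ _) fun t _ =>
        neg_half_quart_le_vir (fun x => h.isCutoff.nonneg _) _
  have I2 : ∫ t in (T / 2)..T, 2 * δ ≤ ∫ t in (T / 2)..T, vir (cutoff φ R) (A t, B t) := by
    refine intervalIntegral.integral_mono_on (by linarith) intervalIntegrable_const
      (cv.intervalIntegrable _ _) fun t ht => (h.vir_gt (by linarith [ht.1]) ?_).le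
    have := hcon t ⟨by linarith [ht.1], ht.2⟩
    rw [hR]
    nlinarith
  have S := intervalIntegral.integral_add_adjacent_intervals (cv.intervalIntegrable 0 (T / 2))
    (cv.intervalIntegrable (T / 2) T) (μ := volume)
  have hV := h.virial T R hT.le hRp
  have eR : K * (R + R⁻¹ * T) = δ / 4 * T + K * (2 * (C * c))⁻¹ := by
    rw [← hce, hR]; field_simp
  rw [intervalIntegral.integral_const_mul] at I1
  rw [intervalIntegral.integral_const, smul_eq_mul] at I2
  rw [div_lt_iff₀ (by positivity)] at hT1
  rw [eR] at hV
  nlinarith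

end Trapped

end CubicQuintic

/-! ### Weak evacuation and the contradiction -/

namespace CubicQuintic

theorem abs_integral_resc_mul_le_norm {h : Plane → ℝ} (hh : IsTest h) {r : ℝ} (hr : 0 < r) (f : L2) :
    |∫ x, resc r h x * f x| ≤ ‖hh.memLp.toLp h‖ * ‖f‖ := by
  rw [← inner_toLp (hh.resc hr).memLp, ← norm_resc hh hr]
  exact abs_real_inner_le_norm _ _

theorem pderiv_resc {h : Plane → ℝ} (hh : IsTest h) (r : ℝ) (j : Fin 2) :
    pderiv j (resc r h) = fun x => r⁻¹ * resc r (pderiv j h) x := by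
  funext x
  have hd : DifferentiableAt ℝ (fun y => h (r⁻¹ • y)) x :=
    differentiableAt_of_smooth (hh.1.comp (contDiff_const_smul r⁻¹)) x
  have := pderiv_const_mul hd r⁻¹ j
  rw [pderiv_comp_smul _ _ _ (differentiableAt_of_smooth hh.1 _)] at this
  exact this

/-- A second derivative is moved onto the profile. Each derivative of a profile at scale `r` gains
`r⁻¹`, and the `L²` norm is independent of `r`. -/
theorem exists_abs_weakRHS_le {h : Plane → ℝ} (hh : IsTest h) : ∃ D, 0 ≤ D ∧
    ∀ r, 0 < r → ∀ (p : W) (f : L2), |weakRHS (resc r h) p f| ≤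
      (r⁻¹) ^ 2 * (D * ‖W.val p‖) + |∫ x, resc r h x * f x| := by
  set D : Fin 2 → ℝ := fun j => ‖((hh.pderiv j).pderiv j).memLp.toLp _‖
  refine ⟨D 0 + D 1, by positivity, fun r hr p f => ?_⟩
  have key : ∀ j, |∫ x, pderiv j (resc r h) x * W.der j p x| ≤ (r⁻¹) ^ 2 * (D j * ‖W.val p‖) := by
    intro j
    have e1 := W.integral_pderiv p ((hh.resc hr).pderiv j) j
    have e2 : ∀ x, pderiv j (pderiv j (resc r h)) x =
        (r⁻¹) ^ 2 * resc r (pderiv j (pderiv j h)) x := fun x => by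
      rw [pderiv_resc hh, pderiv_const_mul (differentiableAt_of_smooth ((hh.pderiv j).resc hr).1 x),
        pderiv_resc (hh.pderiv j)]
      ring
    simp only [e2, mul_assoc] at e1
    rw [integral_const_mul] at e1
    rw [← abs_neg, ← e1, abs_mul, abs_of_nonneg (by positivity)]
    exact mul_le_mul_of_nonneg_left (abs_integral_resc_mul_le_norm ((hh.pderiv j).pderiv j) hr _) (by positivity)
  rw [weakRHS, Fin.sum_univ_two]
  refine (abs_add_le _ _).trans (add_le_add_left ((abs_add_le _ _).trans ?_) _)
  refine (add_le_add (key 0) (key 1)).trans (le_of_eq ?_)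
  ring

/-- A fixed square-integrable function becomes orthogonal to spreading profiles. -/
theorem eventually_abs_integral_resc_le {h : Plane → ℝ} (hh : IsTest h) (f : L2) {ε : ℝ}
    (hε : 0 < ε) : ∀ᶠ r : ℝ in atTop, |∫ x, resc r h x * f x| ≤ ε := by
  obtain ⟨b, hb, hb'⟩ := hh.exists_bound
  set n := ‖hh.memLp.toLp h‖
  obtain ⟨g, hg, hfg⟩ := exists_test_near f (ε := ε / (2 * (n + 1))) (by positivity)
  set I := ∫ x, |g x|
  have hI : 0 ≤ I := integral_nonneg fun x => abs_nonneg _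
  filter_upwards [eventually_gt_atTop 0, eventually_ge_atTop (2 * (b * I) / ε)] with r hr hr'
  have e : ∫ x, resc r h x * f x = (∫ x, resc r h x * (f - hg.memLp.toLp g : L2) x) +
      ∫ x, resc r h x * g x := by
    have e' : ∫ x, resc r h x * g x = inner ℝ ((hh.resc hr).memLp.toLp _) (hg.memLp.toLp g) := by
      rw [inner_toLp]
      exact integral_congr_ae (hg.memLp.coeFn_toLp.mono fun x hx => by simp only [hx])
    rw [e', ← inner_toLp (hh.resc hr).memLp, ← inner_toLp (hh.resc hr).memLp, ← inner_add_right,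
      sub_add_cancel]
  have h1 : |∫ x, resc r h x * (f - hg.memLp.toLp g : L2) x| ≤ ε / 2 := by
    refine (abs_integral_resc_mul_le_norm hh hr _).trans ?_
    refine (mul_le_mul_of_nonneg_left hfg (norm_nonneg _)).trans ?_
    change n * (ε / (2 * (n + 1))) ≤ ε / 2
    have hn : 0 ≤ n := norm_nonneg _
    rw [mul_div_assoc', div_le_div_iff₀ (by positivity) two_pos]
    nlinarith
  have h2 : |∫ x, resc r h x * g x| ≤ ε / 2 := by
    have : ‖∫ x, resc r h x * g x‖ ≤ ∫ x, r⁻¹ * b * |g x| := by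
      refine norm_integral_le_of_norm_le (hg.integrable.abs.const_mul _) (ae_of_all _ fun x => ?_)
      rw [Real.norm_eq_abs, abs_mul, resc, abs_mul, abs_of_pos (inv_pos.2 hr)]
      exact mul_le_mul_of_nonneg_right
        (mul_le_mul_of_nonneg_left (hb' _) (inv_pos.2 hr).le) (abs_nonneg _)
    rw [integral_const_mul, Real.norm_eq_abs] at this
    refine this.trans ?_
    rw [div_le_iff₀ hε] at hr'
    change r⁻¹ * b * I ≤ ε / 2
    rw [mul_assoc, inv_mul_eq_div, div_le_iff₀ hr]
    linarith
  rw [e]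
  refine (abs_add_le _ _).trans ?_
  linarith

/-- Weak evacuation: a curve driven by a dispersive term and by a forcing that is small in mean
becomes orthogonal to profiles spreading proportionally to time. -/
theorem eventually_abs_integral_resc_curve_le {f g d k : ℝ → L2} {p : ℝ → W} {N : ℝ} (hN : 0 ≤ N)
    (hp : Continuous p) (hg : Continuous g) (hd : Continuous d)
    (heq : ∀ η : Plane → ℝ, IsTest η → ∀ t, 0 ≤ t →
      |(∫ x, η x * f t x) - ∫ x, η x * f 0 x| ≤ ∫ s in (0 : ℝ)..t, |weakRHS η (p s) (g s)|)
    (hpN : ∀ t, ‖W.val (p t)‖ ≤ N) (hkN : ∀ t, ‖k t‖ ≤ N)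
    (hgd : ∀ t, ∀ᵐ x, g t x = d t x * k t x)
    (hmean : ∀ θ : ℝ, 0 < θ → ∀ᶠ T : ℝ in atTop, ∫ t in (0 : ℝ)..T, ‖d t‖ ^ 2 ≤ θ * T)
    {h : Plane → ℝ} (hh : IsTest h) {c ε : ℝ} (hc : 0 < c) (hε : 0 < ε) :
    ∀ᶠ T : ℝ in atTop, ∀ t ∈ Icc 0 T, ∀ r, c * T ≤ r → |∫ x, resc r h x * f t x| ≤ ε := by
  obtain ⟨b, hb, hb'⟩ := hh.exists_bound
  obtain ⟨D, hD, hw⟩ := exists_abs_weakRHS_le hh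
  obtain ⟨r₀, hr₀⟩ := eventually_atTop.1 (eventually_abs_integral_resc_le hh (f 0) (half_pos hε))
  -- Makes the forcing contribution `2θbN/c` at most `ε/4`; the dispersive term takes another `ε/4`
  -- and the initial datum `ε/2`.
  set θ := c * ε / (8 * (b * N + 1)) with hθ
  have hbN : 0 ≤ b * N := mul_nonneg hb hN
  have hθ0 : 0 < θ := by positivity
  have hθe : b * N * (2 * θ) / c ≤ ε / 4 := by
    have : θ * (8 * (b * N + 1)) = c * ε := by rw [hθ]; field_simp
    rw [div_le_iff₀ hc]
    nlinarith
  filter_upwards [eventually_gt_atTop 0, eventually_ge_atTop (r₀ / c), hmean (θ ^ 2) (by positivity),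
    eventually_ge_atTop (4 * (D * N) / (c ^ 2 * ε))] with T hT hT0 hm hT1 t ht r hr
  have hcT : 0 < c * T := by positivity
  have hr0 : 0 < r := hcT.trans_le hr
  have hrr : r₀ ≤ r := by rw [div_le_iff₀ hc] at hT0; linarith
  have hri : r⁻¹ ≤ (c * T)⁻¹ := inv_anti₀ hcT hr
  have hri0 : 0 < r⁻¹ := inv_pos.2 hr0
  -- The mean hypothesis controls `‖d‖²`, whereas the forcing is linear in `‖d‖`. The inequality
  -- `‖d‖ ≤ θ + θ⁻¹‖d‖²` bridges the two, with the hypothesis used at level `θ²`.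
  set bd : ℝ → ℝ := fun s => (r⁻¹) ^ 2 * (D * N) + r⁻¹ * (b * N) * (θ + θ⁻¹ * ‖d s‖ ^ 2) with hbd
  have hbdc : Continuous bd := by fun_prop
  have hpt : ∀ s, |weakRHS (resc r h) (p s) (g s)| ≤ bd s := by
    intro s
    refine (hw r hr0 (p s) (g s)).trans (add_le_add ?_ ?_)
    · have := hpN s
      gcongr
    · refine (abs_integral_resc_mul_le hh hb' hr0 (hgd s)).trans ?_
      have h1 : ‖d s‖ ≤ θ + θ⁻¹ * ‖d s‖ ^ 2 := by
        rw [inv_mul_eq_div, ← sub_le_iff_le_add', le_div_iff₀ hθ0]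
        nlinarith [sq_nonneg (‖d s‖ - θ), norm_nonneg (d s), sq_nonneg θ]
      calc r⁻¹ * b * (‖d s‖ * ‖k s‖) ≤ r⁻¹ * b * ((θ + θ⁻¹ * ‖d s‖ ^ 2) * N) := by
            have := hkN s
            gcongr
        _ = r⁻¹ * (b * N) * (θ + θ⁻¹ * ‖d s‖ ^ 2) := by ring
  have hwc : Continuous fun s => |weakRHS (resc r h) (p s) (g s)| :=
    (continuous_weakRHS (hh.resc hr0) hp hg).abs
  have hbd0 : ∀ s, 0 ≤ bd s := fun s => (abs_nonneg _).trans (hpt s)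
  have I1 : ∫ s in (0 : ℝ)..t, |weakRHS (resc r h) (p s) (g s)| ≤ ∫ s in (0 : ℝ)..T, bd s :=
    (intervalIntegral.integral_mono ht.1 (hwc.intervalIntegrable _ _)
      (hbdc.intervalIntegrable _ _) hpt).trans
      (intervalIntegral.integral_mono_interval le_rfl ht.1 ht.2 (ae_of_all _ hbd0)
        (hbdc.intervalIntegrable _ _))
  have hdc : Continuous fun s => ‖d s‖ ^ 2 := hd.norm.pow 2
  have I2 : ∫ s in (0 : ℝ)..T, bd s = (r⁻¹) ^ 2 * (D * N) * T +
      r⁻¹ * (b * N) * (θ * T + θ⁻¹ * ∫ s in (0 : ℝ)..T, ‖d s‖ ^ 2) := by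
    have c1 : Continuous fun s => θ⁻¹ * ‖d s‖ ^ 2 := hdc.const_mul _
    have c2 : Continuous fun s => r⁻¹ * (b * N) * (θ + θ⁻¹ * ‖d s‖ ^ 2) :=
      (continuous_const.add c1).const_mul _
    rw [hbd, intervalIntegral.integral_add intervalIntegrable_const (c2.intervalIntegrable _ _),
      intervalIntegral.integral_const_mul (r⁻¹ * (b * N)),
      intervalIntegral.integral_add intervalIntegrable_const (c1.intervalIntegrable _ _),
      intervalIntegral.integral_const_mul θ⁻¹]
    simp only [intervalIntegral.integral_const, smul_eq_mul, sub_zero]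
    ring
  have I3 : (r⁻¹) ^ 2 * (D * N) * T ≤ ε / 4 := by
    have h1 : (r⁻¹) ^ 2 ≤ ((c * T)⁻¹) ^ 2 := pow_le_pow_left₀ hri0.le hri 2
    have h2 : (r⁻¹) ^ 2 * (D * N) * T ≤ ((c * T)⁻¹) ^ 2 * (D * N) * T := by gcongr
    refine h2.trans ?_
    have e : ((c * T)⁻¹) ^ 2 * (D * N) * T = D * N / (c ^ 2 * T) := by field_simp
    rw [div_le_iff₀ (by positivity)] at hT1
    rw [e, div_le_iff₀ (by positivity)]
    linarith
  have I4 : r⁻¹ * (b * N) * (θ * T + θ⁻¹ * ∫ s in (0 : ℝ)..T, ‖d s‖ ^ 2) ≤ ε / 4 := by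
    have h1 : θ⁻¹ * ∫ s in (0 : ℝ)..T, ‖d s‖ ^ 2 ≤ θ * T := by
      rw [inv_mul_eq_div, div_le_iff₀ hθ0]; linarith
    have h2 : r⁻¹ * (b * N) * (θ * T + θ⁻¹ * ∫ s in (0 : ℝ)..T, ‖d s‖ ^ 2) ≤
        (c * T)⁻¹ * (b * N) * (θ * T + θ * T) := by
      have h3 : 0 ≤ θ⁻¹ * ∫ s in (0 : ℝ)..T, ‖d s‖ ^ 2 :=
        mul_nonneg (inv_pos.2 hθ0).le
          (intervalIntegral.integral_nonneg hT.le fun s _ => by positivity)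
      gcongr
    refine h2.trans (le_trans (le_of_eq ?_) hθe)
    field_simp
    ring
  have hi := hr₀ r hrr
  have he := heq _ (hh.resc hr0) t ht.1
  have htri : |∫ x, resc r h x * f t x| ≤
      |(∫ x, resc r h x * f t x) - ∫ x, resc r h x * f 0 x| + |∫ x, resc r h x * f 0 x| := by
    have := abs_add_le ((∫ x, resc r h x * f t x) - ∫ x, resc r h x * f 0 x)
      (∫ x, resc r h x * f 0 x)
    rwa [sub_add_cancel] at this
  linarith

/-- The weak derivative is orthogonal to every test function, and these are dense. -/
theorem der_eq_zero {p : W} (hp : W.val p = 0) (j : Fin 2) : W.der j p = 0 := by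
  have h0 : ∀ η : Plane → ℝ, ∀ hη : IsTest η, inner ℝ (hη.memLp.toLp η) (W.der j p) = 0 := by
    intro η hη
    have h1 := p.2 η hη j
    have h2 : (p : L2 × (Fin 2 → L2)).1 = 0 := hp
    rw [h2, inner_zero_right] at h1
    exact neg_eq_zero.1 h1.symm
  by_contra hne
  have hpos : 0 < ‖W.der j p‖ := norm_pos_iff.2 hne
  obtain ⟨η, hη, hle⟩ := exists_test_near (W.der j p) (half_pos hpos)
  have h1 := real_inner_le_norm (W.der j p - hη.memLp.toLp η) (W.der j p)
  rw [inner_sub_left, h0 η hη, sub_zero, real_inner_self_eq_norm_sq] at h1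
  nlinarith

theorem enr_eq_zero {y : W × W} (h1 : W.val y.1 = 0) (h2 : W.val y.2 = 0) (c : Plane → ℝ) :
    enr c y = 0 := by
  have hp : ∀ (c : Plane → ℝ) (f : L2), pair c 0 f = 0 := fun c f => by
    have := pair_smul_left c 0 0 f
    rwa [zero_smul, zero_mul] at this
  have hd : densL y = 0 := by
    refine Lp.ext ?_
    have z1 := Lp.coeFn_zero ℝ 2 (volume : Measure Plane)
    filter_upwards [good_dens.coeFn_toL2 y, z1] with x h3 h4
    rw [densL, h3, dens, h1, h2, h4]
    simp
  rw [enr, dirichlet, quart, sext, hd, pair_comm _ (densSqL y), der_eq_zero h1, der_eq_zero h1,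
    der_eq_zero h2, der_eq_zero h2, hp, hp, hp]
  ring

/-- One factor `|u|²` is isolated, since its `L²` norm is what becomes small in mean; the cofactor
is merely bounded in `L²`. -/
theorem nre_ae (y : W × W) :
    ∀ᵐ x, nre y x = densL y x * (cubicRe y - W.val y.1 : L2) x := by
  filter_upwards [good_nonlin_re.coeFn_toL2 y, cubicRe_ae y, good_dens.coeFn_toL2 y,
    Lp.coeFn_sub (cubicRe y) (W.val y.1)] with x h1 h2 h3 h4
  rw [nre, h1, h4, Pi.sub_apply, h2, densL, h3, fac]
  ring

theorem nim_ae (y : W × W) :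
    ∀ᵐ x, nim y x = densL y x * (cubicIm y - W.val y.2 : L2) x := by
  filter_upwards [good_nonlin_im.coeFn_toL2 y, cubicIm_ae y, good_dens.coeFn_toL2 y,
    Lp.coeFn_sub (cubicIm y) (W.val y.2)] with x h1 h2 h3 h4
  rw [nim, h1, h4, Pi.sub_apply, h2, densL, h3, fac]
  ring

/-- A bounded curve with finite nets that becomes orthogonal to spreading profiles is small at
some instant. -/
theorem HasNet.eventually_norm_sq_le {f : ℝ → L2} {lam : ℝ → ℝ} (hn : HasNet f lam) {N : ℝ}
    (hN : 0 ≤ N) (hf : ∀ t, ‖f t‖ ≤ N) {c : ℝ}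
    (hw : ∀ h : Plane → ℝ, IsTest h → ∀ ε : ℝ, 0 < ε → ∀ᶠ T : ℝ in atTop, ∀ t ∈ Icc 0 T, ∀ r,
      c * T ≤ r → |∫ x, resc r h x * f t x| ≤ ε) {ε : ℝ} (hε : 0 < ε) :
    ∀ᶠ T : ℝ in atTop, ∀ t ∈ Icc 0 T, c * T ≤ lam t → ‖f t‖ ^ 2 ≤ ε := by
  obtain ⟨F, hF, hFt, hnet⟩ := hn (ε / (2 * (N + 1))) (by positivity)
  have hall := (hF.eventually_all).2 fun h hh => hw h (hFt h hh) (ε / 2) (half_pos hε)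
  filter_upwards [hall] with T hT t ht hl
  obtain ⟨h, hh, hm, hle⟩ := hnet t ht.1
  have h1 := (le_abs_self _).trans (hT h hh t ht (lam t) hl)
  have h2 : inner ℝ (f t - hm.toLp _) (f t) ≤ ε / 2 := by
    refine (real_inner_le_norm _ _).trans ?_
    refine (mul_le_mul hle (hf t) (norm_nonneg _) (by positivity)).trans ?_
    rw [div_mul_eq_mul_div, div_le_div_iff₀ (by positivity) two_pos]
    nlinarith
  -- One copy of `f t` is replaced by the profile from its net at scale `lam t`; finiteness of the
  -- net allows one `T` for all profiles.
  have e : ‖f t‖ ^ 2 = inner ℝ (f t - hm.toLp _) (f t) + ∫ x, resc (lam t) h x * f t x := by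
    rw [← inner_toLp hm, ← inner_add_left, sub_add_cancel, real_inner_self_eq_norm_sq]
  linarith

/-- Times whose scale is comparable to `T` carry arbitrarily little mass, by compactness and weak
evacuation. Mass being conserved, the solution is zero, whose energy is not positive. -/
theorem Trapped.false {φ : Plane → ℝ} {C δ t₀ M K : ℝ} {A B : ℝ → W} {lam : ℝ → ℝ}
    (h : Trapped φ C δ t₀ M K A B lam) : False := by
  obtain ⟨c, hc, hscale⟩ := h.exists_large_scale
  obtain ⟨N₁, h₁, b₁⟩ := (good_dens.mul good_re).exists_norm_toL2_le M
  obtain ⟨N₂, h₂, b₂⟩ := (good_dens.mul good_im).exists_norm_toL2_le M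
  have hM := h.M_nonneg
  set N := N₁ + N₂ + M
  have hN : 0 ≤ N := by positivity
  have hMN : M ≤ N := by simp only [N]; linarith
  have vA : ∀ t, ‖W.val (A t)‖ ≤ M := fun t => (W.norm_val_le _).trans (h.normA t)
  have vB : ∀ t, ‖W.val (B t)‖ ≤ M := fun t => (W.norm_val_le _).trans (h.normB t)
  have hmean : ∀ θ : ℝ, 0 < θ → ∀ᶠ T : ℝ in atTop,
      ∫ t in (0 : ℝ)..T, ‖densL (A t, B t)‖ ^ 2 ≤ θ * T := fun θ hθ => by
    simp only [← quart_eq]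
    exact h.eventually_mean_quart_le hθ
  have hdc : Continuous fun t => densL (A t, B t) := continuous_densL.comp h.continuous_pair
  have wA : ∀ η : Plane → ℝ, IsTest η → ∀ ε : ℝ, 0 < ε → ∀ᶠ T : ℝ in atTop, ∀ t ∈ Icc 0 T, ∀ r,
      c * T ≤ r → |∫ x, resc r η x * W.val (A t) x| ≤ ε := fun η hη ε hε => by
    refine eventually_abs_integral_resc_curve_le hN h.sol.contB h.sol.continuous_nim hdc
      (fun ζ hζ t ht => ?_) (fun t => (vB t).trans hMN)
      (k := fun t => cubicIm (A t, B t) - W.val (B t)) (fun t => ?_) (fun t => nim_ae _) hmean hη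
      hc hε
    · rw [h.sol.eqA ζ hζ t ht]
      exact intervalIntegral.abs_integral_le_integral_abs ht
    · refine (norm_sub_le _ _).trans ?_
      have := b₂ _ (h.bdd t)
      change ‖cubicIm (A t, B t)‖ ≤ N₂ at this
      simp only [N]
      linarith [vB t]
  have wB : ∀ η : Plane → ℝ, IsTest η → ∀ ε : ℝ, 0 < ε → ∀ᶠ T : ℝ in atTop, ∀ t ∈ Icc 0 T, ∀ r,
      c * T ≤ r → |∫ x, resc r η x * W.val (B t) x| ≤ ε := fun η hη ε hε => by
    refine eventually_abs_integral_resc_curve_le hN h.sol.contA h.sol.continuous_nre hdc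
      (fun ζ hζ t ht => ?_) (fun t => (vA t).trans hMN)
      (k := fun t => cubicRe (A t, B t) - W.val (A t)) (fun t => ?_) (fun t => nre_ae _) hmean hη
      hc hε
    · rw [h.sol.eqB ζ hζ t ht, abs_neg]
      exact intervalIntegral.abs_integral_le_integral_abs ht
    · refine (norm_sub_le _ _).trans ?_
      have := b₁ _ (h.bdd t)
      change ‖cubicRe (A t, B t)‖ ≤ N₁ at this
      simp only [N]
      linarith [vA t]
  -- For large `T`, the bounds for both components hold on all of `[0, T]` wherever the scale
  -- exceeds `cT`, in particular at the large-scale instant; mass conservation carries them back to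
  -- time `0`.
  have hmass : ∀ ε : ℝ, 0 < ε → ‖W.val (A 0)‖ ^ 2 + ‖W.val (B 0)‖ ^ 2 ≤ 0 + ε := by
    intro ε hε
    obtain ⟨T, ⟨t, ht, hl⟩, hA, hB⟩ := (hscale.and
      ((h.netA.eventually_norm_sq_le hM vA wA (half_pos hε)).and
        (h.netB.eventually_norm_sq_le hM vB wB (half_pos hε)))).exists
    rw [← h.sol.mass_conservation h.normA h.normB ht.1]
    linarith [hA t ht hl, hB t ht hl]
  have h0 := le_of_forall_pos_le_add hmass
  have hm := h.sol.mass_conservation h.normA h.normB h.start_nonneg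
  have zA : W.val (A t₀) = 0 := by
    refine norm_eq_zero.1 (pow_eq_zero_iff two_ne_zero |>.1 ?_)
    nlinarith [sq_nonneg ‖W.val (A t₀)‖, sq_nonneg ‖W.val (B t₀)‖]
  have zB : W.val (B t₀) = 0 := by
    refine norm_eq_zero.1 (pow_eq_zero_iff two_ne_zero |>.1 ?_)
    nlinarith [sq_nonneg ‖W.val (A t₀)‖, sq_nonneg ‖W.val (B t₀)‖]
  have he := h.energy t₀ le_rfl
  rw [enr_eq_zero (y := (A t₀, B t₀)) zA zB] at he
  exact lt_asymm he h.delta_pos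

end CubicQuintic

/-! ### Times of small localized energy, and the proposition -/

namespace CubicQuintic

theorem exists_small_energy {φ : Plane → ℝ} (hφ : IsCutoff φ) {u : ℝ → H1} (hu : IsSolution u)
    (hr : ∀ t : ℝ, 0 ≤ t → IsRadial (u t)) {M : ℝ} (hb : BoundedBy u M) {lam : ℝ → ℝ}
    (hl : IsScaleFunction u lam) {C : ℝ} (hC : 0 < C) {δ t₀ : ℝ} (hδ : 0 < δ) (ht₀ : 0 ≤ t₀) :
    ∃ t, t₀ ≤ t ∧ ∫ x, energyDensity φ (C * lam t) (u t) x ≤ δ := by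
  by_contra hcon
  push Not at hcon
  obtain ⟨K, hK, hV⟩ := exists_virial_bound M
  have hm : ∀ t : ℝ, (0 : ℝ) ≤ max t 0 := fun t => le_max_right _ _
  have hbd : ∀ t, ‖parts (u (max t 0))‖ ≤ M := fun t => (norm_parts_le _).trans (hb _ (hm t))
  have h : Trapped φ C δ t₀ M K (fun t => (parts (u (max t 0))).1)
      (fun t => (parts (u (max t 0))).2) lam :=
    { sol := hu.realSol
      bdd := hbd
      one_le := hl.1
      netA := hl.hasNet _
      netB := hl.hasNet _
      isCutoff := hφ
      C_pos := hC
      delta_pos := hδ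
      start_nonneg := ht₀
      energy := fun t ht => by
        have := hcon t ht
        rw [(integral_energyDensity hφ _ _).2] at this
        rw [max_eq_left (ht₀.trans ht)]
        exact this
      K_pos := hK
      virial := fun T R hT hR => hV _ _ hu.realSol (fun t => isRadial_part _ (hr _ (hm t)))
        (fun t => isRadial_part _ (hr _ (hm t))) hbd T R hT hR _ (isWeight_cutoff hφ R)
        (fun x => hφ.le_one _) fun x hx => cutoff_eq_zero hφ hR hx }
  exact h.false

end CubicQuintic

theorem proposition4p1 (φ : CubicQuintic.Plane → ℝ) (hφ : CubicQuintic.IsCutoff φ) :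
    -- the virial/Morawetz estimate, with a constant depending only on `φ` and the `H¹` bound
    (∀ M : ℝ, ∃ K : ℝ, 0 < K ∧
      ∀ u : ℝ → CubicQuintic.H1, CubicQuintic.IsSolution u →
        (∀ t : ℝ, 0 ≤ t → CubicQuintic.IsRadial (u t)) → CubicQuintic.BoundedBy u M →
        ∀ T R : ℝ, 0 < T → 0 < R →
          (∀ t : ℝ, 0 ≤ t → Integrable (CubicQuintic.virialDensity φ R (u t))) ∧
          IntervalIntegrable (fun t => ∫ x, CubicQuintic.virialDensity φ R (u t) x) volume 0 T ∧
          ∫ t in (0 : ℝ)..T, ∫ x, CubicQuintic.virialDensity φ R (u t) x ≤ K * (R + R⁻¹ * T)) ∧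
    -- energy evacuation, for solutions that are compact modulo the scale function `lam`
    (∀ u : ℝ → CubicQuintic.H1, CubicQuintic.IsSolution u →
      (∀ t : ℝ, 0 ≤ t → CubicQuintic.IsRadial (u t)) → (∃ M : ℝ, CubicQuintic.BoundedBy u M) →
      CubicQuintic.InfiniteL4 u →
      ∀ lam : ℝ → ℝ, CubicQuintic.IsScaleFunction u lam →
      ∀ C : ℝ, 0 < C →
        ∃ t : ℕ → ℝ, (∀ n, 0 ≤ t n) ∧ Tendsto t atTop atTop ∧
          (∀ n, Integrable (CubicQuintic.energyDensity φ (C * lam (t n)) (u (t n)))) ∧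
          limsup (fun n =>
            ((∫ x, CubicQuintic.energyDensity φ (C * lam (t n)) (u (t n)) x : ℝ) : EReal)) atTop
              ≤ 0) := by
  refine ⟨fun M => CubicQuintic.virial_estimate hφ M, ?_⟩
  rintro u hu hr ⟨M, hb⟩ - lam hl C hC
  -- Threshold `1/(n+1)` and starting time `n`: the former gives the bound on the upper limit, the
  -- latter `t n → ∞`.
  choose t ht hE using fun n : ℕ => CubicQuintic.exists_small_energy hφ hu hr hb hl hC
    (δ := 1 / ((n : ℝ) + 1)) (t₀ := n) (by positivity) n.cast_nonneg
  refine ⟨t, fun n => n.cast_nonneg.trans (ht n),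
    tendsto_atTop_mono ht tendsto_natCast_atTop_atTop,
    fun n => (CubicQuintic.integral_energyDensity hφ _ _).1, ?_⟩
  -- The upper limit is taken in `EReal`, a complete lattice, so comparison needs no lower bound on
  -- the energies and no default value can interfere.
  have hlim : Tendsto (fun n : ℕ => ((1 / ((n : ℝ) + 1) : ℝ) : EReal)) atTop (𝓝 0) :=
    (continuous_coe_real_ereal.tendsto 0).comp tendsto_one_div_add_atTop_nhds_zero_nat
  rw [← hlim.limsup_eq]
  exact limsup_le_limsup (Eventually.of_forall fun n => EReal.coe_le_coe_iff.2 (hE n))
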